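/- All graphs are finite and undirected; loops and multiple edges are allowed. A bilabelled graph $\mathbf K=(K,\mathbf a,\mathbf b)\in\mathscr G(k,l)$ ($k,l\in\mathbb N_0$) is a graph $K$ with a tuple $\mathbf a=(a_1,\dots,a_k)$ of input vertices and a tuple $\mathbf b=(b_1,\dots,b_l)$ of output vertices of $K$ (repetitions allowed); bilabelled graphs are considered up to isomorphism. For $\mathbf K=(K,\mathbf a,\mathbf b)$, $\mathbf H=(H,\mathbf c,\mathbf d)$ put $\mathbf K\otimes\mathbf H=(K\sqcup H,\mathbf{ac},\mathbf{bd})$, $\mathbf K^*=(K,\mathbf b,\mathbf a)$ and, if $|\mathbf b|=|\mathbf c|$, $\mathbf H\cdot\mathbf K=(H\cdot K,\mathbf a,\mathbf d)$, where $H\cdot K$ arises from $H\sqcup K$ by identifying $b_i$ with $c_i$ for every $i$ (all edges are kept). Let $\mathbf M^{k,l}\in\mathscr G(k,l)$ be the graph with a single vertex $v$ and no edges, with $\mathbf a=(v,\dots,v)$ and $\mathbf b=(v,\dots,v)$. Let $\mathbf X^{k,l}\in\mathscr G(k,l)$ be the star with centre $v_0$ and leaves $v_1,\dots,v_{k+l}$,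 with $\mathbf a=(v_1,\dots,v_k)$ and $\mathbf b=(v_{k+1},\dots,v_{k+l})$. Let $\mathbf 0\in\mathscr G(0,0)$ be the graph with no vertices, and let $\mathbf A\in\mathscr G(1,1)$ consist of two vertices, one the input and the other the output, joined by one edge. A graph category is a collection of bilabelled graphs that contains $\mathbf M^{1,1}$, $\mathbf M^{0,2}$, $\mathbf 0$ and is closed under tensor product, composition and involution. $\langle S\rangle$ denotes the smallest graph category containing $S$. A two-path contraction of $\mathbf K$ is obtained by contracting the two (distinct, possibly parallel) edges incident with a vertex $v$ of degree two that is neither an input nor an output vertex (contracting a set of edges means deleting them and identifying the ends of each). $\langle S\rangle^{\rm c}$ denotes the smallest graph category containing $S$ that is closed under two-path contraction. Given $\mathbf K\in\mathscr G(k,l)$, let $K^\circ$ be the graph obtained from $K$ by adding a cycle $\alpha_k,\dots,\alpha_1,\beta_1,\dots,\beta_l$ of new vertices (empty, a loop or a double edge if $k+l=0,1,2$) and the edges $a_i\alpha_i$, $b_j\beta_j$ for all $i,j$, and let $K^\odot$ be obtained from $K^\circ$ by adding one more vertex adjacent to every vertex of this cycle. $\mathbf K$ is called planar if $K^\odot$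 is a planar graph. The extended degree $\tilde d_v$ of a vertex $v$ of $K$ is its degree in $K^\circ$. Proposition. We have $$\langle \mathbf M^{2,2},\ (\mathbf A\otimes\mathbf A)\cdot\mathbf M^{2,2}\cdot(\mathbf A\otimes\mathbf A)\rangle^{\rm c}=\langle\mathbf M^{k,l},\mathbf X^{k,l}\mid k,l\in\mathbb N_0,\ k+l\text{ even}\rangle=\mathscr C,$$ where $\mathscr C$ consists of all bilabelled graphs $\mathbf K=(K,\mathbf a,\mathbf b)$, with any numbers $k,l\in\mathbb N_0$ of inputs and outputs, such that (i) $\mathbf K$ is planar, (ii) $\tilde d_v$ is even for all vertices $v$ of $K$, and (iii) $K$ is bipartite and all the vertices $a_1,\dots,a_k,b_1,\dots,b_l$ lie in one of the two parts. -/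

import Mathlib

/-- A finite undirected graph in which loops and multiple edges are allowed, with vertex type `V`
and edge type `E`: each edge has an unordered pair of end vertices. -/
structure Multigraph (V E : Type) where
  ends : E → Sym2 V

namespace Multigraph

variable {V E : Type}

/-- The degree of a vertex: the number of incident edges, loops being counted twice. -/
noncomputable def degree (G : Multigraph V E) (v : V) : ℕ :=
  Nat.card {e : E // v ∈ G.ends e} + Nat.card {e : E // G.ends e = s(v, v)}

/-- The involution on the darts (half-edges) exchanging the two darts of every edge. -/
def flip (E : Type) : Equiv.Perm (E × Bool) :=
  (Equiv.refl E).prodCongr Equiv.boolNot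

/-- A combinatorial embedding of a graph into a closed oriented surface: every edge consists of two
darts `(e, false)` and `(e, true)`, each issuing from one end of `e`, and the darts issuing
from one and the same vertex are arranged in a cyclic order, given by the permutation `rot`. -/
structure Embedding (G : Multigraph V E) where
  src : E × Bool → V
  ends_eq : ∀ e, G.ends e = s(src (e, false), src (e, true))
  rot : Equiv.Perm (E × Bool)
  sameCycle_rot_iff : ∀ d d', rot.SameCycle d d' ↔ src d = src d'

namespace Embedding

variable {G : Multigraph V E} (ε : G.Embedding)

/-- The permutation of the darts whose orbits are the boundary walks of the faces: pass to the other
end of the edge, then to the next dart around that vertex. -/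
def face : Equiv.Perm (E × Bool) := ε.rot * flip E

/-- The number of non-isolated vertices, i.e. of orbits of `rot`. -/
noncomputable def numVertices : ℕ :=
  Nat.card (Quotient (Equiv.Perm.SameCycle.setoid ε.rot))

/-- The number of faces, i.e. of orbits of `face`, each connected component of the graph being
embedded into a surface of its own. -/
noncomputable def numFaces : ℕ :=
  Nat.card (Quotient (Equiv.Perm.SameCycle.setoid ε.face))

/-- The number of connected components that are not isolated vertices. -/
noncomputable def numComponents : ℕ :=
  Nat.card (Quot fun d d' : E × Bool => d' = ε.rot d ∨ d' = flip E d)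

/-- Euler's formula `#vertices - #edges + #faces = 2 #components`. Since the left side is at most
two on every component, it says that every component is embedded into a sphere. -/
def IsSpherical : Prop :=
  ε.numVertices + ε.numFaces = Nat.card E + 2 * ε.numComponents

end Embedding

/-- A (finite) graph is planar if it can be embedded into the sphere, equivalently, into the
plane. Isolated vertices do not matter, and the components can be embedded one by one. -/
def IsPlanar (G : Multigraph V E) : Prop :=
  ∃ ε : G.Embedding, ε.IsSpherical

end Multigraph

/-- A bilabelled graph `(K, a, b)` with `k` input vertices `a` and `l` output vertices `b`. -/
structure BilabelledGraph (k l : ℕ) where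
  V : Type
  E : Type
  finiteV : Finite V
  finiteE : Finite E
  graph : Multigraph V E
  a : Fin k → V
  b : Fin l → V

namespace BilabelledGraph

/-- Isomorphism of bilabelled graphs. -/
def Iso {k l : ℕ} (K H : BilabelledGraph k l) : Prop :=
  ∃ (φ : K.V ≃ H.V) (ψ : K.E ≃ H.E),
    (∀ e, H.graph.ends (ψ e) = (K.graph.ends e).map φ) ∧
    (∀ i, φ (K.a i) = H.a i) ∧ (∀ j, φ (K.b j) = H.b j)

/-- The tensor product `K ⊗ H = (K ⊔ H, ac, bd)`. -/
def tensor {k l k' l' : ℕ} (K : BilabelledGraph k l) (H : BilabelledGraph k' l') :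
    BilabelledGraph (k + k') (l + l') where
  V := K.V ⊕ H.V
  E := K.E ⊕ H.E
  finiteV := by
    have := K.finiteV
    have := H.finiteV
    infer_instance
  finiteE := by
    have := K.finiteE
    have := H.finiteE
    infer_instance
  graph := ⟨Sum.elim (fun e => (K.graph.ends e).map Sum.inl)
    (fun e => (H.graph.ends e).map Sum.inr)⟩
  a := Fin.append (Sum.inl ∘ K.a) (Sum.inr ∘ H.a)
  b := Fin.append (Sum.inl ∘ K.b) (Sum.inr ∘ H.b)

/-- The pairs of vertices of `H ⊔ K` identified in the composition `H · K`: the `i`-th output of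
`K` with the `i`-th input of `H`. -/
def GlueRel {k m l : ℕ} (H : BilabelledGraph m l) (K : BilabelledGraph k m)
    (x y : H.V ⊕ K.V) : Prop :=
  ∃ i : Fin m, x = Sum.inl (H.a i) ∧ y = Sum.inr (K.b i)

/-- The composition `H · K`, with the inputs of `K` and the outputs of `H`; all edges are kept. -/
def comp {k m l : ℕ} (H : BilabelledGraph m l) (K : BilabelledGraph k m) :
    BilabelledGraph k l where
  V := Quot (GlueRel H K)
  E := H.E ⊕ K.E
  finiteV := by
    have := K.finiteV
    have := H.finiteV
    exact Finite.of_surjective (Quot.mk (GlueRel H K)) Quot.mk_surjective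
  finiteE := by
    have := K.finiteE
    have := H.finiteE
    infer_instance
  graph := ⟨Sum.elim (fun e => (H.graph.ends e).map (fun v => Quot.mk _ (Sum.inl v)))
    (fun e => (K.graph.ends e).map (fun v => Quot.mk _ (Sum.inr v)))⟩
  a := fun i => Quot.mk _ (Sum.inr (K.a i))
  b := fun j => Quot.mk _ (Sum.inl (H.b j))

/-- The involution `K* = (K, b, a)`. -/
def invol {k l : ℕ} (K : BilabelledGraph k l) : BilabelledGraph l k where
  V := K.V
  E := K.E
  finiteV := K.finiteV
  finiteE := K.finiteE
  graph := K.graph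
  a := K.b
  b := K.a

/-- The bilabelled graph `0` with no vertices. -/
def null : BilabelledGraph 0 0 where
  V := Empty
  E := Empty
  finiteV := inferInstance
  finiteE := inferInstance
  graph := ⟨Empty.elim⟩
  a := Fin.elim0
  b := Fin.elim0

/-- `M k l` has one vertex and no edges; the vertex is `k` times an input, `l` times an output. -/
def M (k l : ℕ) : BilabelledGraph k l where
  V := Unit
  E := Empty
  finiteV := inferInstance
  finiteE := inferInstance
  graph := ⟨Empty.elim⟩
  a := fun _ => ()
  b := fun _ => ()

/-- `X k l` is the star with centre `none` and `k + l` leaves; the first `k` leaves are the inputs,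
the last `l` leaves are the outputs. -/
def X (k l : ℕ) : BilabelledGraph k l where
  V := Option (Fin (k + l))
  E := Fin (k + l)
  finiteV := inferInstance
  finiteE := inferInstance
  graph := ⟨fun i => s(none, some i)⟩
  a := fun i => some (Fin.castAdd l i)
  b := fun j => some (Fin.natAdd k j)

/-- A single edge; one end is the input, the other end is the output. -/
def edge : BilabelledGraph 1 1 where
  V := Bool
  E := Unit
  finiteV := inferInstance
  finiteE := inferInstance
  graph := ⟨fun _ => s(false, true)⟩
  a := fun _ => false
  b := fun _ => true

/-- `(edge ⊗ edge) · M 2 2 · (edge ⊗ edge)`: the connecter with its four strings replaced by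
edges. -/
def edgeConnecter : BilabelledGraph 2 2 :=
  ((edge.tensor edge).comp (M 2 2)).comp (edge.tensor edge)

/-- The labels in the cyclic order `a_k, …, a_1, b_1, …, b_l`. -/
def boundary {k l : ℕ} (K : BilabelledGraph k l) : Fin (k + l) → K.V :=
  Fin.append (fun i : Fin k => K.a i.rev) K.b

/-- The graph `K°`: add the enveloping cycle `α_k, …, α_1, β_1, …, β_l` of new vertices (a loop if
`k + l = 1`, a double edge if `k + l = 2`), and join `α_i` to `a_i` and `β_j` to `b_j`. -/
def enveloped {k l : ℕ} (K : BilabelledGraph k l) :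
    Multigraph (K.V ⊕ Fin (k + l)) (K.E ⊕ (Fin (k + l) ⊕ Fin (k + l))) :=
  ⟨Sum.elim (fun e => (K.graph.ends e).map Sum.inl)
    (Sum.elim (fun i => s(Sum.inl (K.boundary i), Sum.inr i))
      (fun i => s(Sum.inr i, Sum.inr (finRotate (k + l) i))))⟩

/-- The graph `K^⊙`: add to `K°` one more vertex adjacent to all vertices of the enveloping
cycle. -/
def capped {k l : ℕ} (K : BilabelledGraph k l) :
    Multigraph ((K.V ⊕ Fin (k + l)) ⊕ Unit)
      ((K.E ⊕ (Fin (k + l) ⊕ Fin (k + l))) ⊕ Fin (k + l)) :=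
  ⟨Sum.elim (fun e => (K.enveloped.ends e).map Sum.inl)
    (fun i => s(Sum.inl (Sum.inr i), Sum.inr ()))⟩

/-- A bilabelled graph `K` is planar if the graph `K^⊙` is planar. -/
def IsPlanar {k l : ℕ} (K : BilabelledGraph k l) : Prop :=
  K.capped.IsPlanar

/-- The extended degree of a vertex: its degree in `K°`. -/
noncomputable def extDegree {k l : ℕ} (K : BilabelledGraph k l) (v : K.V) : ℕ :=
  K.enveloped.degree (Sum.inl v)

/-- `K` is bipartite, with all input and output vertices in one of the parts. -/
def IsLabelBipartite {k l : ℕ} (K : BilabelledGraph k l) : Prop :=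
  ∃ part : Set K.V,
    (∀ e u v, K.graph.ends e = s(u, v) → (u ∈ part ↔ v ∉ part)) ∧
    (∀ i, K.a i ∈ part) ∧ (∀ j, K.b j ∈ part)

/-- A vertex is inner if it is neither an input nor an output vertex. -/
def IsInner {k l : ℕ} (K : BilabelledGraph k l) (v : K.V) : Prop :=
  (∀ i, K.a i ≠ v) ∧ (∀ j, K.b j ≠ v)

/-- Contraction of a set `T` of edges: the edges in `T` disappear and their ends are identified. -/
def contract {k l : ℕ} (K : BilabelledGraph k l) (T : Set K.E) : BilabelledGraph k l where
  V := Quot fun x y : K.V => ∃ e ∈ T, K.graph.ends e = s(x, y)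
  E := {e : K.E // e ∉ T}
  finiteV := by
    have := K.finiteV
    exact Finite.of_surjective (Quot.mk _) Quot.mk_surjective
  finiteE := by
    have := K.finiteE
    infer_instance
  graph := ⟨fun e => (K.graph.ends e.1).map (Quot.mk _)⟩
  a := fun i => Quot.mk _ (K.a i)
  b := fun j => Quot.mk _ (K.b j)

end BilabelledGraph

/-- Collections of bilabelled graphs, with arbitrary numbers of inputs and outputs. -/
abbrev GraphCollection : Type 1 := Set (Σ k l : ℕ, BilabelledGraph k l)

open BilabelledGraph in
/-- Graph categories. Bilabelled graphs are considered up to isomorphism, so collections of them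
have to be invariant under isomorphism. -/
structure IsGraphCategory (C : GraphCollection) : Prop where
  iso_mem : ∀ {k l : ℕ} {K H : BilabelledGraph k l}, Iso K H → ⟨k, l, K⟩ ∈ C → ⟨k, l, H⟩ ∈ C
  id_mem : ⟨1, 1, M 1 1⟩ ∈ C
  dual_mem : ⟨0, 2, M 0 2⟩ ∈ C
  null_mem : ⟨0, 0, null⟩ ∈ C
  tensor_mem : ∀ {k l k' l' : ℕ} {K : BilabelledGraph k l} {H : BilabelledGraph k' l'},
    ⟨k, l, K⟩ ∈ C → ⟨k', l', H⟩ ∈ C → ⟨k + k', l + l', K.tensor H⟩ ∈ C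
  comp_mem : ∀ {k m l : ℕ} {H : BilabelledGraph m l} {K : BilabelledGraph k m},
    ⟨m, l, H⟩ ∈ C → ⟨k, m, K⟩ ∈ C → ⟨k, l, H.comp K⟩ ∈ C
  invol_mem : ∀ {k l : ℕ} {K : BilabelledGraph k l}, ⟨k, l, K⟩ ∈ C → ⟨l, k, K.invol⟩ ∈ C

/-- Closedness under two-path contraction: the two edges incident with an inner vertex `v` of degree
two may be contracted. (The degree excludes loops at `v`; the two edges may be parallel.) -/
def IsTwoPathClosed (C : GraphCollection) : Prop :=
  ∀ {k l : ℕ} (K : BilabelledGraph k l) (v : K.V) (e f : K.E),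
    K.IsInner v → K.graph.degree v = 2 → e ≠ f → v ∈ K.graph.ends e → v ∈ K.graph.ends f →
    ⟨k, l, K⟩ ∈ C → ⟨k, l, K.contract {e, f}⟩ ∈ C

/-- The smallest graph category containing `S`. -/
def generatedCategory (S : GraphCollection) : GraphCollection :=
  {K | ∀ C : GraphCollection, IsGraphCategory C → S ⊆ C → K ∈ C}

/-- The smallest graph category containing `S` that is closed under two-path contraction. -/
def contractionClosure (S : GraphCollection) : GraphCollection :=
  {K | ∀ C : GraphCollection, IsGraphCategory C → IsTwoPathClosed C → S ⊆ C → K ∈ C}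

/-! Planarity is treated with permutations. For two permutations `σ`, `τ` of a finite set of darts,
`defect σ τ` is twice the total genus of the hypermap whose vertices, hyperedges and faces are the
cycles of `σ`, `τ` and `σ * τ`. Multiplying `τ` by a transposition joins or splits cycles, and the
change of the defect is a matter of counting: a join never lowers it, and preserves it if the two
points lie on one face or in different components (`defect_mul_swap`). Hence taking points out of
their cycles never raises the genus, and Euler's inequality follows by taking out all of them.

A bilabelled graph is planar exactly if it can be drawn in a disc with its labels on the boundary in
cyclic order. In a `Diagram` the boundary is one additional hyperedge passing through the label
positions. The equivalence with planarity of the capped graph is `isPlanar_iff`. In one direction a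
wheel is attached to the boundary without raising the genus (`defect_cap_le`). In the other
direction the rotation at the hub of a wheel in the sphere has to follow the rim (`wheel_rot`), and
when the wheel is erased, the cycle at its hub survives as the boundary.

The contraction closure lies in 𝒞: the three conditions are the case of colour `true` on all labels
of a property `IsTame`, which allows any colours of the labels. A composition is a disjoint union
followed by joining neighbouring labels of equal colour, the innermost pair first. A two-path
contraction contracts two edges and changes the colour of the vertex between them. So 𝒞 is a graph
category closed under two-path contraction, and it contains both generators.

𝒞 lies in the category generated by the `M` and `X`: inputs can be bent to outputs, and the outputs
can be rotated, so that membership concerns graphs with a cyclic word of labels. Edges are cut one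
by one, the ends becoming labels (`IsTame.cut`). An end of colour `true` stays a label, an end of
colour `false` obtains a pendant edge whose leaf is the label; capping this leaf with the opposite
end restores the edge. When no edges are left, the vertices form a noncrossing partition of the
labels into blocks of even size. One block is an interval (`exists_interval`); it is an `M` or an
`X`, depending on the colour, and splits off as a tensor factor.

The `M` and `X` lie in the contraction closure: copies of `M 2 2` glued together give all `M`, and
the second generator is isomorphic to `X 2 2`. Joining a leaf of one star with a leaf of another one
and contracting the resulting two-path fuses the two centres (`InCat.star_append`), which yields all
larger stars. These three inclusions form a cycle. -/

open Equiv

namespace Hypermap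

/-! ### Joining two classes of an equivalence relation -/

section Merge

variable {α : Type*}

/-- The equivalence relation obtained from `r` by joining the classes of `x` and `y`. -/
def merge (r : Setoid α) (x y : α) : Setoid α where
  r a b := r a b ∨ (r a x ∧ r y b) ∨ (r a y ∧ r x b)
  iseqv := by
    refine ⟨fun a => Or.inl (r.refl a), ?_, ?_⟩
    · rintro a b (h | ⟨h, h'⟩ | ⟨h, h'⟩)
      · exact Or.inl (r.symm h)
      · exact Or.inr (Or.inr ⟨r.symm h', r.symm h⟩)
      · exact Or.inr (Or.inl ⟨r.symm h', r.symm h⟩)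
    · rintro a b c (h | ⟨h, h'⟩ | ⟨h, h'⟩) (k | ⟨k, k'⟩ | ⟨k, k'⟩)
      · exact Or.inl (r.trans h k)
      · exact Or.inr (Or.inl ⟨r.trans h k, k'⟩)
      · exact Or.inr (Or.inr ⟨r.trans h k, k'⟩)
      · exact Or.inr (Or.inl ⟨h, r.trans h' k⟩)
      · exact Or.inr (Or.inl ⟨h, k'⟩)
      · exact Or.inl (r.trans h k')
      · exact Or.inr (Or.inr ⟨h, r.trans h' k⟩)
      · exact Or.inl (r.trans h k')
      · exact Or.inr (Or.inr ⟨h, k'⟩)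

theorem merge_apply {r : Setoid α} {x y a b : α} :
    merge r x y a b ↔ r a b ∨ (r a x ∧ r y b) ∨ (r a y ∧ r x b) := Iff.rfl

theorem le_merge (r : Setoid α) (x y : α) : r ≤ merge r x y := fun _ _ h => Or.inl h

theorem merge_rel (r : Setoid α) (x y : α) : merge r x y x y :=
  Or.inr (Or.inl ⟨r.refl x, r.refl y⟩)

theorem merge_le {r s : Setoid α} {x y : α} (h : r ≤ s) (hxy : s x y) : merge r x y ≤ s := by
  rintro a b (k | ⟨k, k'⟩ | ⟨k, k'⟩)
  · exact h k
  · exact s.trans (h k) (s.trans hxy (h k'))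
  · exact s.trans (h k) (s.trans (s.symm hxy) (h k'))

theorem merge_eq_self {r : Setoid α} {x y : α} (h : r x y) : merge r x y = r :=
  le_antisymm (merge_le le_rfl h) (le_merge r x y)

/-- The classes other than that of `y` represent every merged class exactly once, the joined class
being represented by the class of `x`. -/
theorem card_merge [Finite α] {r : Setoid α} {x y : α} (h : ¬ r x y) :
    Nat.card (Quotient (merge r x y)) + 1 = Nat.card (Quotient r) := by
  classical
  have e : {q : Quotient r // q ≠ Quotient.mk r y} ≃ Quotient (merge r x y) := by
    refine Equiv.ofBijective (fun q => Quotient.map' id (fun a b hab => Or.inl hab) q.1) ⟨?_, ?_⟩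
    · rintro ⟨p, hp⟩ ⟨q, hq⟩ hpq
      induction p using Quotient.inductionOn with | _ a
      induction q using Quotient.inductionOn with | _ b
      have hab : merge r x y a b := Quotient.exact hpq
      rcases hab with k | ⟨k, k'⟩ | ⟨k, k'⟩
      · exact Subtype.ext (Quotient.sound k)
      · exact absurd (Quotient.sound (r.symm k')) hq
      · exact absurd (Quotient.sound k) hp
    · intro q
      induction q using Quotient.inductionOn with | _ a
      by_cases ha : r a y
      · refine ⟨⟨Quotient.mk r x, fun hx => h (Quotient.exact hx)⟩, ?_⟩
        exact Quotient.sound (Or.inr (Or.inl ⟨r.refl x, r.symm ha⟩))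
      · exact ⟨⟨Quotient.mk r a, fun hx => ha (Quotient.exact hx)⟩, rfl⟩
  have : Fintype (Quotient r) := Fintype.ofFinite _
  rw [← Nat.card_congr e, Nat.card_eq_fintype_card, Nat.card_eq_fintype_card,
    Fintype.card_subtype_compl, Fintype.card_subtype_eq]
  have : 0 < Fintype.card (Quotient r) := Fintype.card_pos_iff.2 ⟨Quotient.mk r x⟩
  omega

/-- Every class meets the given finite set. -/
theorem card_quotient_le [Finite α] (r : Setoid α) (S : Finset α) (h : ∀ a, ∃ s ∈ S, r s a) :
    Nat.card (Quotient r) ≤ S.card := by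
  have : Function.Surjective (fun s : S => Quotient.mk r s.1) := by
    intro q
    induction q using Quotient.inductionOn with | _ a
    obtain ⟨s, hs, hsa⟩ := h a
    exact ⟨⟨s, hs⟩, Quotient.sound hsa⟩
  simpa using Nat.card_le_card_of_surjective _ this

end Merge

/-! ### Cycles, components and genus of a pair of permutations -/

variable {D : Type*}

/-- The number of cycles of a permutation, fixed points included. -/
noncomputable def cyc (σ : Perm D) : ℕ := Nat.card (Quotient (Perm.SameCycle.setoid σ))

/-- The partition into orbits of the group generated by two permutations. -/
def conn (σ τ : Perm D) : Setoid D := Relation.EqvGen.setoid fun d d' => d' = σ d ∨ d' = τ d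

theorem conn_left (σ τ : Perm D) (d : D) : conn σ τ d (σ d) := .rel _ _ (Or.inl rfl)

theorem conn_right (σ τ : Perm D) (d : D) : conn σ τ d (τ d) := .rel _ _ (Or.inr rfl)

theorem conn_le {σ τ : Perm D} {s : Setoid D} (h : ∀ d, s d (σ d)) (h' : ∀ d, s d (τ d)) :
    conn σ τ ≤ s := by
  intro a b hab
  induction hab with
  | rel a b hab => rcases hab with rfl | rfl; exacts [h _, h' _]
  | refl a => exact s.refl a
  | symm a b _ ih => exact s.symm ih
  | trans a b c _ _ ih ih' => exact s.trans ih ih'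

/-- The working tool for invariants: points of one cycle agree in some respect as soon as `d` and `σ
d` do, where `s` is often a `Setoid.comap`. `conn_le` plays the same role for components. -/
theorem sameCycle_le {σ : Perm D} {s : Setoid D} (h : ∀ d, s d (σ d)) :
    Perm.SameCycle.setoid σ ≤ s := by
  rintro a b ⟨i, rfl⟩
  have key : ∀ (n : ℕ) (a : D), s a ((σ ^ n) a) := by
    intro n
    induction n with
    | zero => exact fun a => s.refl a
    | succ n ih => intro a; rw [pow_succ']; exact s.trans (ih a) (h _)
  rcases i with n | n
  · exact key n a
  · have := key (n + 1) ((σ ^ (Int.negSucc n)) a)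
    rw [← Perm.mul_apply] at this
    simpa [zpow_negSucc] using s.symm this

theorem sameCycle_apply (σ : Perm D) (d : D) : σ.SameCycle d (σ d) :=
  ⟨1, by simp⟩

theorem conn_of_sameCycle_left {σ : Perm D} (τ : Perm D) {a b : D} (h : σ.SameCycle a b) :
    conn σ τ a b := sameCycle_le (conn_left σ τ) h

theorem conn_of_sameCycle_right (σ : Perm D) {τ : Perm D} {a b : D} (h : τ.SameCycle a b) :
    conn σ τ a b := sameCycle_le (conn_right σ τ) h

theorem conn_comm (σ τ : Perm D) : conn σ τ = conn τ σ :=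
  le_antisymm (conn_le (conn_right _ _) (conn_left _ _)) (conn_le (conn_right _ _) (conn_left _ _))

/-- The number of orbits of the group generated by two permutations. -/
noncomputable def comps (σ τ : Perm D) : ℕ := Nat.card (Quotient (conn σ τ))

/-- Twice the sum of the genera of the components of the hypermap given by two permutations. -/
noncomputable def defect (σ τ : Perm D) : ℤ :=
  Nat.card D + 2 * comps σ τ - cyc σ - cyc τ - cyc (σ * τ)

theorem comps_comm (σ τ : Perm D) : comps σ τ = comps τ σ := by rw [comps, comps, conn_comm]

theorem cyc_inv (σ : Perm D) : cyc σ⁻¹ = cyc σ := by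
  rw [cyc, cyc]
  congr 2
  ext a b
  exact Perm.sameCycle_inv

/-- Permutations intertwined by a bijection have equally many cycles. -/
theorem cyc_congr {D' : Type*} (e : D ≃ D') {σ : Perm D} {σ' : Perm D'}
    (h : ∀ d, e (σ d) = σ' (e d)) : cyc σ = cyc σ' := by
  have h' : ∀ d, e.symm (σ' d) = σ (e.symm d) := fun d => by
    apply e.injective; rw [h]; simp
  refine Nat.card_congr (Quotient.congr e fun a b => ⟨fun hab => ?_, fun hab => ?_⟩)
  · exact sameCycle_le (s := (Perm.SameCycle.setoid σ').comap e)
      (fun d => by rw [Setoid.comap_rel, h]; exact sameCycle_apply _ _) hab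
  · have := sameCycle_le (s := (Perm.SameCycle.setoid σ).comap e.symm)
      (fun d => by rw [Setoid.comap_rel, h']; exact sameCycle_apply _ _) hab
    rw [Setoid.comap_rel] at this
    simpa using this

theorem cyc_mul_comm (σ τ : Perm D) : cyc (σ * τ) = cyc (τ * σ) :=
  cyc_congr τ fun d => by simp

theorem defect_comm (σ τ : Perm D) : defect σ τ = defect τ σ := by
  rw [defect, defect, comps_comm, cyc_mul_comm]; ring

theorem defect_inv (σ τ : Perm D) : defect σ⁻¹ τ⁻¹ = defect σ τ := by
  have h : comps σ⁻¹ τ⁻¹ = comps σ τ := by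
    rw [comps, comps]
    congr 2
    refine le_antisymm (conn_le (fun d => ?_) fun d => ?_) (conn_le (fun d => ?_) fun d => ?_)
    · exact Setoid.symm' _ (by simpa using conn_left σ τ (σ⁻¹ d))
    · exact Setoid.symm' _ (by simpa using conn_right σ τ (τ⁻¹ d))
    · exact Setoid.symm' _ (by simpa using conn_left σ⁻¹ τ⁻¹ (σ d))
    · exact Setoid.symm' _ (by simpa using conn_right σ⁻¹ τ⁻¹ (τ d))
  rw [defect, defect, h, cyc_inv, cyc_inv, ← mul_inv_rev, cyc_inv, cyc_mul_comm]

/-- Triality: the roles of the three permutations with product one can be exchanged. -/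
theorem defect_inv_mul (σ τ : Perm D) : defect σ⁻¹ (σ * τ) = defect σ τ := by
  have h : comps σ⁻¹ (σ * τ) = comps σ τ := by
    rw [comps, comps]
    congr 2
    have h1 : ∀ d, conn σ τ (σ⁻¹ d) d := fun d => by simpa using conn_left σ τ (σ⁻¹ d)
    have h2 : ∀ d, conn σ⁻¹ (σ * τ) (σ d) d := fun d => by
      simpa using conn_left σ⁻¹ (σ * τ) (σ d)
    refine le_antisymm (conn_le (fun d => ?_) fun d => ?_) (conn_le (fun d => ?_) fun d => ?_)
    · exact Setoid.symm' _ (h1 d)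
    · exact Setoid.trans' _ (conn_right σ τ d) (conn_left σ τ _)
    · exact Setoid.symm' _ (h2 d)
    · exact Setoid.trans' _ (conn_right σ⁻¹ (σ * τ) d) (h2 _)
  rw [defect, defect, h, cyc_inv, inv_mul_cancel_left]; ring

/-! ### Transpositions, erasing of points, and Euler's inequality -/

section Swap

variable [Finite D] [DecidableEq D]

omit [Finite D] in
theorem swap_self_one (x : D) : swap x x = (1 : Perm D) := swap_self x

/-- From `y` the product jumps to `τ x` and then follows the `τ`-cycle of `x` until it reaches `x`,
so the two cycles become one. -/
theorem sameCycle_mul_swap {τ : Perm D} {x y : D} (h : ¬ τ.SameCycle x y) :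
    Perm.SameCycle.setoid (τ * swap x y) = merge (Perm.SameCycle.setoid τ) x y := by
  have hxy : x ≠ y := fun e => h (e ▸ Perm.SameCycle.refl _ _)
  have key : ∀ u v : D, u ≠ v → ¬ τ.SameCycle u v → (τ * swap u v).SameCycle u v := by
    intro u v huv h
    have step : ∀ n : ℕ, (τ * swap u v).SameCycle v ((τ ^ (n + 1)) u) := by
      intro n
      induction n with
      | zero => simpa using sameCycle_apply (τ * swap u v) v
      | succ n ih =>
        by_cases hu : (τ ^ (n + 1)) u = u
        · rw [pow_succ', Perm.mul_apply, hu]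
          simpa using sameCycle_apply (τ * swap u v) v
        · have hv : (τ ^ (n + 1)) u ≠ v := fun e => h ⟨(n + 1 : ℕ), by rw [zpow_natCast, e]⟩
          refine ih.trans ?_
          have := sameCycle_apply (τ * swap u v) ((τ ^ (n + 1)) u)
          rwa [Perm.mul_apply, swap_apply_of_ne_of_ne hu hv, ← Perm.mul_apply, ← pow_succ'] at this
    have := step (orderOf τ - 1)
    rw [Nat.sub_add_cancel (orderOf_pos τ), pow_orderOf_eq_one] at this
    exact this.symm
  have hm := key x y hxy h
  apply le_antisymm
  · refine sameCycle_le fun d => ?_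
    rw [Perm.mul_apply]
    rcases eq_or_ne d x with rfl | hdx
    · rw [swap_apply_left]
      exact Or.inr (Or.inl ⟨.refl _ _, sameCycle_apply _ _⟩)
    · rcases eq_or_ne d y with rfl | hdy
      · rw [swap_apply_right]
        exact Or.inr (Or.inr ⟨.refl _ _, sameCycle_apply _ _⟩)
      · rw [swap_apply_of_ne_of_ne hdx hdy]
        exact Or.inl (sameCycle_apply _ _)
  · refine merge_le (sameCycle_le fun d => ?_) hm
    change (τ * swap x y).SameCycle d (τ d)
    rcases eq_or_ne d x with rfl | hdx
    · exact hm.trans (by simpa using sameCycle_apply (τ * swap d y) y)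
    · rcases eq_or_ne d y with rfl | hdy
      · exact hm.symm.trans (by simpa using sameCycle_apply (τ * swap x d) x)
      · have := sameCycle_apply (τ * swap x y) d
        rwa [Perm.mul_apply, swap_apply_of_ne_of_ne hdx hdy] at this

/-- Let `n` be the first time at which `τ` leads from `x` to `y`. From `y` the product runs through
the arc `τ x, …, τ ^ n x = y` and closes up there; the point `x` is not on this arc. -/
theorem not_sameCycle_mul_swap {τ : Perm D} {x y : D} (hxy : x ≠ y) (h : τ.SameCycle x y) :
    ¬ (τ * swap x y).SameCycle x y := by
  obtain ⟨k, hk⟩ : ∃ k : ℕ, (τ ^ k) x = y := by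
    obtain ⟨k, -, hk⟩ := h.exists_pow_eq'
    exact ⟨k, hk⟩
  classical
  let p : ℕ → Prop := fun k => (τ ^ k) x = y
  have hp : ∃ k, p k := ⟨k, hk⟩
  set n := Nat.find hp with hn
  have hny : (τ ^ n) x = y := Nat.find_spec hp
  have hmin : ∀ m < n, (τ ^ m) x ≠ y := fun m hm => Nat.find_min hp hm
  have hx : ∀ m, 0 < m → m ≤ n → (τ ^ m) x ≠ x := by
    intro m h0 hm e
    rcases hm.eq_or_lt with rfl | hm
    · exact hxy (e.symm.trans hny)
    · refine hmin (n - m) (by omega) ?_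
      conv_lhs => rw [← e]
      rw [← Perm.mul_apply, ← pow_add, Nat.sub_add_cancel hm.le, hny]
  have hn0 : 0 < n := by
    rcases Nat.eq_zero_or_pos n with h0 | h0
    · rw [h0] at hny; exact absurd hny hxy
    · exact h0
  have step : ∀ j : ℕ, ∃ m, 0 < m ∧ m ≤ n ∧ ((τ * swap x y) ^ j) y = (τ ^ m) x := by
    intro j
    induction j with
    | zero => exact ⟨n, hn0, le_rfl, by simp [hny]⟩
    | succ j ih =>
      obtain ⟨m, h0, hm, e⟩ := ih
      rw [pow_succ', Perm.mul_apply, e]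
      rcases hm.eq_or_lt with rfl | hm
      · exact ⟨1, one_pos, hn0, by rw [hny]; simp⟩
      · refine ⟨m + 1, by omega, hm, ?_⟩
        rw [Perm.mul_apply, swap_apply_of_ne_of_ne (hx m h0 hm.le) (hmin m hm), pow_succ',
          Perm.mul_apply]
  intro hs
  obtain ⟨j, -, hj⟩ := hs.symm.exists_pow_eq'
  obtain ⟨m, h0, hm, e⟩ := step j
  exact hx m h0 hm (e.symm.trans hj)

theorem cyc_mul_swap_of_not {τ : Perm D} {x y : D} (h : ¬ τ.SameCycle x y) :
    cyc (τ * swap x y) + 1 = cyc τ := by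
  rw [cyc, cyc, sameCycle_mul_swap h]
  exact card_merge h

theorem cyc_mul_swap_of_sameCycle {τ : Perm D} {x y : D} (hxy : x ≠ y) (h : τ.SameCycle x y) :
    cyc (τ * swap x y) = cyc τ + 1 := by
  have := cyc_mul_swap_of_not (not_sameCycle_mul_swap hxy h)
  rw [mul_assoc, swap_mul_self, mul_one] at this
  omega

theorem cyc_mul_swap_le (τ : Perm D) (x y : D) : cyc (τ * swap x y) ≤ cyc τ + 1 := by
  by_cases h : τ.SameCycle x y
  · rcases eq_or_ne x y with rfl | hxy
    · rw [swap_self_one, mul_one]; omega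
    · rw [cyc_mul_swap_of_sameCycle hxy h]
  · have := cyc_mul_swap_of_not h; omega

theorem conn_mul_swap (σ : Perm D) {τ : Perm D} {x y : D} (h : ¬ τ.SameCycle x y) :
    conn σ (τ * swap x y) = merge (conn σ τ) x y := by
  have hs := sameCycle_mul_swap h
  have hle : Perm.SameCycle.setoid τ ≤ Perm.SameCycle.setoid (τ * swap x y) :=
    hs ▸ le_merge _ _ _
  apply le_antisymm
  · refine conn_le (fun d => le_merge _ _ _ (conn_left _ _ _)) fun d => ?_
    have : merge (Perm.SameCycle.setoid τ) x y d ((τ * swap x y) d) :=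
      hs ▸ sameCycle_apply (τ * swap x y) d
    exact merge_le (fun a b hab => le_merge _ _ _ (conn_of_sameCycle_right σ hab))
      (merge_rel _ x y) this
  · refine merge_le (conn_le (conn_left _ _) fun d => ?_) ?_
    · exact conn_of_sameCycle_right σ (hle (sameCycle_apply τ d))
    · have : Perm.SameCycle.setoid (τ * swap x y) x y := hs ▸ merge_rel _ x y
      exact conn_of_sameCycle_right σ this

/-- Joining two cycles does not change the genus if a face is split, or if the two cycles belong
to different components. -/
theorem defect_mul_swap {σ τ : Perm D} {x y : D} (h : ¬ τ.SameCycle x y)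
    (h' : (σ * τ).SameCycle x y ∨ ¬ conn σ τ x y) :
    defect σ (τ * swap x y) = defect σ τ := by
  have h1 := cyc_mul_swap_of_not h
  have hxy : x ≠ y := fun e => h (e ▸ Perm.SameCycle.refl _ _)
  rw [defect, defect, ← mul_assoc, comps, comps, conn_mul_swap σ h]
  by_cases hc : conn σ τ x y
  · have h2 := cyc_mul_swap_of_sameCycle hxy (h'.resolve_right (not_not.2 hc))
    rw [merge_eq_self hc, h2, ← h1]
    push_cast
    ring
  · have h2 : cyc (σ * τ * swap x y) + 1 = cyc (σ * τ) := by
      refine cyc_mul_swap_of_not fun hs => hc ?_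
      refine sameCycle_le (fun d => ?_) hs
      exact Setoid.trans' _ (conn_right σ τ d) (conn_left σ τ _)
    rw [← h1, ← h2, ← card_merge hc]
    push_cast
    ring

/-- If `defect_mul_swap` does not apply, the points lie in one component but on different faces.
Then two faces are merged as well and the defect grows by two, that is, a handle is added. -/
theorem defect_le_defect_mul_swap {σ τ : Perm D} {x y : D} (h : ¬ τ.SameCycle x y) :
    defect σ τ ≤ defect σ (τ * swap x y) := by
  by_cases h' : (σ * τ).SameCycle x y ∨ ¬ conn σ τ x y
  · exact (defect_mul_swap h h').ge
  · rw [not_or, not_not] at h'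
    have h1 := cyc_mul_swap_of_not h
    have h2 := cyc_mul_swap_of_not h'.1
    rw [defect, defect, ← mul_assoc, comps, comps, conn_mul_swap σ h, merge_eq_self h'.2]
    omega

/-- Splitting a cycle does not increase the genus. -/
theorem defect_mul_swap_le (σ : Perm D) {τ : Perm D} {x y : D} (h : τ.SameCycle x y) :
    defect σ (τ * swap x y) ≤ defect σ τ := by
  rcases eq_or_ne x y with rfl | hxy
  · rw [swap_self_one, mul_one]
  · have := defect_le_defect_mul_swap (σ := σ) (not_sameCycle_mul_swap hxy h)
    rwa [mul_assoc, swap_mul_self, mul_one] at this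

/-- Take a point out of its cycle, turning it into a fixed point. -/
def erase (σ : Perm D) (d : D) : Perm D := σ * swap (σ⁻¹ d) d

omit [Finite D] in
theorem erase_self (σ : Perm D) (d : D) : erase σ d d = d := by simp [erase]

omit [Finite D] in
theorem erase_of_apply_eq {σ : Perm D} {d x : D} (h : σ x = d) (hx : x ≠ d) :
    erase σ d x = σ d := by
  subst h; simp [erase]

omit [Finite D] in
theorem erase_of_ne {σ : Perm D} {d x : D} (h : σ x ≠ d) (hx : x ≠ d) : erase σ d x = σ x := by
  rw [erase, Perm.mul_apply, swap_apply_of_ne_of_ne _ hx]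
  rintro rfl
  exact h (by simp)

omit [Finite D] [DecidableEq D] in
theorem sameCycle_inv_apply (σ : Perm D) (d : D) : σ.SameCycle (σ⁻¹ d) d := ⟨1, by simp⟩

theorem defect_erase_le (σ τ : Perm D) (d : D) : defect σ (erase τ d) ≤ defect σ τ :=
  defect_mul_swap_le σ (sameCycle_inv_apply τ d)

theorem cyc_erase_le (σ : Perm D) (d : D) : cyc (erase σ d) ≤ cyc σ + 1 := cyc_mul_swap_le _ _ _

theorem cyc_erase {σ : Perm D} {d : D} (h : σ d ≠ d) : cyc (erase σ d) = cyc σ + 1 :=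
  cyc_mul_swap_of_sameCycle (fun e => h (by conv_lhs => rw [← e]
                                            simp)) (sameCycle_inv_apply σ d)

theorem sameCycle_erase {σ : Perm D} {d x y : D} :
    (erase σ d).SameCycle x y ↔ x = y ∨ (x ≠ d ∧ y ≠ d ∧ σ.SameCycle x y) := by
  let r : Setoid D :=
    { r := fun x y => x = y ∨ (x ≠ d ∧ y ≠ d ∧ σ.SameCycle x y)
      iseqv := by
        refine ⟨fun _ => Or.inl rfl, ?_, ?_⟩
        · rintro a b (rfl | ⟨h1, h2, h3⟩)
          · exact Or.inl rfl
          · exact Or.inr ⟨h2, h1, h3.symm⟩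
        · rintro a b c (rfl | ⟨h1, h2, h3⟩) (rfl | ⟨k1, k2, k3⟩)
          · exact Or.inl rfl
          · exact Or.inr ⟨k1, k2, k3⟩
          · exact Or.inr ⟨h1, h2, h3⟩
          · exact Or.inr ⟨h1, k2, h3.trans k3⟩ }
  constructor
  · refine fun h => sameCycle_le (s := r) (fun a => ?_) h
    change a = _ ∨ _
    rcases eq_or_ne a d with rfl | ha
    · exact Or.inl (erase_self _ _).symm
    · by_cases hd : σ a = d
      · rw [erase_of_apply_eq hd ha]
        refine Or.inr ⟨ha, fun e => ha ?_, ?_⟩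
        · exact σ.injective (hd.trans e.symm)
        · exact (hd ▸ sameCycle_apply σ a : σ.SameCycle a d).trans (sameCycle_apply σ d)
      · rw [erase_of_ne hd ha]
        exact Or.inr ⟨ha, hd, sameCycle_apply σ a⟩
  · rintro (rfl | ⟨hx, hy, h⟩)
    · exact Perm.SameCycle.refl _ _
    · obtain ⟨n, -, rfl⟩ := h.exists_pow_eq'
      -- Follow `σ` from `x`: the erased permutation keeps pace, except that at the moment when `σ`
      -- visits `d` it is already at `σ d`.
      have key : ∀ n : ℕ, ((erase σ d).SameCycle x ((σ ^ n) x) ∧ (σ ^ n) x ≠ d) ∨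
          ((σ ^ n) x = d ∧ (erase σ d).SameCycle x (σ d)) := by
        intro n
        induction n with
        | zero => exact Or.inl ⟨.refl _ _, hx⟩
        | succ n ih =>
          rw [pow_succ', Perm.mul_apply]
          rcases ih with ⟨h1, h2⟩ | ⟨h1, h2⟩
          · by_cases h3 : σ ((σ ^ n) x) = d
            · refine Or.inr ⟨h3, h1.trans ?_⟩
              rw [← erase_of_apply_eq h3 h2]
              exact sameCycle_apply _ _
            · refine Or.inl ⟨h1.trans ?_, h3⟩
              rw [← erase_of_ne h3 h2]
              exact sameCycle_apply _ _
          · rw [h1]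
            by_cases h3 : σ d = d
            · exact Or.inr ⟨h3, h2⟩
            · exact Or.inl ⟨h2, h3⟩
      rcases key n with h | h
      · exact h.1
      · exact absurd h.1 hy

/-- Take all points of a list out of their cycles. -/
def eraseList (σ : Perm D) : List D → Perm D
  | [] => σ
  | d :: l => eraseList (erase σ d) l

theorem sameCycle_eraseList {σ : Perm D} {l : List D} {x y : D} :
    (eraseList σ l).SameCycle x y ↔ x = y ∨ (x ∉ l ∧ y ∉ l ∧ σ.SameCycle x y) := by
  induction l generalizing σ with
  | nil =>
    simp only [eraseList, List.not_mem_nil, not_false_eq_true, true_and]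
    exact ⟨Or.inr, fun h => h.elim (fun e => e ▸ Perm.SameCycle.refl _ _) id⟩
  | cons d l ih =>
    rw [eraseList, ih, sameCycle_erase]
    simp only [List.mem_cons, not_or]
    tauto

theorem eraseList_of_mem {σ : Perm D} {l : List D} {x : D} (h : x ∈ l) : eraseList σ l x = x := by
  have := sameCycle_apply (eraseList σ l) x
  rw [sameCycle_eraseList] at this
  rcases this with h' | h'
  · exact h'.symm
  · exact absurd h h'.1

theorem defect_eraseList_le (σ τ : Perm D) (l : List D) :
    defect σ (eraseList τ l) ≤ defect σ τ := by
  induction l generalizing τ with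
  | nil => exact le_rfl
  | cons d l ih => exact (ih _).trans (defect_erase_le _ _ _)

theorem cyc_eraseList_le (σ : Perm D) (l : List D) : cyc (eraseList σ l) ≤ cyc σ + l.length := by
  induction l generalizing σ with
  | nil => exact le_rfl
  | cons d l ih =>
    rw [eraseList, List.length_cons]
    have := ih (erase σ d)
    have := cyc_erase_le σ d
    omega

theorem cyc_eraseList {σ : Perm D} {x : D} {l : List D} (hl : (x :: l).Nodup)
    (h : ∀ d ∈ l, σ.SameCycle x d) : cyc (eraseList σ l) = cyc σ + l.length := by
  induction l generalizing σ with
  | nil => rfl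
  | cons d l ih =>
    simp only [List.nodup_cons, List.mem_cons, not_or] at hl
    rw [eraseList, List.length_cons, ih]
    · rw [cyc_erase, add_right_comm, add_assoc]
      intro hd
      exact hl.1.1 (((h d (by simp)).symm.eq_of_left hd).symm)
    · simp only [List.nodup_cons]; exact ⟨hl.1.2, hl.2.2⟩
    · intro d' hd'
      refine sameCycle_erase.2 (Or.inr ⟨hl.1.1, ?_, h d' (by simp [hd'])⟩)
      rintro rfl
      exact hl.2.1 hd'

omit [Finite D] [DecidableEq D] in
theorem cyc_one : cyc (1 : Perm D) = Nat.card D := by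
  refine (Nat.card_congr (Equiv.ofBijective (fun d => Quotient.mk _ d) ⟨?_, ?_⟩)).symm
  · intro a b h
    exact Perm.sameCycle_one.1 (Quotient.exact h)
  · exact Quotient.mk_surjective

omit [Finite D] [DecidableEq D] in
theorem defect_one (σ : Perm D) : defect σ 1 = 0 := by
  have : conn σ 1 = Perm.SameCycle.setoid σ :=
    le_antisymm (conn_le (sameCycle_apply σ) fun d => Setoid.refl' _ _)
      fun _ _ h => conn_of_sameCycle_left 1 h
  rw [defect, comps, this, mul_one, cyc_one, cyc]
  ring

/-- Euler's inequality. -/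
theorem defect_nonneg (σ τ : Perm D) : 0 ≤ defect σ τ := by
  have := Fintype.ofFinite D
  -- Erasing all points leaves the identity, which has defect zero with every permutation.
  have h : eraseList τ Finset.univ.toList = 1 := by
    ext x
    exact eraseList_of_mem (by simp)
  have := defect_eraseList_le σ τ Finset.univ.toList
  rwa [h, defect_one] at this

/-- Erasing does not raise the defect in either argument, and the defect is never negative. -/
theorem defect_eraseList {σ τ : Perm D} (h : defect σ τ = 0) (l l' : List D) :
    defect (eraseList σ l) (eraseList τ l') = 0 := by
  refine le_antisymm ?_ (defect_nonneg _ _)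
  refine (defect_eraseList_le _ _ _).trans ?_
  rw [defect_comm]
  refine (defect_eraseList_le _ _ _).trans ?_
  rw [defect_comm, h]

omit [Finite D] in
theorem erase_inv (σ : Perm D) (d : D) : erase σ⁻¹ d = (erase σ d)⁻¹ := by
  have h : σ⁻¹ (σ d) = d := by simp
  rw [erase, erase, inv_inv, mul_inv_rev, swap_inv, mul_swap_eq_swap_mul, h, swap_comm]

omit [Finite D] in
theorem eraseList_inv (σ : Perm D) (l : List D) : eraseList σ⁻¹ l = (eraseList σ l)⁻¹ := by
  induction l generalizing σ with
  | nil => rfl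
  | cons d l ih => rw [eraseList, eraseList, erase_inv, ih]

/-- Erasing points from a permutation and from the faces. -/
theorem defect_eraseList_face {σ τ : Perm D} (h : defect σ τ = 0) (l l' : List D) :
    defect (eraseList σ l) ((eraseList σ l)⁻¹ * eraseList (σ * τ) l') = 0 := by
  rw [← defect_inv_mul, mul_inv_cancel_left, ← eraseList_inv]
  exact defect_eraseList (by rwa [defect_inv_mul]) l l'

/-- The first return of a permutation to the complement of `S` leads from `x` to `y`. -/
inductive Skip (σ : Perm D) (S : D → Prop) : D → D → Prop
  | step {x y : D} : σ x = y → ¬ S y → Skip σ S x y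
  | skip {x y z : D} : σ x = z → S z → Skip σ S z y → Skip σ S x y

omit [Finite D] in
theorem Skip.erase {σ : Perm D} {d : D} {l : List D} {x y : D} (h : Skip σ (· ∈ d :: l) x y)
    (hx : x ≠ d) : Skip (erase σ d) (· ∈ l) x y := by
  -- The induction needs a companion claim for paths starting at the erased point `d` itself: in the
  -- erased permutation they are continued from its predecessor `x0`.
  suffices h : (x ≠ d → Skip (Hypermap.erase σ d) (· ∈ l) x y) ∧
      (x = d → ∀ x0, x0 ≠ d → σ x0 = d → Skip (Hypermap.erase σ d) (· ∈ l) x0 y) from h.1 hx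
  clear hx
  induction h with
  | @step x y h hy =>
    simp only [List.mem_cons, not_or] at hy
    refine ⟨fun hx => .step ?_ hy.2, ?_⟩
    · rw [erase_of_ne (h ▸ hy.1) hx, h]
    · rintro rfl x0 h0 h1
      exact .step (by rw [erase_of_apply_eq h1 h0, h]) hy.2
  | @skip x y z h hz _ ih =>
    simp only [List.mem_cons] at hz
    refine ⟨fun hx => ?_, ?_⟩
    · rcases eq_or_ne z d with rfl | hzd
      · exact ih.2 rfl x hx h
      · exact .skip (by rw [erase_of_ne (h ▸ hzd) hx, h]) (hz.resolve_left hzd) (ih.1 hzd)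
    · rintro rfl x0 h0 h1
      rcases eq_or_ne z x with rfl | hzd
      · exact absurd (σ.injective (h1.trans h.symm)) h0
      · exact .skip (by rw [erase_of_apply_eq h1 h0, h]) (hz.resolve_left hzd) (ih.1 hzd)

-- This is how erased permutations are evaluated: exhibit the path of `σ` through points of the list
-- up to the first point outside.
omit [Finite D] in
theorem eraseList_eq_of_skip {σ : Perm D} {l : List D} {x y : D} (h : Skip σ (· ∈ l) x y)
    (hx : x ∉ l) : eraseList σ l x = y := by
  induction l generalizing σ with
  | nil =>
    cases h with
    | step h _ => exact h
    | skip _ h _ => simp at h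
  | cons d l ih =>
    simp only [List.mem_cons, not_or] at hx
    exact ih (h.erase hx.1) hx.2

end Swap

/-! ### Disjoint unions and transport of the genus -/

section Sum

variable {D' : Type*}

/-- The equivalence relation on a disjoint union given by relations on the parts. -/
def sumSetoid (r : Setoid D) (s : Setoid D') : Setoid (D ⊕ D') where
  r := Sum.LiftRel r s
  iseqv := by
    refine ⟨?_, ?_, ?_⟩
    · rintro (a | a)
      exacts [.inl (r.refl a), .inr (s.refl a)]
    · rintro _ _ (h | h)
      exacts [.inl (r.symm h), .inr (s.symm h)]
    · rintro _ _ _ (h | h) (k | k)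
      exacts [.inl (r.trans h k), .inr (s.trans h k)]

theorem card_sumSetoid [Finite D] [Finite D'] (r : Setoid D) (s : Setoid D') :
    Nat.card (Quotient (sumSetoid r s)) = Nat.card (Quotient r) + Nat.card (Quotient s) := by
  rw [← Nat.card_sum]
  symm
  refine Nat.card_congr (Equiv.ofBijective (Sum.elim
    (Quotient.map' Sum.inl fun a b h => Sum.LiftRel.inl h)
    (Quotient.map' Sum.inr fun a b h => Sum.LiftRel.inr h)) ⟨?_, ?_⟩)
  · rintro (p | p) (q | q) h <;> induction p using Quotient.inductionOn with | _ a <;>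
      induction q using Quotient.inductionOn with | _ b <;> have h' := Quotient.exact h <;>
      cases h' with | _ h' <;> exact congrArg _ (Quotient.sound h')
  · intro q
    induction q using Quotient.inductionOn with | _ a
    rcases a with a | a
    exacts [⟨Sum.inl (Quotient.mk _ a), rfl⟩, ⟨Sum.inr (Quotient.mk _ a), rfl⟩]

theorem sameCycle_sumCongr (σ : Perm D) (σ' : Perm D') :
    Perm.SameCycle.setoid (σ.sumCongr σ') =
      sumSetoid (Perm.SameCycle.setoid σ) (Perm.SameCycle.setoid σ') := by
  apply le_antisymm
  · refine sameCycle_le ?_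
    rintro (a | a)
    exacts [.inl (sameCycle_apply _ _), .inr (sameCycle_apply _ _)]
  · rintro _ _ (h | h)
    · exact sameCycle_le (s := (Perm.SameCycle.setoid (σ.sumCongr σ')).comap Sum.inl)
        (fun d => sameCycle_apply (σ.sumCongr σ') (Sum.inl d)) h
    · exact sameCycle_le (s := (Perm.SameCycle.setoid (σ.sumCongr σ')).comap Sum.inr)
        (fun d => sameCycle_apply (σ.sumCongr σ') (Sum.inr d)) h

theorem conn_sumCongr (σ τ : Perm D) (σ' τ' : Perm D') :
    conn (σ.sumCongr σ') (τ.sumCongr τ') = sumSetoid (conn σ τ) (conn σ' τ') := by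
  apply le_antisymm
  · refine conn_le ?_ ?_ <;> rintro (a | a)
    exacts [.inl (conn_left _ _ _), .inr (conn_left _ _ _), .inl (conn_right _ _ _),
      .inr (conn_right _ _ _)]
  · rintro _ _ (h | h)
    · exact conn_le (s := (conn (σ.sumCongr σ') (τ.sumCongr τ')).comap Sum.inl)
        (fun d => conn_left (σ.sumCongr σ') (τ.sumCongr τ') (Sum.inl d))
        (fun d => conn_right (σ.sumCongr σ') (τ.sumCongr τ') (Sum.inl d)) h
    · exact conn_le (s := (conn (σ.sumCongr σ') (τ.sumCongr τ')).comap Sum.inr)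
        (fun d => conn_left (σ.sumCongr σ') (τ.sumCongr τ') (Sum.inr d))
        (fun d => conn_right (σ.sumCongr σ') (τ.sumCongr τ') (Sum.inr d)) h

variable [Finite D] [Finite D']

theorem cyc_sumCongr (σ : Perm D) (σ' : Perm D') : cyc (σ.sumCongr σ') = cyc σ + cyc σ' := by
  rw [cyc, sameCycle_sumCongr, card_sumSetoid, cyc, cyc]

theorem defect_sumCongr (σ τ : Perm D) (σ' τ' : Perm D') :
    defect (σ.sumCongr σ') (τ.sumCongr τ') = defect σ τ + defect σ' τ' := by
  rw [defect, comps, conn_sumCongr, card_sumSetoid, Perm.sumCongr_mul, cyc_sumCongr, cyc_sumCongr,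
    cyc_sumCongr, Nat.card_sum, defect, defect, comps, comps]
  push_cast
  ring

omit [Finite D] [Finite D'] in
theorem defect_congr (e : D ≃ D') {σ τ : Perm D} {σ' τ' : Perm D'}
    (h : ∀ d, e (σ d) = σ' (e d)) (k : ∀ d, e (τ d) = τ' (e d)) : defect σ τ = defect σ' τ' := by
  have hc : comps σ τ = comps σ' τ' := by
    have h' : ∀ d, e.symm (σ' d) = σ (e.symm d) := fun d => by
      apply e.injective; rw [h]; simp
    have k' : ∀ d, e.symm (τ' d) = τ (e.symm d) := fun d => by
      apply e.injective; rw [k]; simp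
    refine Nat.card_congr (Quotient.congr e fun a b => ⟨fun hab => ?_, fun hab => ?_⟩)
    · exact conn_le (s := (conn σ' τ').comap e)
        (fun d => by rw [Setoid.comap_rel, h]; exact conn_left _ _ _)
        (fun d => by rw [Setoid.comap_rel, k]; exact conn_right _ _ _) hab
    · have := conn_le (s := (conn σ τ).comap e.symm)
        (fun d => by rw [Setoid.comap_rel, h']; exact conn_left _ _ _)
        (fun d => by rw [Setoid.comap_rel, k']; exact conn_right _ _ _) hab
      rw [Setoid.comap_rel] at this
      simpa using this
  rw [defect, defect, hc, cyc_congr e h, cyc_congr e k, Nat.card_congr e,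
    cyc_congr e (σ := σ * τ) (σ' := σ' * τ') fun d => by simp [h, k]]

omit [Finite D] in
/-- Points fixed by both permutations do not matter. -/
theorem defect_of_injective {j : D' → D} (hj : Function.Injective j) {σ τ : Perm D}
    {σ' τ' : Perm D'} [Finite D] (h : ∀ d, j (σ' d) = σ (j d)) (k : ∀ d, j (τ' d) = τ (j d))
    (hσ : ∀ x ∉ Set.range j, σ x = x) (hτ : ∀ x ∉ Set.range j, τ x = x) :
    defect σ τ = defect σ' τ' := by
  classical
  let e : D' ⊕ ((Set.range j)ᶜ : Set D) ≃ D :=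
    ((Equiv.ofInjective j hj).sumCongr (Equiv.refl _)).trans (Equiv.Set.sumCompl _)
  have he : ∀ d, e (Sum.inl d) = j d := fun d => rfl
  have he' : ∀ x, e (Sum.inr x) = x := fun d => rfl
  rw [← defect_congr e (σ := σ'.sumCongr 1) (τ := τ'.sumCongr 1), defect_sumCongr, defect_one,
    add_zero]
  · rintro (d | d)
    · simpa [he] using h d
    · simpa [he'] using (hσ _ d.2).symm
  · rintro (d | d)
    · simpa [he] using k d
    · simpa [he'] using (hτ _ d.2).symm

end Sum

end Hypermap

namespace Hypermap

/-! ### Cycles given by lists, and gluing of two points -/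

section FormPerm

variable {D : Type*} [DecidableEq D]

theorem formPerm_map {D' : Type*} [DecidableEq D'] {j : D → D'} (hj : Function.Injective j)
    (l : List D) (x : D) : (l.map j).formPerm (j x) = j (l.formPerm x) := by
  induction l generalizing x with
  | nil => rfl
  | cons a l ih =>
    cases l with
    | nil => rfl
    | cons b l =>
      simp only [List.map_cons, List.formPerm_cons_cons, Perm.mul_apply] at ih ⊢
      rw [ih, hj.swap_apply]

/-- The list `x :: l` is the image of `d :: l` under `swap x d`, so the corresponding cycles are
conjugate. -/
theorem formPerm_insert {x d : D} {l : List D} (h : (x :: d :: l).Nodup) :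
    (x :: d :: l).formPerm = (x :: l).formPerm * swap x d := by
  have hl : x :: l = (d :: l).map (swap x d) := by
    simp only [List.nodup_cons, List.mem_cons, not_or] at h
    rw [List.map_cons, swap_apply_right]
    congr 1
    refine (List.map_id l).symm.trans (List.map_congr_left fun a ha => ?_)
    rw [swap_apply_of_ne_of_ne]
    · rfl
    · rintro rfl; exact h.1.2 ha
    · rintro rfl; exact h.2.1 ha
  rw [List.formPerm_cons_cons, hl]
  ext a
  rw [Perm.mul_apply, Perm.mul_apply, formPerm_map (swap x d).injective]

theorem erase_formPerm {x : D} {l : List D} (h : (x :: l).Nodup) :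
    erase (x :: l).formPerm x = l.formPerm := by
  cases l with
  | nil => rw [List.formPerm_singleton, List.formPerm_nil]; exact swap_self_one x
  | cons y l =>
    have h' : (x :: y :: l).formPerm x = y := List.formPerm_apply_head _ _ _ h
    have h'' : (x :: y :: l).formPerm ((x :: y :: l).formPerm⁻¹ x) = x := by simp
    rw [erase, mul_swap_eq_swap_mul, h', h'', List.formPerm_cons_cons, ← mul_assoc, swap_mul_self,
      one_mul]

/-- One transposition joins two disjoint cycles. Which points `u` and `v` occur is irrelevant later,
as long as they come from the two lists. -/
theorem formPerm_append {l l' : List D} (h : (l ++ l').Nodup) (hl : l ≠ []) (hl' : l' ≠ []) :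
    ∃ u ∈ l, ∃ v ∈ l', (l ++ l').formPerm = l.formPerm * l'.formPerm * swap u v := by
  induction l with
  | nil => exact absurd rfl hl
  | cons x l ih =>
    cases l with
    | nil =>
      obtain ⟨y, l', rfl⟩ := List.exists_cons_of_ne_nil hl'
      refine ⟨x, by simp, (y :: l').formPerm⁻¹ y, ?_, ?_⟩
      · rw [← List.formPerm_mem_iff_mem]; simp
      · have hx : (y :: l').formPerm x = x := List.formPerm_apply_of_notMem (by simp_all)
        rw [List.cons_append, List.nil_append, List.formPerm_cons_cons, List.formPerm_singleton,
          one_mul, mul_swap_eq_swap_mul, hx]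
        simp
    | cons z l =>
      obtain ⟨u, hu, v, hv, e⟩ := ih (List.nodup_cons.1 h).2 (by simp)
      refine ⟨u, by simp [hu], v, hv, ?_⟩
      rw [List.cons_append, List.cons_append, List.formPerm_cons_cons, ← List.cons_append, e,
        List.formPerm_cons_cons]
      simp only [mul_assoc]

theorem sameCycle_formPerm {l : List D} (hl : l.Nodup) {x y : D} (hx : x ∈ l) (hy : y ∈ l) :
    l.formPerm.SameCycle x y := by
  by_cases h : 2 ≤ l.length
  · exact (List.isCycle_formPerm hl h).sameCycle ((List.formPerm_apply_mem_ne_self_iff l hl x hx).2 h)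
      ((List.formPerm_apply_mem_ne_self_iff l hl y hy).2 h)
  · match l, h with
    | [], _ => simp at hx
    | [a], _ =>
      rw [List.mem_singleton] at hx hy
      rw [hx, hy]
    | _ :: _ :: _, h => simp at h

theorem eraseList_formPerm_append {l l' : List D} (h : (l ++ l').Nodup) :
    eraseList (l ++ l').formPerm l = l'.formPerm := by
  induction l with
  | nil => rfl
  | cons x l ih =>
    rw [List.cons_append] at h ⊢
    rw [eraseList, erase_formPerm h, ih (List.nodup_cons.1 h).2]

end FormPerm

section Agree

variable {D : Type*} [DecidableEq D]

theorem eraseList_of_notMem {σ : Perm D} {l : List D} {x : D} (hx : x ∉ l) (h : σ x ∉ l) :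
    eraseList σ l x = σ x := eraseList_eq_of_skip (.step rfl h) hx

/-- Erasing is a local operation. -/
theorem eraseList_congr {σ τ : Perm D} {S : D → Prop} (h : ∀ x, S x → σ x = τ x)
    (hS : ∀ x, S (τ x) ↔ S x) {l : List D} (hl : ∀ x ∈ l, S x) {x : D} (hx : S x) :
    eraseList σ l x = eraseList τ l x := by
  induction l generalizing σ τ with
  | nil => exact h x hx
  | cons d l ih =>
    have hd : S d := hl d (by simp)
    have hd' : S (τ⁻¹ d) := by rw [← hS]; simpa
    have e : σ⁻¹ d = τ⁻¹ d := by rw [Perm.inv_eq_iff_eq, h _ hd']; simp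
    have hsw : ∀ x, S (swap (τ⁻¹ d) d x) ↔ S x := by
      intro x
      rcases eq_or_ne x (τ⁻¹ d) with rfl | h1
      · rw [swap_apply_left]; exact iff_of_true hd hd'
      · rcases eq_or_ne x d with rfl | h2
        · rw [swap_apply_right]; exact iff_of_true hd' hd
        · rw [swap_apply_of_ne_of_ne h1 h2]
    refine ih (fun x hx => ?_) (fun x => ?_) (fun x hx => hl x (by simp [hx]))
    · rw [erase, erase, Perm.mul_apply, Perm.mul_apply, e, h _ ((hsw x).2 hx)]
    · rw [erase, Perm.mul_apply, hS, hsw]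

end Agree

section Glue

variable {D : Type*} [DecidableEq D] [Finite D]

/-- Contract the pair `x, y`: the two points become fixed points, and the `σ`-cycles containing
them are joined. -/
theorem exists_glue {σ τ : Perm D} (h : defect σ τ = 0) {x y : D} (hxy : τ x = y) :
    ∃ σ' : Perm D, defect σ' (eraseList τ [x, y]) = 0 ∧ ∀ a b, σ'.SameCycle a b ↔
      a = b ∨ (a ∉ [x, y] ∧ b ∉ [x, y] ∧ merge (Perm.SameCycle.setoid σ) x y a b) := by
  by_cases hs : σ.SameCycle x y
  · refine ⟨eraseList σ [x, y], defect_eraseList h _ _, fun a b => ?_⟩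
    rw [sameCycle_eraseList, merge_eq_self hs]
    rfl
  · have hx : σ.SameCycle (σ⁻¹ x) x := sameCycle_inv_apply σ x
    have hs' : ¬ σ.SameCycle y (σ⁻¹ x) := fun k => hs (k.trans hx).symm
    -- The cycle of `y` is joined at the predecessor of `x`: as `τ * σ` maps `σ⁻¹ x` to `τ x = y`,
    -- both points lie on one face and the genus stays zero.
    have hd : defect (σ * swap y (σ⁻¹ x)) τ = 0 := by
      rw [defect_comm, defect_mul_swap hs', defect_comm, h]
      refine Or.inl (Perm.SameCycle.symm ?_)
      have h' : (τ * σ) (σ⁻¹ x) = y := by simp [hxy]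
      exact h' ▸ sameCycle_apply (τ * σ) (σ⁻¹ x)
    refine ⟨eraseList (σ * swap y (σ⁻¹ x)) [x, y], defect_eraseList hd _ _, fun a b => ?_⟩
    have hm : merge (Perm.SameCycle.setoid σ) y (σ⁻¹ x) = merge (Perm.SameCycle.setoid σ) x y := by
      apply le_antisymm
      · refine merge_le (le_merge _ _ _) (Setoid.symm' _ ?_)
        exact Setoid.trans' _ (le_merge _ _ _ hx) (merge_rel _ _ _)
      · refine merge_le (le_merge _ _ _) (Setoid.symm' _ ?_)
        exact Setoid.trans' _ (merge_rel _ _ _) (le_merge _ _ _ hx)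
    rw [sameCycle_eraseList, ← hm, ← sameCycle_mul_swap hs']
    rfl

end Glue

end Hypermap

open Equiv Hypermap

/-! ### Drawings in a disc: disjoint union, joining labels, contracting edges -/

namespace Multigraph

variable {V E V' E' : Type}

/-- Identify vertices by a map. -/
def map (g : Multigraph V E) (f : V → V') : Multigraph V' E := ⟨fun e => (g.ends e).map f⟩

@[simp]
theorem map_ends (g : Multigraph V E) (f : V → V') (e : E) :
    (g.map f).ends e = (g.ends e).map f := rfl

/-- The disjoint union. -/
def sum (g : Multigraph V E) (h : Multigraph V' E') : Multigraph (V ⊕ V') (E ⊕ E') :=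
  ⟨Sum.elim (fun e => (g.ends e).map Sum.inl) (fun e => (h.ends e).map Sum.inr)⟩

/-- A plane drawing of a graph in a disc, with the labels on the boundary in the cyclic order `w`.
The darts and the label positions belong to a finite set `D`, whose other elements are irrelevant;
the labels form one cycle of `opp`. -/
structure Diagram (g : Multigraph V E) (w : List V) where
  D : Type
  [dec : DecidableEq D]
  [fin : Finite D]
  dart : E × Bool → D
  dart_inj : Function.Injective dart
  W : List D
  nodup : W.Nodup
  dart_notMem : ∀ p, dart p ∉ W
  vert : D → V
  ends_eq : ∀ e, g.ends e = s(vert (dart (e, false)), vert (dart (e, true)))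
  word : W.map vert = w
  rot : Perm D
  opp : Perm D
  rot_fix : ∀ x, x ∉ Set.range dart → x ∉ W → rot x = x
  sameCycle : ∀ x y, (x ∈ Set.range dart ∨ x ∈ W) → (y ∈ Set.range dart ∨ y ∈ W) →
    (rot.SameCycle x y ↔ vert x = vert y)
  opp_dart : ∀ e b, opp (dart (e, b)) = dart (e, !b)
  opp_of_notMem : ∀ x, x ∉ Set.range dart → opp x = W.formPerm x
  planar : defect rot opp = 0

attribute [instance] Diagram.dec Diagram.fin

/-- The graph can be drawn in a disc with the labels `w` on the boundary. -/
def IsPlane (g : Multigraph V E) (w : List V) : Prop := Nonempty (Diagram g w)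

variable {g : Multigraph V E} {w : List V}

theorem Diagram.sameCycle_eq (Δ : Diagram g w) {x y : Δ.D} (hx : x ∉ Set.range Δ.dart)
    (hx' : x ∉ Δ.W) (h : Δ.rot.SameCycle x y) : x = y :=
  h.eq_of_left (Δ.rot_fix x hx hx')

theorem Diagram.formPerm_mem_range (Δ : Diagram g w) (x : Δ.D) :
    Δ.W.formPerm x ∈ Set.range Δ.dart ↔ x ∈ Set.range Δ.dart := by
  by_cases hx : x ∈ Δ.W
  · refine iff_of_false ?_ ?_
    · rintro ⟨p, hp⟩
      exact Δ.dart_notMem p (hp ▸ List.formPerm_mem_iff_mem.2 hx)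
    · rintro ⟨p, rfl⟩
      exact Δ.dart_notMem p hx
  · rw [List.formPerm_apply_of_notMem hx]

theorem IsPlane.rotate (h : IsPlane g w) (n : ℕ) : IsPlane g (w.rotate n) := by
  obtain ⟨Δ⟩ := h
  exact ⟨{ Δ with
    W := Δ.W.rotate n
    nodup := List.nodup_rotate.2 Δ.nodup
    dart_notMem := fun p => by rw [List.mem_rotate]; exact Δ.dart_notMem p
    word := by rw [List.map_rotate, Δ.word]
    rot_fix := fun x => by rw [List.mem_rotate]; exact Δ.rot_fix x
    sameCycle := fun x y => by rw [List.mem_rotate, List.mem_rotate]; exact Δ.sameCycle x y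
    opp_of_notMem := fun x => by
      rw [List.formPerm_rotate _ Δ.nodup]; exact Δ.opp_of_notMem x }⟩

/-- The mirror image of a drawing: inverting both permutations preserves the defect and reverses the
boundary cycle. -/
theorem IsPlane.reverse (h : IsPlane g w) : IsPlane g w.reverse := by
  obtain ⟨Δ⟩ := h
  exact ⟨{ Δ with
    W := Δ.W.reverse
    rot := Δ.rot⁻¹
    opp := Δ.opp⁻¹
    nodup := List.nodup_reverse.2 Δ.nodup
    dart_notMem := fun p => by rw [List.mem_reverse]; exact Δ.dart_notMem p
    word := by rw [List.map_reverse, Δ.word]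
    rot_fix := fun x h h' => by
      rw [Perm.inv_eq_iff_eq, Δ.rot_fix x h (by simpa using h')]
    sameCycle := fun x y => by
      rw [List.mem_reverse, List.mem_reverse, Perm.sameCycle_inv]; exact Δ.sameCycle x y
    opp_dart := fun e b => by rw [Perm.inv_eq_iff_eq, Δ.opp_dart, Bool.not_not]
    opp_of_notMem := fun x hx => by
      have h' : Δ.W.formPerm⁻¹ x ∉ Set.range Δ.dart := by
        rw [← Δ.formPerm_mem_range]; simpa using hx
      rw [List.formPerm_reverse, Perm.inv_eq_iff_eq, Δ.opp_of_notMem _ h']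
      simp
    planar := by rw [defect_inv, Δ.planar] }⟩

/-- Surjectivity of `φ` is not needed, since a diagram does not see vertices without darts and
labels. -/
theorem IsPlane.of_injective (h : IsPlane g w) {g' : Multigraph V' E'} {φ : V → V'}
    (hφ : Function.Injective φ) (ψ : E' ≃ E) (hg : ∀ e, g'.ends e = (g.ends (ψ e)).map φ) :
    IsPlane g' (w.map φ) := by
  obtain ⟨Δ⟩ := h
  have hr : Set.range (Δ.dart ∘ Prod.map ψ id) = Set.range Δ.dart :=
    (ψ.surjective.prodMap Function.surjective_id).range_comp _
  exact ⟨{ Δ with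
    dart := Δ.dart ∘ Prod.map ψ id
    dart_inj := Δ.dart_inj.comp (ψ.injective.prodMap Function.injective_id)
    dart_notMem := fun p => Δ.dart_notMem _
    vert := φ ∘ Δ.vert
    ends_eq := fun e => by rw [hg, Δ.ends_eq]; rfl
    word := by rw [← List.map_map, Δ.word]
    rot_fix := fun x => by rw [hr]; exact Δ.rot_fix x
    sameCycle := fun x y h h' => by
      rw [hr] at h h'
      rw [Δ.sameCycle x y h h', Function.comp, Function.comp, hφ.eq_iff]
    opp_dart := fun e b => Δ.opp_dart _ _
    opp_of_notMem := fun x => by rw [hr]; exact Δ.opp_of_notMem x }⟩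

/-- Place two discs side by side. Their boundary cycles belong to different components, so they can
be joined by a transposition without changing the genus; if one boundary is empty, there is nothing
to join. -/
theorem IsPlane.sum (h : IsPlane g w) {g' : Multigraph V' E'} {w' : List V'}
    (h' : IsPlane g' w') : IsPlane (g.sum g') (w.map Sum.inl ++ w'.map Sum.inr) := by
  obtain ⟨Δ⟩ := h
  obtain ⟨Δ'⟩ := h'
  let W : List (Δ.D ⊕ Δ'.D) := Δ.W.map Sum.inl ++ Δ'.W.map Sum.inr
  let dart : (E ⊕ E') × Bool → Δ.D ⊕ Δ'.D := fun p =>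
    Sum.elim (fun e => Sum.inl (Δ.dart (e, p.2))) (fun e => Sum.inr (Δ'.dart (e, p.2))) p.1
  have hl : ∀ x, Sum.inl x ∈ Set.range dart ↔ x ∈ Set.range Δ.dart := by
    intro x
    constructor
    · rintro ⟨⟨e | e, b⟩, h⟩
      · exact ⟨(e, b), Sum.inl_injective h⟩
      · cases h
    · rintro ⟨⟨e, b⟩, rfl⟩
      exact ⟨(Sum.inl e, b), rfl⟩
  have hr : ∀ x, Sum.inr x ∈ Set.range dart ↔ x ∈ Set.range Δ'.dart := by
    intro x
    constructor
    · rintro ⟨⟨e | e, b⟩, h⟩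
      · cases h
      · exact ⟨(e, b), Sum.inr_injective h⟩
    · rintro ⟨⟨e, b⟩, rfl⟩
      exact ⟨(Sum.inr e, b), rfl⟩
  have hlW : ∀ x, Sum.inl x ∈ W ↔ x ∈ Δ.W := by simp [W]
  have hrW : ∀ x, Sum.inr x ∈ W ↔ x ∈ Δ'.W := by simp [W]
  have hnd : W.Nodup := by
    refine List.Nodup.append (Δ.nodup.map Sum.inl_injective) (Δ'.nodup.map Sum.inr_injective) ?_
    intro a ha ha'
    rw [List.mem_map] at ha ha'
    obtain ⟨b, -, rfl⟩ := ha
    obtain ⟨c, -, hc⟩ := ha'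
    cases hc
  have hsc : ∀ x y, (Δ.rot.sumCongr Δ'.rot).SameCycle x y ↔
      Sum.LiftRel Δ.rot.SameCycle Δ'.rot.SameCycle x y := fun x y =>
    Setoid.ext_iff.1 (sameCycle_sumCongr Δ.rot Δ'.rot) x y
  have hform : ∀ x ∉ Set.range dart, (Δ.opp.sumCongr Δ'.opp) x =
      ((Δ.W.map Sum.inl).formPerm * (Δ'.W.map Sum.inr).formPerm : Perm (Δ.D ⊕ Δ'.D)) x := by
    rintro (x | x) hx
    · rw [hl] at hx
      rw [Perm.mul_apply, List.formPerm_apply_of_notMem (l := Δ'.W.map Sum.inr) (by simp),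
        formPerm_map Sum.inl_injective, Perm.sumCongr_apply, Sum.map_inl, Δ.opp_of_notMem x hx]
    · rw [hr] at hx
      rw [Perm.mul_apply, formPerm_map Sum.inr_injective,
        List.formPerm_apply_of_notMem (l := Δ.W.map Sum.inl) (by simp), Perm.sumCongr_apply,
        Sum.map_inr, Δ'.opp_of_notMem x hx]
  obtain ⟨opp, hopp, hd, hf⟩ : ∃ opp : Perm (Δ.D ⊕ Δ'.D),
      defect (Δ.rot.sumCongr Δ'.rot) opp = 0 ∧ (∀ e b, opp (dart (e, b)) = dart (e, !b)) ∧
        ∀ x ∉ Set.range dart, opp x = W.formPerm x := by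
    have h0 : defect (Δ.rot.sumCongr Δ'.rot) (Δ.opp.sumCongr Δ'.opp) = 0 := by
      rw [defect_sumCongr, Δ.planar, Δ'.planar, add_zero]
    have hd : ∀ e b, (Δ.opp.sumCongr Δ'.opp) (dart (e, b)) = dart (e, !b) := by
      rintro (e | e) b
      exacts [congrArg Sum.inl (Δ.opp_dart e b), congrArg Sum.inr (Δ'.opp_dart e b)]
    by_cases hW : Δ.W = []
    · refine ⟨_, h0, hd, fun x hx => ?_⟩
      rw [hform x hx]
      simp [W, hW]
    by_cases hW' : Δ'.W = []
    · refine ⟨_, h0, hd, fun x hx => ?_⟩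
      rw [hform x hx]
      simp [W, hW']
    obtain ⟨u, hu, v, hv, e⟩ := formPerm_append hnd (by simpa using hW) (by simpa using hW')
    have hdart : ∀ p, dart p ∉ W := by
      rintro ⟨e | e, b⟩
      · exact fun h => Δ.dart_notMem _ ((hlW _).1 h)
      · exact fun h => Δ'.dart_notMem _ ((hrW _).1 h)
    have huW : u ∈ W := List.mem_append_left _ hu
    have hvW : v ∈ W := List.mem_append_right _ hv
    have hnc : ¬ conn (Δ.rot.sumCongr Δ'.rot) (Δ.opp.sumCongr Δ'.opp) u v := by
      rw [List.mem_map] at hu hv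
      obtain ⟨u, -, rfl⟩ := hu
      obtain ⟨v, -, rfl⟩ := hv
      rw [conn_sumCongr]
      rintro ⟨⟩
    refine ⟨Δ.opp.sumCongr Δ'.opp * swap u v, ?_, fun e b => ?_, fun x hx => ?_⟩
    · rw [defect_mul_swap _ (Or.inr hnc), h0]
      exact fun h => hnc (conn_of_sameCycle_right _ h)
    · rw [Perm.mul_apply, swap_apply_of_ne_of_ne, hd]
      · rintro rfl; exact hdart _ huW
      · rintro rfl; exact hdart _ hvW
    · rw [Perm.mul_apply, hform, e]
      · rfl
      · by_cases h : x = u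
        · rw [h, swap_apply_left]; rintro ⟨p, rfl⟩; exact hdart _ hvW
        · by_cases h' : x = v
          · rw [h', swap_apply_right]; rintro ⟨p, rfl⟩; exact hdart _ huW
          · rwa [swap_apply_of_ne_of_ne h h']
  refine ⟨{
    D := Δ.D ⊕ Δ'.D
    dart := dart
    dart_inj := ?_
    W := W
    nodup := hnd
    dart_notMem := ?_
    vert := Sum.map Δ.vert Δ'.vert
    ends_eq := ?_
    word := ?_
    rot := Δ.rot.sumCongr Δ'.rot
    opp := opp
    rot_fix := ?_
    sameCycle := ?_
    opp_dart := hd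
    opp_of_notMem := hf
    planar := hopp }⟩
  · rintro ⟨e | e, b⟩ ⟨e' | e', b'⟩ h
    · have := Δ.dart_inj (Sum.inl_injective h); simp_all
    · cases h
    · cases h
    · have := Δ'.dart_inj (Sum.inr_injective h); simp_all
  · rintro ⟨e | e, b⟩
    · exact fun h => Δ.dart_notMem _ ((hlW _).1 h)
    · exact fun h => Δ'.dart_notMem _ ((hrW _).1 h)
  · rintro (e | e)
    · simp [Multigraph.sum, Δ.ends_eq, dart]
    · simp [Multigraph.sum, Δ'.ends_eq, dart]
  · simp only [W, ← Δ.word, ← Δ'.word, List.map_append, List.map_map]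
    rfl
  · rintro (x | x) h1 h2
    · rw [hl] at h1
      rw [hlW] at h2
      exact congrArg Sum.inl (Δ.rot_fix x h1 h2)
    · rw [hr] at h1
      rw [hrW] at h2
      exact congrArg Sum.inr (Δ'.rot_fix x h1 h2)
  · rintro (x | x) (y | y) h1 h2 <;> rw [hsc]
    · rw [hl, hlW] at h1 h2
      simpa using Δ.sameCycle x y h1 h2
    · simp
    · simp
    · rw [hr, hrW] at h1 h2
      simpa using Δ'.sameCycle x y h1 h2

theorem merge_sameCycle_iff {D : Type} {σ : Perm D} {vert : D → V} {S : D → Prop}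
    (h : ∀ x y, S x → S y → (σ.SameCycle x y ↔ vert x = vert y)) {x y a b : D} (hx : S x)
    (hy : S y) (ha : S a) (hb : S b) : merge (Perm.SameCycle.setoid σ) x y a b ↔
      merge ⊥ (vert x) (vert y) (vert a) (vert b) := by
  change (σ.SameCycle a b ∨ (σ.SameCycle a x ∧ σ.SameCycle y b) ∨
    (σ.SameCycle a y ∧ σ.SameCycle x b)) ↔ (vert a = vert b ∨ (vert a = vert x ∧ vert y = vert b) ∨
    (vert a = vert y ∧ vert x = vert b))
  rw [h a b ha hb, h a x ha hx, h y b hy hb, h a y ha hy, h x b hx hb]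

/-- Join two consecutive labels in the outer face. -/
theorem IsPlane.cap {x y : V} (h : IsPlane g (x :: y :: w)) {f : V → V'}
    (hf : ∀ a b, f a = f b ↔ merge ⊥ x y a b) : IsPlane (g.map f) (w.map f) := by
  obtain ⟨Δ⟩ := h
  obtain ⟨X, Y, W, hW⟩ : ∃ X Y W, Δ.W = X :: Y :: W := by
    match hW : Δ.W with
    | [] => have := Δ.word; simp [hW] at this
    | [X] => have := Δ.word; simp [hW] at this
    | X :: Y :: W => exact ⟨X, Y, W, rfl⟩
  have hw := Δ.word
  have hnd := Δ.nodup
  rw [hW] at hw hnd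
  simp only [List.map_cons, List.cons.injEq] at hw
  obtain ⟨hX, hY, hw⟩ := hw
  have hXW : X ∈ Δ.W := by simp [hW]
  have hYW : Y ∈ Δ.W := by simp [hW]
  have hXd : X ∉ Set.range Δ.dart := by rintro ⟨p, rfl⟩; exact Δ.dart_notMem p hXW
  have hYd : Y ∉ Set.range Δ.dart := by rintro ⟨p, rfl⟩; exact Δ.dart_notMem p hYW
  -- Consecutive labels are related by `opp` just like the two darts of an edge, so that the gluing
  -- is the same as for an edge contraction.
  have hXY : Δ.opp X = Y := by
    rw [Δ.opp_of_notMem X hXd, hW, List.formPerm_apply_head _ _ _ hnd]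
  obtain ⟨rot, hd, hs⟩ := exists_glue Δ.planar hXY
  have hn : ∀ a, a ∈ Set.range Δ.dart ∨ a ∈ W → a ∉ [X, Y] := by
    intro a ha h
    simp only [List.mem_cons, List.not_mem_nil, or_false] at h
    simp only [List.nodup_cons, List.mem_cons, not_or] at hnd
    rcases h with rfl | rfl
    · exact ha.elim hXd hnd.1.2
    · exact ha.elim hYd hnd.2.1
  have hu : ∀ a, a ∈ Set.range Δ.dart ∨ a ∈ W → a ∈ Set.range Δ.dart ∨ a ∈ Δ.W := by
    rintro a (h | h)
    exacts [Or.inl h, Or.inr (by simp [hW, h])]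
  exact ⟨{ Δ with
    W := W
    nodup := by simp_all
    dart_notMem := fun p h => Δ.dart_notMem p (by simp [hW, h])
    vert := f ∘ Δ.vert
    ends_eq := fun e => by rw [map_ends, Δ.ends_eq]; rfl
    word := by rw [← List.map_map, hw]
    rot := rot
    opp := eraseList Δ.opp [X, Y]
    rot_fix := fun a ha ha' => by
      have := (hs a (rot a)).1 (sameCycle_apply rot a)
      rcases this with h | ⟨h1, h2, h3⟩
      · exact h.symm
      · have haW : a ∉ Δ.W := by
          rw [hW]
          simp only [List.mem_cons, List.not_mem_nil, or_false, not_or] at h1 ⊢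
          exact ⟨h1.1, h1.2, ha'⟩
        rw [merge_apply] at h3
        simp only [List.mem_cons, List.not_mem_nil, or_false, not_or] at h1
        rcases h3 with h3 | ⟨h3, -⟩ | ⟨h3, -⟩
        · exact (Δ.sameCycle_eq ha haW h3).symm
        · exact absurd (Δ.sameCycle_eq ha haW h3) h1.1
        · exact absurd (Δ.sameCycle_eq ha haW h3) h1.2
    sameCycle := fun a b ha hb => by
      rw [hs, merge_sameCycle_iff Δ.sameCycle (Or.inr hXW) (Or.inr hYW) (hu a ha) (hu b hb), hX, hY,
        ← hf]
      exact ⟨fun h => h.elim (fun h => congrArg _ h) fun h => h.2.2,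
        fun h => Or.inr ⟨hn a ha, hn b hb, h⟩⟩
    opp_dart := fun e b => by
      rw [eraseList_of_notMem (hn _ (Or.inl ⟨_, rfl⟩)), Δ.opp_dart]
      rw [Δ.opp_dart]
      exact hn _ (Or.inl ⟨_, rfl⟩)
    opp_of_notMem := fun a ha => by
      rw [eraseList_congr (S := (· ∉ Set.range Δ.dart)) (τ := Δ.W.formPerm) Δ.opp_of_notMem
        (fun a => not_congr (Δ.formPerm_mem_range a)) (by
          intro b hb
          rcases (by simpa using hb : b = X ∨ b = Y) with rfl | rfl
          exacts [hXd, hYd]) ha, hW,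
        show X :: Y :: W = [X, Y] ++ W from rfl, eraseList_formPerm_append hnd]
    planar := hd }⟩

/-- Contract an edge. -/
theorem IsPlane.contract (h : IsPlane g w) {g' : Multigraph V' E'} {e₀ : E} {x y : V}
    (he : g.ends e₀ = s(x, y)) {f : V → V'} (hf : ∀ a b, f a = f b ↔ merge ⊥ x y a b)
    {j : E' → E} (hj : Function.Injective j) (hr : ∀ e, e ∈ Set.range j ↔ e ≠ e₀)
    (hg : ∀ e, g'.ends e = (g.ends (j e)).map f) : IsPlane g' (w.map f) := by
  obtain ⟨Δ⟩ := h
  have hf' : ∀ a b, f a = f b ↔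
      merge ⊥ (Δ.vert (Δ.dart (e₀, false))) (Δ.vert (Δ.dart (e₀, true))) a b := by
    intro a b
    rw [hf, merge_apply, merge_apply]
    rw [Δ.ends_eq, Sym2.eq_iff] at he
    rcases he with ⟨h1, h2⟩ | ⟨h1, h2⟩
    · rw [h1, h2]
    · rw [h1, h2, or_comm (a := _ ∧ _)]
  set X := Δ.dart (e₀, false) with hX
  set Y := Δ.dart (e₀, true) with hY
  have hXW : X ∉ Δ.W := Δ.dart_notMem _
  have hYW : Y ∉ Δ.W := Δ.dart_notMem _
  have hXY : Δ.opp X = Y := Δ.opp_dart e₀ false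
  -- The edge may be a loop: then both darts lie in one cycle of the rotation and are merely erased.
  obtain ⟨rot, hd, hs⟩ := exists_glue Δ.planar hXY
  let dart := Δ.dart ∘ Prod.map j id
  have hdart : ∀ a, a ∈ Set.range dart ↔ a ∈ Set.range Δ.dart ∧ a ∉ [X, Y] := by
    intro a
    simp only [List.mem_cons, List.not_mem_nil, or_false, not_or]
    constructor
    · rintro ⟨⟨e, b⟩, rfl⟩
      have := (hr (j e)).1 ⟨e, rfl⟩
      refine ⟨⟨_, rfl⟩, fun h => this ?_, fun h => this ?_⟩
      · exact congrArg Prod.fst (Δ.dart_inj h)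
      · exact congrArg Prod.fst (Δ.dart_inj h)
    · rintro ⟨⟨⟨e, b⟩, rfl⟩, h1, h2⟩
      have : e ≠ e₀ := by
        rintro rfl
        cases b
        exacts [h1 rfl, h2 rfl]
      obtain ⟨e', rfl⟩ := (hr e).2 this
      exact ⟨(e', b), rfl⟩
  have hn : ∀ a, a ∈ Set.range dart ∨ a ∈ Δ.W → a ∉ [X, Y] := by
    rintro a (ha | ha)
    · exact ((hdart a).1 ha).2
    · simp only [List.mem_cons, List.not_mem_nil, or_false, not_or]
      constructor <;> rintro rfl <;> contradiction
  have hu : ∀ a, a ∈ Set.range dart ∨ a ∈ Δ.W → a ∈ Set.range Δ.dart ∨ a ∈ Δ.W := by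
    rintro a (h | h)
    exacts [Or.inl ((hdart a).1 h).1, Or.inr h]
  exact ⟨{ Δ with
    dart := dart
    dart_inj := Δ.dart_inj.comp (hj.prodMap Function.injective_id)
    dart_notMem := fun p => Δ.dart_notMem _
    vert := f ∘ Δ.vert
    ends_eq := fun e => by rw [hg, Δ.ends_eq]; rfl
    word := by rw [← List.map_map, Δ.word]
    rot := rot
    opp := eraseList Δ.opp [X, Y]
    rot_fix := fun a ha ha' => by
      have := (hs a (rot a)).1 (sameCycle_apply rot a)
      rcases this with h | ⟨h1, h2, h3⟩
      · exact h.symm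
      · have had : a ∉ Set.range Δ.dart := fun h => ha ((hdart a).2 ⟨h, h1⟩)
        rw [merge_apply] at h3
        simp only [List.mem_cons, List.not_mem_nil, or_false, not_or] at h1
        rcases h3 with h3 | ⟨h3, -⟩ | ⟨h3, -⟩
        · exact (Δ.sameCycle_eq had ha' h3).symm
        · exact absurd (Δ.sameCycle_eq had ha' h3) h1.1
        · exact absurd (Δ.sameCycle_eq had ha' h3) h1.2
    sameCycle := fun a b ha hb => by
      rw [hs, merge_sameCycle_iff Δ.sameCycle (Or.inl ⟨_, rfl⟩) (Or.inl ⟨_, rfl⟩) (hu a ha)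
        (hu b hb), ← hf']
      exact ⟨fun h => h.elim (fun h => congrArg _ h) fun h => h.2.2,
        fun h => Or.inr ⟨hn a ha, hn b hb, h⟩⟩
    opp_dart := fun e b => by
      have h1 : dart (e, b) ∉ [X, Y] := hn _ (Or.inl ⟨_, rfl⟩)
      have h2 : Δ.opp (dart (e, b)) = dart (e, !b) := Δ.opp_dart _ _
      rw [eraseList_of_notMem h1, h2]
      rw [h2]
      exact hn _ (Or.inl ⟨_, rfl⟩)
    opp_of_notMem := fun a ha => by
      by_cases h : a ∈ [X, Y]
      · rw [eraseList_of_mem h, List.formPerm_apply_of_notMem]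
        exact fun h' => hn a (Or.inr h') h
      · have had : a ∉ Set.range Δ.dart := fun k => ha ((hdart a).2 ⟨k, h⟩)
        have hb : Δ.opp a ∉ [X, Y] := by
          rw [Δ.opp_of_notMem a had]
          intro hm
          refine (Δ.formPerm_mem_range a).not.2 had ?_
          simp only [List.mem_cons, List.not_mem_nil, or_false] at hm
          rcases hm with hm | hm <;> rw [hm] <;> exact ⟨_, rfl⟩
        rw [eraseList_of_notMem h hb, Δ.opp_of_notMem a had]
    planar := hd }⟩

end Multigraph

/-! ### Restriction of permutations, cyclic rotations, and the sphere as genus zero -/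

namespace Hypermap

variable {D D' : Type*}

theorem exists_perm_of_injective [Finite D'] {j : D' → D} (hj : Function.Injective j)
    {σ : Perm D} (h : ∀ d, σ (j d) ∈ Set.range j) : ∃ σ' : Perm D', ∀ d, j (σ' d) = σ (j d) := by
  choose f hf using h
  have hi : Function.Injective f := fun a b hab => by
    have := hf a
    rw [hab, hf b] at this
    exact (hj (σ.injective this)).symm
  exact ⟨Equiv.ofBijective f (Finite.injective_iff_bijective.1 hi), hf⟩

theorem sameCycle_of_injective {j : D' → D} (hj : Function.Injective j) {σ : Perm D}
    {σ' : Perm D'} [Finite D] (h : ∀ d, j (σ' d) = σ (j d)) (a b : D') :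
    σ'.SameCycle a b ↔ σ.SameCycle (j a) (j b) := by
  constructor
  · exact fun hab => sameCycle_le (s := (Perm.SameCycle.setoid σ).comap j)
      (fun d => by rw [Setoid.comap_rel, h]; exact sameCycle_apply _ _) hab
  · intro hab
    obtain ⟨n, -, hn⟩ := hab.exists_pow_eq'
    have : ∀ n : ℕ, j ((σ' ^ n) a) = (σ ^ n) (j a) := by
      intro n
      induction n with
      | zero => rfl
      | succ n ih => rw [pow_succ', pow_succ', Perm.mul_apply, Perm.mul_apply, h, ih]
    exact ⟨n, hj (by rw [zpow_natCast, this, hn])⟩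

theorem sameCycle_finRotate {n : ℕ} (i j : Fin n) : (finRotate n).SameCycle i j := by
  obtain _ | n := n
  · exact i.elim0
  have key : ∀ j : Fin (n + 1), (finRotate (n + 1)).SameCycle 0 j := by
    intro j
    induction j using Fin.induction with
    | zero => exact .refl _ _
    | succ j ih =>
      have := sameCycle_apply (finRotate (n + 1)) j.castSucc
      rw [finRotate_apply, Fin.coeSucc_eq_succ] at this
      exact ih.trans this
  exact (key i).symm.trans (key j)

theorem val_finRotate {n : ℕ} (i : Fin n) : (finRotate n i : ℕ) = (i + 1) % n := by
  obtain _ | n := n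
  · exact i.elim0
  · rw [finRotate_apply, Fin.val_add, Fin.val_one', Nat.add_mod_mod]

theorem formPerm_getElem_finRotate [DecidableEq D] {W : List D} (hW : W.Nodup) {n : ℕ}
    (hn : W.length = n) (i : Fin n) :
    W.formPerm (W[(i : ℕ)]'(hn ▸ i.2)) = W[(finRotate n i : ℕ)]'(hn ▸ (finRotate n i).2) := by
  subst hn
  rw [List.formPerm_apply_getElem _ hW]
  simp only [val_finRotate]

theorem cyc_finRotate {n : ℕ} (hn : 0 < n) : cyc (finRotate n) = 1 := by
  have : Subsingleton (Quotient (Perm.SameCycle.setoid (finRotate n))) := by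
    refine ⟨fun p q => ?_⟩
    induction p using Quotient.inductionOn with | _ a
    induction q using Quotient.inductionOn with | _ b
    exact Quotient.sound (sameCycle_finRotate a b)
  have : Nonempty (Quotient (Perm.SameCycle.setoid (finRotate n))) := ⟨Quotient.mk _ ⟨0, hn⟩⟩
  rw [cyc, Nat.card_eq_one_iff_unique]
  exact ⟨inferInstance, inferInstance⟩

theorem cyc_of_isEmpty [IsEmpty D] (σ : Perm D) : cyc σ = 0 := by
  have : IsEmpty (Quotient (Perm.SameCycle.setoid σ)) :=
    ⟨fun q => q.inductionOn fun a => isEmptyElim a⟩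
  exact Nat.card_of_isEmpty

end Hypermap

namespace Multigraph

theorem flip_apply {E : Type} (e : E) (b : Bool) : flip E (e, b) = (e, !b) := rfl

theorem sameCycle_flip {E : Type} {d d' : E × Bool} : (flip E).SameCycle d d' ↔ d.1 = d'.1 := by
  constructor
  · exact fun h => sameCycle_le (s := Setoid.comap Prod.fst ⊥) (fun d => rfl) h
  · obtain ⟨e, b⟩ := d
    obtain ⟨e', b'⟩ := d'
    rintro rfl
    by_cases h : b = b'
    · rw [h]
    · have : b' = !b := by cases b <;> cases b' <;> simp_all
      rw [this]
      exact sameCycle_apply (flip E) (e, b)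

theorem cyc_flip (E : Type) : cyc (flip E) = Nat.card E := by
  refine Nat.card_congr (Equiv.ofBijective (Quotient.lift Prod.fst fun a b h =>
    sameCycle_flip.1 h) ⟨?_, ?_⟩)
  · intro p q h
    induction p using Quotient.inductionOn with | _ a
    induction q using Quotient.inductionOn with | _ b
    exact Quotient.sound (sameCycle_flip.2 h)
  · exact fun e => ⟨Quotient.mk _ (e, false), rfl⟩

/-- There are twice as many darts as edges, and `flip` has one cycle per edge, so Euler's formula
says that the defect vanishes. -/
theorem Embedding.isSpherical_iff {V E : Type} {g : Multigraph V E} (ε : g.Embedding) :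
    ε.IsSpherical ↔ defect ε.rot (flip E) = 0 := by
  have h : ε.numComponents = comps ε.rot (flip E) :=
    Nat.card_congr (Quot.congr (Equiv.refl _) fun a b => Iff.rfl |>.trans Iff.rfl) |>.trans
      (Nat.card_congr (Equiv.ofBijective (Quot.lift (Quotient.mk (conn ε.rot (flip E)))
        fun a b h => Quotient.sound (Relation.EqvGen.rel _ _ h))
        ⟨fun p q h => by
          induction p using Quot.ind with | _ a
          induction q using Quot.ind with | _ b
          exact Quot.eqvGen_sound (Quotient.exact h), fun q => by
          induction q using Quotient.inductionOn with | _ a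
          exact ⟨Quot.mk _ a, rfl⟩⟩))
  rw [IsSpherical, h, defect, cyc_flip, Nat.card_prod, Nat.card_eq_two_iff.2 ⟨false, true, by simp,
    by ext b; cases b <;> simp⟩]
  change cyc ε.rot + cyc (ε.rot * flip E) = _ ↔ _
  push_cast
  omega

end Multigraph

namespace Hypermap

/-- Erase the cycle of `σ` through a list. -/
theorem exists_erase_formPerm {D : Type*} [DecidableEq D] [Finite D] {σ : Perm D} {W : List D}
    (hW : W.Nodup) (h : ∀ x ∈ W, σ x = W.formPerm x) :
    ∃ τ : Perm D, (∀ x ∈ W, τ x = x) ∧ (∀ x ∉ W, τ x = σ x) ∧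
      cyc σ + W.length = cyc τ + cyc (finRotate W.length) := by
  have hcl : ∀ x y, σ.SameCycle x y → (x ∈ W ↔ y ∈ W) := by
    intro x y hxy
    have hm : ∀ d, d ∈ W → σ d ∈ W := fun d hd => by
      rw [h d hd, List.formPerm_mem_iff_mem]; exact hd
    have hm' : ∀ d, σ d ∈ W → d ∈ W := by
      have hfin := Finite.injective_iff_surjective.1
        (fun a b hab => Subtype.ext (σ.injective (congrArg Subtype.val hab)) :
        Function.Injective (fun d : {d // d ∈ W} => (⟨σ d.1, hm d.1 d.2⟩ : {d // d ∈ W})))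
      intro d hd
      obtain ⟨⟨e, he⟩, hee⟩ := hfin ⟨_, hd⟩
      rwa [← σ.injective (congrArg Subtype.val hee)]
    exact iff_of_eq (sameCycle_le (s := Setoid.comap (· ∈ W) ⊥)
      (fun d => propext ⟨hm d, hm' d⟩) hxy)
  have hsc : ∀ x ∈ W, ∀ y ∈ W, σ.SameCycle x y := by
    intro x hx y hy
    obtain ⟨n, -, rfl⟩ := (sameCycle_formPerm hW hx hy).exists_pow_eq'
    clear hy
    induction n with
    | zero => exact .refl _ _
    | succ n ih =>
      refine ih.trans ?_
      rw [pow_succ', Perm.mul_apply, ← h _ ((hcl _ _ ih).1 hx)]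
      exact sameCycle_apply _ _
  cases W with
  -- An empty list has no cycle to erase; the formula holds since `finRotate 0` has no cycles.
  | nil => exact ⟨σ, by simp, fun _ _ => rfl, by
      have : IsEmpty (Fin ([] : List D).length) := Fin.isEmpty
      rw [cyc_of_isEmpty (finRotate _)]; rfl⟩
  | cons x l =>
    refine ⟨eraseList σ l, fun y hy => ?_, fun y hy => ?_, ?_⟩
    · have := sameCycle_apply (eraseList σ l) y
      rw [sameCycle_eraseList] at this
      rcases this with h' | ⟨h1, h2, h3⟩
      · exact h'.symm
      · have := (hcl _ _ h3).1 hy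
        rw [List.mem_cons] at this hy
        rw [this.resolve_right h2, hy.resolve_right h1]
    · have hy' : σ y ∉ x :: l := fun k => hy ((hcl _ _ (sameCycle_apply σ y)).2 k)
      simp only [List.mem_cons, not_or] at hy hy'
      exact eraseList_of_notMem hy.2 hy'.2
    · rw [cyc_finRotate (by simp), cyc_eraseList hW fun d hd => hsc _ (by simp) _ (by simp [hd]),
        List.length_cons]
      ring

/-! ### Attaching a wheel to the boundary of a disc -/

section Cap

/-- The darts of a graph with labels, and those of a wheel with `n` spokes: four darts at every
vertex of the rim and `n` darts at the hub. -/
abbrev CapDart (D : Type) (n : ℕ) : Type := D ⊕ ((Fin 4 × Fin n) ⊕ Fin n)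

variable {D : Type} {n : ℕ} {t : Fin n → D} {c : Perm (Fin n)} {rot opp : Perm D}

/-- The rotation at the rim of the wheel. -/
def rimRot (n : ℕ) : Perm (Fin 4 × Fin n) := (finRotate 4).prodCongr (Equiv.refl _)

theorem sameCycle_rimRot {a b : Fin 4 × Fin n} : (rimRot n).SameCycle a b ↔ a.2 = b.2 := by
  constructor
  · exact fun h => sameCycle_le (s := Setoid.comap Prod.snd ⊥) (fun d => rfl) h
  · obtain ⟨a, i⟩ := a
    obtain ⟨b, j⟩ := b
    rintro rfl
    exact (sameCycle_of_injective (σ := rimRot n) (j := fun a : Fin 4 => (a, i))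
      (fun a b h => congrArg Prod.fst h) (fun d => rfl) a b).1 (sameCycle_finRotate a b)

theorem cyc_rimRot : cyc (rimRot n) = n := by
  have e : Quotient (Perm.SameCycle.setoid (rimRot n)) ≃ Fin n := by
    refine Equiv.ofBijective (Quotient.lift Prod.snd fun a b h => sameCycle_rimRot.1 h) ⟨?_, ?_⟩
    · intro p q h
      induction p using Quotient.inductionOn with | _ a
      induction q using Quotient.inductionOn with | _ b
      exact Quotient.sound (sameCycle_rimRot.2 h)
    · exact fun i => ⟨Quotient.mk _ (0, i), rfl⟩
  rw [cyc, Nat.card_congr e, Nat.card_fin]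

/-- The rotation of the capped graph. -/
def capRot (c : Perm (Fin n)) (rot : Perm D) : Perm (CapDart D n) :=
  rot.sumCongr ((rimRot n).sumCongr c)

theorem sameCycle_capRot_inl {x y : D} :
    (capRot c rot).SameCycle (.inl x) (.inl y) ↔ rot.SameCycle x y := by
  have := Setoid.ext_iff.1 (sameCycle_sumCongr rot ((rimRot n).sumCongr c)) (.inl x) (.inl y)
  exact this.trans Sum.liftRel_inl_inl

theorem sameCycle_capRot_inr_inl {x y : Fin 4 × Fin n} :
    (capRot c rot).SameCycle (.inr (.inl x)) (.inr (.inl y)) ↔ (rimRot n).SameCycle x y := by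
  have h := Setoid.ext_iff.1 (sameCycle_sumCongr rot ((rimRot n).sumCongr c)) (.inr (.inl x))
    (.inr (.inl y))
  have h' := Setoid.ext_iff.1 (sameCycle_sumCongr (rimRot n) c) (.inl x) (.inl y)
  exact h.trans (Sum.liftRel_inr_inr.trans (h'.trans Sum.liftRel_inl_inl))

theorem sameCycle_capRot_inr_inr {x y : Fin n} :
    (capRot c rot).SameCycle (.inr (.inr x)) (.inr (.inr y)) ↔ c.SameCycle x y := by
  have h := Setoid.ext_iff.1 (sameCycle_sumCongr rot ((rimRot n).sumCongr c)) (.inr (.inr x))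
    (.inr (.inr y))
  have h' := Setoid.ext_iff.1 (sameCycle_sumCongr (rimRot n) c) (.inr x) (.inr y)
  exact h.trans (Sum.liftRel_inr_inr.trans (h'.trans Sum.liftRel_inr_inr))

open Classical in
/-- The other ends of the darts of the capped graph. -/
noncomputable def capOppFun (t : Fin n → D) (c : Perm (Fin n)) (opp : Perm D) : CapDart D n → CapDart D n
  | .inl x => if h : ∃ i, t i = x then .inr (.inl (0, h.choose)) else .inl (opp x)
  | .inr (.inl (0, i)) => .inl (t i)
  | .inr (.inl (1, i)) => .inr (.inl (3, c i))
  | .inr (.inl (2, i)) => .inr (.inr i)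
  | .inr (.inl (3, i)) => .inr (.inl (1, c.symm i))
  | .inr (.inr i) => .inr (.inl (2, i))

theorem capOppFun_label (ht : Function.Injective t) (i : Fin n) :
    capOppFun t c opp (.inl (t i)) = .inr (.inl (0, i)) := by
  have h : ∃ j, t j = t i := ⟨i, rfl⟩
  have : capOppFun t c opp (.inl (t i)) = .inr (.inl (0, h.choose)) := dif_pos h
  rw [this, ht h.choose_spec]

theorem capOppFun_of_notMem {x : D} (hx : x ∉ Set.range t) :
    capOppFun t c opp (.inl x) = .inl (opp x) := dif_neg hx

variable (ht : Function.Injective t)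
  (ho : ∀ x ∉ Set.range t, opp x ∉ Set.range t ∧ opp (opp x) = x)

include ht ho

theorem capOppFun_involutive : Function.Involutive (capOppFun t c opp) := by
  rintro (x | ⟨a, i⟩ | i)
  · by_cases hx : x ∈ Set.range t
    · obtain ⟨i, rfl⟩ := hx
      rw [capOppFun_label ht]
      rfl
    · rw [capOppFun_of_notMem hx, capOppFun_of_notMem (ho x hx).1, (ho x hx).2]
  · fin_cases a
    · exact capOppFun_label ht i
    · simp [capOppFun]
    · simp [capOppFun]
    · simp [capOppFun]
  · rfl

variable (c) in
/-- The other ends of the darts of the capped graph. -/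
noncomputable def capOpp : Perm (CapDart D n) := (capOppFun_involutive (c := c) ht ho).toPerm

theorem capOpp_apply (x : CapDart D n) : capOpp c ht ho x = capOppFun t c opp x := rfl

/-- Every dart of the wheel is connected to some label, and the rim connects consecutive labels in
place of the former cycle of `opp`. -/
theorem comps_cap_le [Finite D] (hc : ∀ i, opp (t i) = t (c i)) :
    comps (capRot c rot) (capOpp c ht ho) ≤ comps rot opp := by
  have h1 := conn_left (capRot c rot) (capOpp c ht ho)
  have h2 := conn_right (capRot c rot) (capOpp c ht ho)
  set r := conn (capRot c rot) (capOpp c ht ho) with hr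
  have ht' : ∀ i, r (.inl (t i)) (.inr (.inl (0, i))) := fun i => by
    have := h2 (.inl (t i))
    rwa [capOpp_apply, capOppFun_label ht] at this
  have h01 : ∀ i, r (.inr (.inl (0, i))) (.inr (.inl (1, i))) := fun i => h1 (.inr (.inl (0, i)))
  have h12 : ∀ i, r (.inr (.inl (1, i))) (.inr (.inl (2, i))) := fun i => h1 (.inr (.inl (1, i)))
  have h30 : ∀ i, r (.inr (.inl (3, i))) (.inr (.inl (0, i))) := fun i => h1 (.inr (.inl (3, i)))
  have h13 : ∀ i, r (.inr (.inl (1, i))) (.inr (.inl (3, c i))) :=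
    fun i => h2 (.inr (.inl (1, i)))
  have h2h : ∀ i, r (.inr (.inl (2, i))) (.inr (.inr i)) := fun i => h2 (.inr (.inl (2, i)))
  have hle : conn rot opp ≤ r.comap Sum.inl := by
    refine conn_le (fun d => h1 (.inl d)) fun d => ?_
    rw [Setoid.comap_rel]
    by_cases hd : d ∈ Set.range t
    · obtain ⟨i, rfl⟩ := hd
      rw [hc]
      exact r.trans' (ht' i) (r.trans' (h01 i) (r.trans' (h13 i) (r.trans' (h30 _)
        (r.symm' (ht' _)))))
    · have := h2 (.inl d)
      rwa [capOpp_apply, capOppFun_of_notMem hd] at this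
  refine Nat.card_le_card_of_surjective (Quotient.map' Sum.inl fun a b h => hle h) fun q => ?_
  induction q using Quotient.inductionOn with | _ a
  have hsub : ∀ i, ∃ d : D, r (.inl d) (.inr (.inl (1, i))) :=
    fun i => ⟨t i, r.trans' (ht' i) (h01 i)⟩
  suffices h : ∃ d : D, r (.inl d) a by
    obtain ⟨d, hd⟩ := h
    exact ⟨Quotient.mk _ d, Quotient.sound hd⟩
  rcases a with d | ⟨a, i⟩ | i
  · exact ⟨d, r.refl' _⟩
  · fin_cases a
    · exact ⟨t i, ht' i⟩
    · exact hsub i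
    · exact ⟨t i, r.trans' (ht' i) (r.trans' (h01 i) (h12 i))⟩
    · exact ⟨t i, r.trans' (ht' i) (r.symm' (h30 i))⟩
  · exact ⟨t i, r.trans' (ht' i) (r.trans' (h01 i) (r.trans' (h12 i) (h2h i)))⟩

/-- Lower bounds for the numbers of edges and faces suffice. Each erasure creates at most one
further cycle, and after erasing suitable rim darts one is left with `τ`, respectively with the old
faces, all darts of the wheel being fixed. -/
theorem defect_cap_le [Finite D] (hc : ∀ i, opp (t i) = t (c i)) {τ : Perm D}
    (h1 : ∀ i, τ (t i) = t i) (h2 : ∀ x ∉ Set.range t, τ x = opp x)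
    (h3 : cyc opp + n = cyc τ + cyc c) :
    defect (capRot c rot) (capOpp c ht ho) ≤ defect rot opp := by
  classical
  have hcomps := comps_cap_le (rot := rot) ht ho hc
  have hrot : cyc (capRot c rot) = cyc rot + (n + cyc c) := by
    rw [capRot, cyc_sumCongr, cyc_sumCongr, cyc_rimRot]
  -- One dart of each of the `3 * n` new edges is erased, whereupon the other dart is fixed. This is
  -- why the comparison is with `τ`, which fixes the labels.
  have hopp : cyc τ + 5 * n ≤ cyc (capOpp c ht ho) + 3 * n := by
    let L : List (CapDart D n) := (Finset.univ : Finset (Fin 3 × Fin n)).toList.map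
      fun p => .inr (.inl (p.1.castSucc, p.2))
    have hL : L.length = 3 * n := by simp [L]
    have e : eraseList (capOpp c ht ho) L = τ.sumCongr 1 := by
      ext x
      rcases x with x | ⟨a, i⟩ | i
      · have hx : (.inl x : CapDart D n) ∉ L := by simp [L]
        by_cases hxt : x ∈ Set.range t
        · obtain ⟨i, rfl⟩ := hxt
          refine eraseList_eq_of_skip (.skip (z := .inr (.inl (0, i))) ?_ ?_ (.step ?_ ?_)) hx
          · exact capOppFun_label (c := c) ht i
          · simp [L]
          · simp [capOpp_apply, capOppFun, h1]
          · simp [L]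
        · refine eraseList_eq_of_skip (.step ?_ ?_) hx
          · rw [capOpp_apply, capOppFun_of_notMem hxt, ← h2 x hxt]
            rfl
          · simp [L]
      · by_cases ha : a = 3
        · subst ha
          refine eraseList_eq_of_skip (.skip (z := .inr (.inl (1, c.symm i))) rfl ?_
            (.step ?_ ?_)) ?_
          · simp only [L, List.mem_map]; exact ⟨(1, c.symm i), by simp, rfl⟩
          · simp [capOpp_apply, capOppFun]
          · simp only [L, List.mem_map]; rintro ⟨⟨a, j⟩, -, h⟩; fin_cases a <;> simp at h
          · simp only [L, List.mem_map]; rintro ⟨⟨a, j⟩, -, h⟩; fin_cases a <;> simp at h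
        · refine eraseList_of_mem (List.mem_map.2 ⟨(a.castPred ha, i), by simp, by simp⟩)
      · refine eraseList_eq_of_skip (.skip (z := .inr (.inl (2, i))) rfl ?_ (.step ?_ ?_)) ?_
        · simp only [L, List.mem_map]; exact ⟨(2, i), by simp, rfl⟩
        · simp [capOpp_apply, capOppFun]
        · simp [L]
        · simp [L]
    have := cyc_eraseList_le (capOpp c ht ho) L
    rw [e, cyc_sumCongr, cyc_one, hL] at this
    simp only [Nat.card_sum, Nat.card_prod, Nat.card_fin] at this
    omega
  -- Where a face used to pass from one label to the next, it now takes the rim edge between them;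
  -- the triangles at the hub shrink to fixed points.
  have hface : cyc (rot * opp) + 5 * n ≤ cyc (capRot c rot * capOpp c ht ho) + 4 * n := by
    let L : List (CapDart D n) := (Finset.univ : Finset (Fin 4 × Fin n)).toList.map
      fun p => .inr (.inl p)
    have hL : L.length = 4 * n := by simp [L]
    have hm : ∀ p, (.inr (.inl p) : CapDart D n) ∈ L := by simp [L]
    have e : eraseList (capRot c rot * capOpp c ht ho) L = (rot * opp).sumCongr 1 := by
      ext x
      rcases x with x | p | i
      · have hx : ∀ x, (.inl x : CapDart D n) ∉ L := by simp [L]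
        by_cases hxt : x ∈ Set.range t
        · obtain ⟨i, rfl⟩ := hxt
          refine eraseList_eq_of_skip (.skip (z := .inr (.inl (1, i))) ?_ (hm _)
            (.skip (z := .inr (.inl (0, c i))) ?_ (hm _) (.step ?_ (hx _)))) (hx _)
          · rw [Perm.mul_apply, capOpp_apply, capOppFun_label ht]; rfl
          · rfl
          · simp [capOpp_apply, capOppFun, hc, capRot]
        · refine eraseList_eq_of_skip (.step ?_ (hx _)) (hx _)
          rw [Perm.mul_apply, capOpp_apply, capOppFun_of_notMem hxt]
          rfl
      · exact eraseList_of_mem (hm _)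
      · have hx : ∀ x, (.inr (.inr x) : CapDart D n) ∉ L := by simp [L]
        refine eraseList_eq_of_skip (.skip (z := .inr (.inl (3, i))) rfl (hm _)
          (.skip (z := .inr (.inl (2, c.symm i))) rfl (hm _) (.step ?_ (hx _)))) (hx _)
        simp [capOpp_apply, capOppFun, capRot]
    have := cyc_eraseList_le (capRot c rot * capOpp c ht ho) L
    rw [e, cyc_sumCongr, cyc_one, hL] at this
    simp only [Nat.card_sum, Nat.card_prod, Nat.card_fin] at this
    omega
  rw [defect, defect, hrot]
  simp only [Nat.card_sum, Nat.card_prod, Nat.card_fin]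
  push_cast
  omega

end Cap

end Hypermap

namespace BilabelledGraph

variable {k l : ℕ} (K : BilabelledGraph k l)

/-- The wheel is attached to the boundary cycle. Points that are neither darts nor labels are fixed
by both permutations and can be dropped. -/
theorem isPlanar_of_isPlane (h : K.graph.IsPlane (List.ofFn K.boundary)) : K.IsPlanar := by
  classical
  have := K.finiteE
  obtain ⟨Δ⟩ := h
  have hlen : Δ.W.length = k + l := by
    have := congrArg List.length Δ.word
    simpa using this
  let t : Fin (k + l) → Δ.D := fun i => Δ.W[(i : ℕ)]'(hlen.symm ▸ i.2)
  have htW : ∀ x, x ∈ Set.range t ↔ x ∈ Δ.W := by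
    intro x
    constructor
    · rintro ⟨i, rfl⟩
      exact List.getElem_mem _
    · intro hx
      obtain ⟨i, hi, rfl⟩ := List.getElem_of_mem hx
      exact ⟨⟨i, hlen.le.trans_lt' hi⟩, rfl⟩
  have ht : Function.Injective t := fun i j hij =>
    Fin.ext ((List.Nodup.getElem_inj_iff Δ.nodup).1 hij)
  have htv : ∀ i, Δ.vert (t i) = K.boundary i := by
    intro i
    have h1 : (Δ.W.map Δ.vert)[(i : ℕ)]'(by simp [hlen]) =
        (List.ofFn K.boundary)[(i : ℕ)]'(by simp) := by
      congr 1; exact Δ.word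
    simpa using h1
  have htd : ∀ i, t i ∉ Set.range Δ.dart := by
    rintro i ⟨p, hp⟩
    exact Δ.dart_notMem p (hp ▸ (htW _).1 ⟨i, rfl⟩)
  have htd' : ∀ p, Δ.dart p ∉ Set.range t := fun p => by rw [htW]; exact Δ.dart_notMem p
  let c := finRotate (k + l)
  have hto : ∀ i, Δ.opp (t i) = t (c i) := fun i => by
    rw [Δ.opp_of_notMem _ (htd i)]
    exact formPerm_getElem_finRotate Δ.nodup hlen i
  have hofix : ∀ x ∉ Set.range Δ.dart, x ∉ Set.range t → Δ.opp x = x := fun x h h' => by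
    rw [Δ.opp_of_notMem x h, List.formPerm_apply_of_notMem (by rwa [← htW])]
  have ho : ∀ x ∉ Set.range t, Δ.opp x ∉ Set.range t ∧ Δ.opp (Δ.opp x) = x := by
    intro x hx
    by_cases hd : x ∈ Set.range Δ.dart
    · obtain ⟨⟨e, b⟩, rfl⟩ := hd
      rw [Δ.opp_dart, Δ.opp_dart, Bool.not_not]
      exact ⟨htd' _, rfl⟩
    · rw [hofix x hd hx, hofix x hd hx]
      exact ⟨hx, rfl⟩
  have hdefect : defect (capRot c Δ.rot) (capOpp c ht ho) = 0 := by
    obtain ⟨τ, h1, h2, h3⟩ := exists_erase_formPerm (σ := Δ.opp) Δ.nodup fun x hx =>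
      Δ.opp_of_notMem x fun ⟨p, hp⟩ => Δ.dart_notMem p (hp ▸ hx)
    rw [hlen] at h3
    refine le_antisymm ?_ (defect_nonneg _ _)
    rw [← Δ.planar]
    exact defect_cap_le ht ho hto (fun i => h1 _ ((htW _).1 ⟨i, rfl⟩))
      (fun x hx => h2 x (by rwa [← htW])) h3
  -- The four darts at a vertex of the rim in cyclic order: `0` to the label, `1` forwards, `2` to
  -- the hub, `3` backwards. The rim edge `i` ends at `c i`.
  let j : ((K.E ⊕ (Fin (k + l) ⊕ Fin (k + l))) ⊕ Fin (k + l)) × Bool → CapDart Δ.D (k + l) :=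
    fun p => match p with
    | (.inl (.inl e), b) => .inl (Δ.dart (e, b))
    | (.inl (.inr (.inl i)), false) => .inl (t i)
    | (.inl (.inr (.inl i)), true) => .inr (.inl (0, i))
    | (.inl (.inr (.inr i)), false) => .inr (.inl (1, i))
    | (.inl (.inr (.inr i)), true) => .inr (.inl (3, c i))
    | (.inr i, false) => .inr (.inl (2, i))
    | (.inr i, true) => .inr (.inr i)
  have hj : Function.Injective j := by
    rintro ⟨(e | i | i) | i, _ | _⟩ ⟨(e' | i' | i') | i', _ | _⟩ h <;>
      simp only [j, Sum.inl.injEq, Sum.inr.injEq, Prod.mk.injEq, reduceCtorEq, Δ.dart_inj.eq_iff,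
        ht.eq_iff, c.injective.eq_iff] at h <;>
      first
        | exact absurd ⟨_, h⟩ (htd _)
        | exact absurd ⟨_, h.symm⟩ (htd _)
        | (simp only [Prod.mk.injEq, Sum.inl.injEq, Sum.inr.injEq]; tauto)
  have hjl : ∀ x, (.inl x : CapDart Δ.D (k + l)) ∈ Set.range j ↔
      x ∈ Set.range Δ.dart ∨ x ∈ Set.range t := by
    intro x
    constructor
    · rintro ⟨⟨(e | i | i) | i, _ | _⟩, h⟩ <;>
        simp only [j, Sum.inl.injEq, reduceCtorEq] at h <;> subst h
      · exact Or.inl ⟨_, rfl⟩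
      · exact Or.inl ⟨_, rfl⟩
      · exact Or.inr ⟨_, rfl⟩
    · rintro (⟨⟨e, b⟩, rfl⟩ | ⟨i, rfl⟩)
      · exact ⟨(.inl (.inl e), b), rfl⟩
      · exact ⟨(.inl (.inr (.inl i)), false), rfl⟩
  have hjr : ∀ x, (.inr x : CapDart Δ.D (k + l)) ∈ Set.range j := by
    rintro (⟨a, i⟩ | i)
    · fin_cases a
      · exact ⟨(.inl (.inr (.inl i)), true), rfl⟩
      · exact ⟨(.inl (.inr (.inr i)), false), rfl⟩
      · exact ⟨(.inr i, false), rfl⟩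
      · exact ⟨(.inl (.inr (.inr (c.symm i))), true), by simp only [j, Equiv.apply_symm_apply]; rfl⟩
    · exact ⟨(.inr i, true), rfl⟩
  have hfixr : ∀ x ∉ Set.range j, capRot c Δ.rot x = x := by
    rintro (x | x) hx
    · rw [hjl, not_or, htW] at hx
      exact congrArg Sum.inl (Δ.rot_fix x hx.1 hx.2)
    · exact absurd (hjr x) hx
  have hfixo : ∀ x ∉ Set.range j, capOpp c ht ho x = x := by
    rintro (x | x) hx
    · rw [hjl, not_or] at hx
      rw [capOpp_apply, capOppFun_of_notMem hx.2, hofix x hx.1 hx.2]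
    · exact absurd (hjr x) hx
  have hflip : ∀ d, j (Multigraph.flip _ d) = capOpp c ht ho (j d) := by
    rintro ⟨(e | i | i) | i, _ | _⟩ <;> rw [Multigraph.flip_apply, capOpp_apply]
    · exact ((capOppFun_of_notMem (htd' _)).trans (congrArg _ (Δ.opp_dart _ _))).symm
    · exact ((capOppFun_of_notMem (htd' _)).trans (congrArg _ (Δ.opp_dart _ _))).symm
    · exact (capOppFun_label ht i).symm
    · rfl
    · rfl
    · simp [j, capOppFun]
    · rfl
    · rfl
  obtain ⟨ρ, hρ⟩ := exists_perm_of_injective hj (σ := capRot c Δ.rot) fun d => by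
    by_contra hd
    have h1 := (capRot c Δ.rot).injective (hfixr _ hd)
    exact hd ⟨d, h1.symm⟩
  let vert : CapDart Δ.D (k + l) → (K.V ⊕ Fin (k + l)) ⊕ Unit :=
    Sum.elim (fun x => .inl (.inl (Δ.vert x))) (Sum.elim (fun p => .inl (.inr p.2))
      fun _ => .inr ())
  have hvert : ∀ x ∈ Set.range j, ∀ y ∈ Set.range j,
      ((capRot c Δ.rot).SameCycle x y ↔ vert x = vert y) := by
    intro x hx y hy
    rcases x with x | x <;> rcases y with y | y
    · rw [sameCycle_capRot_inl]
      rw [hjl, htW] at hx hy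
      simpa [vert] using Δ.sameCycle x y hx hy
    · refine iff_of_false (fun h => ?_) ?_
      · cases (sameCycle_sumCongr _ _).le h
      · rcases y with y | y <;> simp [vert]
    · refine iff_of_false (fun h => ?_) ?_
      · cases (sameCycle_sumCongr _ _).le h
      · rcases x with x | x <;> simp [vert]
    · rcases x with x | x <;> rcases y with y | y
      · rw [sameCycle_capRot_inr_inl, sameCycle_rimRot]
        simp [vert]
      · refine iff_of_false (fun h => ?_) (by simp [vert])
        cases (sameCycle_sumCongr _ _).le h with | inr h => cases (sameCycle_sumCongr _ _).le h
      · refine iff_of_false (fun h => ?_) (by simp [vert])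
        cases (sameCycle_sumCongr _ _).le h with | inr h => cases (sameCycle_sumCongr _ _).le h
      · rw [sameCycle_capRot_inr_inr]
        exact iff_of_true (sameCycle_finRotate _ _) rfl
  refine ⟨{
    src := vert ∘ j
    ends_eq := ?_
    rot := ρ
    sameCycle_rot_iff := fun d d' => ?_ }, ?_⟩
  · rintro ((e | i | i) | i)
    · simp [capped, enveloped, Δ.ends_eq, vert, j]
    · simp [capped, enveloped, htv, vert, j]
    · simp [capped, enveloped, vert, j, c]
    · simp [capped, vert, j]
  · rw [sameCycle_of_injective hj hρ, hvert _ ⟨_, rfl⟩ _ ⟨_, rfl⟩]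
    rfl
  · rw [Multigraph.Embedding.isSpherical_iff]
    rw [← defect_of_injective hj hρ hflip hfixr hfixo]
    exact hdefect

end BilabelledGraph

/-! ### Rigidity of the wheel in the sphere -/

namespace Hypermap

/-- With one vertex, one hyperedge and one component, Euler's formula leaves as many faces as
points, so every face is trivial. -/
theorem mul_eq_one_of_defect {D : Type*} [Finite D] [Nonempty D] {σ τ : Perm D}
    (hσ : ∀ a b, σ.SameCycle a b) (hτ : ∀ a b, τ.SameCycle a b) (h : defect σ τ = 0) :
    σ * τ = 1 := by
  have key : ∀ r : Setoid D, (∀ a b, r a b) → Nat.card (Quotient r) = 1 := by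
    intro r hr
    rw [Nat.card_eq_one_iff_unique]
    refine ⟨⟨fun p q => ?_⟩, ⟨Quotient.mk _ (Classical.arbitrary D)⟩⟩
    induction p using Quotient.inductionOn with | _ a
    induction q using Quotient.inductionOn with | _ b
    exact Quotient.sound (hr a b)
  have h1 : cyc σ = 1 := key _ hσ
  have h2 : cyc τ = 1 := key _ hτ
  have h3 : comps σ τ = 1 := key _ fun a b => conn_of_sameCycle_left τ (hσ a b)
  rw [defect, h1, h2, h3] at h
  have h4 : Nat.card (Quotient (Perm.SameCycle.setoid (σ * τ))) = Nat.card D := by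
    rw [cyc] at h; push_cast at h; omega
  have h5 : Function.Injective (Quotient.mk (Perm.SameCycle.setoid (σ * τ))) :=
    ((Nat.bijective_iff_surjective_and_card _).2 ⟨Quotient.mk_surjective, h4.symm⟩).1
  ext a
  exact h5 (Quotient.sound (s := Perm.SameCycle.setoid (σ * τ)) (sameCycle_apply _ a).symm)

section Wheel

variable {n : ℕ}

/-- The end vertex of a dart of the wheel with `n` spokes; `none` is the hub. The four darts at the
`i`-th spoke lead forwards and backwards along the rim, to the hub, and from the hub. -/
def wheelVertex (a : Fin 4 × Fin n) : Option (Fin n) := if a.1 = 3 then none else some a.2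

/-- In the sphere, the rotation at the hub of a wheel is one of the two orientations of the rim. -/
theorem wheel_rot (hn : 0 < n) {c : Perm (Fin n)} (hc : ∀ i j, c.SameCycle i j)
    {σ α : Perm (Fin 4 × Fin n)} (hα0 : ∀ i, α (0, i) = (1, c i))
    (hα1 : ∀ i, α (1, i) = (0, c.symm i)) (hα2 : ∀ i, α (2, i) = (3, i))
    (hα3 : ∀ i, α (3, i) = (2, i))
    (hσ : ∀ a b, σ.SameCycle a b ↔ wheelVertex a = wheelVertex b) (h : defect σ α = 0) :
    (∀ i, σ (3, i) = (3, c i)) ∨ ∀ i, σ (3, i) = (3, c.symm i) := by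
  have : Nonempty (Fin n) := ⟨⟨0, hn⟩⟩
  have hv : ∀ a, wheelVertex (σ a) = wheelVertex a := fun a =>
    ((hσ _ _).1 (sameCycle_apply σ a)).symm
  have hv3 : ∀ i, ∃ j, σ (3, i) = (3, j) := by
    intro i
    have := hv (3, i)
    rcases hs : σ (3, i) with ⟨b, j⟩
    rw [hs] at this
    by_cases hb : b = 3
    · exact ⟨j, by rw [hb]⟩
    · simp [wheelVertex, hb] at this
  -- The three darts at a vertex of the rim form one cycle, hence none of them is fixed.
  have hvi : ∀ a i, a ≠ 3 → ∃ b, b ≠ 3 ∧ b ≠ a ∧ σ (a, i) = (b, i) := by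
    intro a i ha
    have := hv (a, i)
    rcases hs : σ (a, i) with ⟨b, j⟩
    rw [hs] at this
    have hb : b ≠ 3 := by rintro rfl; simp [wheelVertex, ha] at this
    simp only [wheelVertex, ha, hb, if_false, Option.some.injEq] at this
    refine ⟨b, hb, ?_, by rw [this]⟩
    rintro rfl
    obtain ⟨b', hb', hb3⟩ :=
      (by decide : ∀ b : Fin 4, ∃ b' : Fin 4, b' ≠ b ∧ b' ≠ 3) b
    have hs' : σ.SameCycle (b, i) (b', i) := (hσ _ _).2 (by simp [wheelVertex, ha, hb3])
    have := hs'.eq_of_left (by rw [Function.IsFixedPt, hs, this])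
    exact hb' (congrArg Prod.fst this).symm
  have hcσ : cyc σ ≤ n + 1 := by
    have := card_quotient_le (Perm.SameCycle.setoid σ)
      ((Finset.univ : Finset (Option (Fin n))).image
        fun o => o.elim ((3 : Fin 4), Classical.arbitrary (Fin n)) fun i => (0, i)) (by
      rintro a
      refine ⟨_, Finset.mem_image.2 ⟨wheelVertex a, Finset.mem_univ _, rfl⟩, (hσ _ _).2 ?_⟩
      cases h : wheelVertex a <;> simp [wheelVertex])
    refine this.trans (Finset.card_image_le.trans ?_)
    simp
  have hcα : cyc α ≤ 2 * n := by
    have := card_quotient_le (Perm.SameCycle.setoid α)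
      ((Finset.univ : Finset (Fin 2 × Fin n)).image
        fun p => (if p.1 = 0 then (0 : Fin 4) else 2, p.2)) (by
      rintro ⟨a, i⟩
      have h := fun b j (e : α (b, j) = (a, i)) => (e ▸ sameCycle_apply α (b, j) :
        α.SameCycle (b, j) (a, i))
      fin_cases a
      · exact ⟨(0, i), Finset.mem_image.2 ⟨(0, i), by simp, rfl⟩, .refl _ _⟩
      · exact ⟨(0, c.symm i), Finset.mem_image.2 ⟨(0, c.symm i), by simp, rfl⟩,
          h _ _ (by simp [hα0])⟩
      · exact ⟨(2, i), Finset.mem_image.2 ⟨(1, i), by simp, rfl⟩, .refl _ _⟩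
      · exact ⟨(2, i), Finset.mem_image.2 ⟨(1, i), by simp, rfl⟩, h _ _ (by simp [hα2])⟩)
    refine this.trans (Finset.card_image_le.trans ?_)
    simp
  have hcomps : 0 < comps σ α := by
    rw [comps, Nat.card_pos_iff]
    exact ⟨⟨Quotient.mk _ (0, ⟨0, hn⟩)⟩, inferInstance⟩
  -- some face avoids the hub
  obtain ⟨d, hd⟩ : ∃ d, ∀ i, ¬ (σ * α).SameCycle (3, i) d := by
    by_contra hcon
    push Not at hcon
    have := card_quotient_le (Perm.SameCycle.setoid (σ * α))
      ((Finset.univ : Finset (Fin n)).image fun i => ((3 : Fin 4), i)) (by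
      intro a
      obtain ⟨i, hi⟩ := hcon a
      exact ⟨_, Finset.mem_image.2 ⟨i, Finset.mem_univ _, rfl⟩, hi⟩)
    have hle : cyc (σ * α) ≤ n := this.trans (Finset.card_image_le.trans (by simp))
    rw [defect, Nat.card_prod, Nat.card_fin, Nat.card_fin] at h
    push_cast at h
    omega
  -- After a dart towards the hub, a face continues with a dart at the hub. So a face avoiding the
  -- hub consists of rim darts only.
  have hd' : ∀ d, (∀ i, ¬ (σ * α).SameCycle (3, i) d) → d.1 ≠ 3 ∧ d.1 ≠ 2 ∧
      ∀ i, ¬ (σ * α).SameCycle (3, i) ((σ * α) d) := by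
    rintro ⟨a, i⟩ hd
    have h1 : ∀ j, ¬ (σ * α).SameCycle (3, j) ((σ * α) (a, i)) := fun j hj =>
      hd j (hj.trans (sameCycle_apply _ _).symm)
    refine ⟨?_, ?_, h1⟩
    · rintro rfl
      exact hd i (.refl _ _)
    · rintro rfl
      obtain ⟨j, hj⟩ := hv3 i
      refine h1 j ?_
      rw [Perm.mul_apply, hα2, hj]
  have hall : ∀ P : Fin n → Prop, (∃ i, P i) → (∀ i, P i → P (c i)) → ∀ i, P i := by
    rintro P ⟨i, hi⟩ hP j
    obtain ⟨m, -, rfl⟩ := (hc i j).exists_pow_eq'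
    induction m with
    | zero => exact hi
    | succ m ih => rw [pow_succ', Perm.mul_apply]; exact hP _ ih
  have hall' : ∀ P : Fin n → Prop, (∃ i, P i) → (∀ i, P i → P (c.symm i)) → ∀ i, P i := by
    rintro P ⟨i, hi⟩ hP j
    obtain ⟨m, -, rfl⟩ := (Perm.sameCycle_inv.2 (hc i j)).exists_pow_eq'
    induction m with
    | zero => exact hi
    | succ m ih => rw [pow_succ', Perm.mul_apply]; exact hP _ ih
  obtain ⟨π, hπ⟩ := exists_perm_of_injective (j := fun i : Fin n => ((3 : Fin 4), i))
    (σ := σ) (fun i j h => congrArg Prod.snd h) fun i => by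
      obtain ⟨j, hj⟩ := hv3 i
      exact ⟨j, hj.symm⟩
  have hπc : ∀ i j, π.SameCycle i j := fun i j => by
    rw [sameCycle_of_injective (j := fun i : Fin n => ((3 : Fin 4), i))
      (fun i j h => congrArg Prod.snd h) hπ, hσ]
    simp [wheelVertex]
  let L : List (Fin 4 × Fin n) := (Finset.univ.filter fun a : Fin 4 × Fin n => a.1 ≠ 3).toList
  have hL : ∀ a : Fin 4 × Fin n, a ∈ L ↔ a.1 ≠ 3 := fun a => by simp [L]
  -- Erase the rim from the rotation and from the faces. What remains on the hub darts has genus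
  -- zero, and the rotation `π` and the hyperedge permutation `τ` are both single cycles, so they
  -- are inverse to each other.
  have hfin : ∀ τ : Perm (Fin n), (∀ i j, τ.SameCycle i j) →
      (∀ i, eraseList (σ * α) L (3, i) = (3, π (τ i))) → π * τ = 1 := by
    intro τ hτ he
    refine mul_eq_one_of_defect hπc hτ ?_
    rw [← defect_eraseList_face h L L]
    have h3 : ∀ i, eraseList σ L (3, i) = (3, π i) := fun i => by
      rw [eraseList_of_notMem (by simp [hL]), hπ]
      rw [← hπ]
      simp [hL]
    symm
    have hr : ∀ x : Fin 4 × Fin n, x ∉ Set.range (fun i : Fin n => ((3 : Fin 4), i)) → x ∈ L := by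
      rintro ⟨a, i⟩ hx
      rw [hL]
      rintro rfl
      exact hx ⟨i, rfl⟩
    refine defect_of_injective (j := fun i : Fin n => ((3 : Fin 4), i))
      (fun i j h => congrArg Prod.snd h) (fun i => (h3 i).symm) (fun i => ?_) (fun x hx => ?_)
      (fun x hx => ?_)
    · rw [Perm.mul_apply, he, Perm.eq_inv_iff_eq, h3]
    · exact eraseList_of_mem (hr x hx)
    · rw [Perm.mul_apply, eraseList_of_mem (hr x hx), Perm.inv_eq_iff_eq,
        eraseList_of_mem (hr x hx)]
  have h3L : ∀ i, ((3 : Fin 4), i) ∉ L := by simp [hL]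
  -- In a cycle of three darts, one known successor determines the other two.
  have key : ∀ a b : Fin 4, a ≠ 3 → b ≠ 3 →
      a ≠ 2 → b ≠ 2 → a ≠ b → (∀ i, σ (a, i) = (b, i)) →
      ∀ i, σ (b, i) = (2, i) ∧ σ (2, i) = (a, i) := by
    intro a b ha hb ha2 hb2 hab hs i
    obtain ⟨x, hx3, hxb, hx⟩ := hvi b i hb
    obtain ⟨y, hy3, hy2, hy⟩ := hvi 2 i (by decide)
    have h1 : y ≠ b := by
      rintro rfl
      have := σ.injective (hy.trans (hs i).symm)
      exact ha2 (congrArg Prod.fst this).symm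
    have hya : y = a := by omega
    have hxa : x ≠ a := by
      rintro rfl
      have := σ.injective (hx.trans (hya ▸ hy.symm))
      exact hb2 (congrArg Prod.fst this)
    have hx2 : x = 2 := by omega
    exact ⟨hx2 ▸ hx, hya ▸ hy⟩
  obtain ⟨a, i⟩ := d
  have ha := hd' _ hd
  have ha' : a = 0 ∨ a = 1 :=
    (by decide : ∀ a : Fin 4, a ≠ 3 → a ≠ 2 → a = 0 ∨ a = 1) a ha.1 ha.2.1
  rcases ha' with rfl | rfl
  · left
    -- As `c` is a single cycle, a face containing one forward dart and avoiding the hub goes around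
    -- the whole rim, which fixes the rotation at all vertices of the rim.
    have hall1 := hall (fun i => ∀ j, ¬ (σ * α).SameCycle (3, j) (0, i)) ⟨i, hd⟩
    have step : ∀ i, (∀ j, ¬ (σ * α).SameCycle (3, j) (0, i)) → σ (1, c i) = (0, c i) := by
      intro i hi
      obtain ⟨b, hb3, hb1, hb⟩ := hvi 1 (c i) (by decide)
      have h1 : (σ * α) (0, i) = (b, c i) := by rw [Perm.mul_apply, hα0, hb]
      have h2 := (hd' _ ((hd' _ hi).2.2)).2.1
      rw [h1] at h2
      have : b = 0 := by
        change b ≠ 2 at h2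
        omega
      rw [hb, this]
    have hP := hall1 fun i hi => by
      have := (hd' _ hi).2.2
      rwa [Perm.mul_apply, hα0, step i hi] at this
    have h10 : ∀ i, σ (1, i) = (0, i) := fun i => by simpa using step (c.symm i) (hP _)
    have hk := key 1 0 (by decide) (by decide) (by decide) (by decide) (by decide) h10
    have := hfin c⁻¹ (fun i j => Perm.sameCycle_inv.2 (hc i j)) fun i => by
      refine eraseList_eq_of_skip (.skip (z := (1, i)) ?_ (by simp [hL])
        (.skip (z := (2, c⁻¹ i)) ?_ (by simp [hL]) (.step ?_ (h3L _)))) (h3L _)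
      · rw [Perm.mul_apply, hα3, (hk i).2]
      · rw [Perm.mul_apply, hα1]; exact (hk _).1
      · rw [Perm.mul_apply, hα2, hπ]
    rw [mul_inv_eq_one] at this
    exact fun i => by rw [← hπ, this]
  · right
    have hall1 := hall' (fun i => ∀ j, ¬ (σ * α).SameCycle (3, j) (1, i)) ⟨i, hd⟩
    have step : ∀ i, (∀ j, ¬ (σ * α).SameCycle (3, j) (1, i)) →
        σ (0, c.symm i) = (1, c.symm i) := by
      intro i hi
      obtain ⟨b, hb3, hb1, hb⟩ := hvi 0 (c.symm i) (by decide)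
      have h1 : (σ * α) (1, i) = (b, c.symm i) := by rw [Perm.mul_apply, hα1, hb]
      have h2 := (hd' _ ((hd' _ hi).2.2)).2.1
      rw [h1] at h2
      have : b = 1 := by
        change b ≠ 2 at h2
        omega
      rw [hb, this]
    have hP := hall1 fun i hi => by
      have := (hd' _ hi).2.2
      rwa [Perm.mul_apply, hα1, step i hi] at this
    have h01 : ∀ i, σ (0, i) = (1, i) := fun i => by simpa using step (c i) (hP _)
    have hk := key 0 1 (by decide) (by decide) (by decide) (by decide) (by decide) h01
    have := hfin c hc fun i => by
      refine eraseList_eq_of_skip (.skip (z := (0, i)) ?_ (by simp [hL])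
        (.skip (z := (2, c i)) ?_ (by simp [hL]) (.step ?_ (h3L _)))) (h3L _)
      · rw [Perm.mul_apply, hα3, (hk i).2]
      · rw [Perm.mul_apply, hα0]; exact (hk _).1
      · rw [Perm.mul_apply, hα2, hπ]
    rw [mul_eq_one_iff_eq_inv] at this
    exact fun i => by rw [← hπ, this]; rfl

end Wheel

end Hypermap

/-! ### From a planar capped graph back to the disc -/

namespace Hypermap

theorem exists_list_mem_iff {D : Type*} [Finite D] (P : D → Prop) :
    ∃ L : List D, ∀ x, x ∈ L ↔ P x :=
  ⟨(Set.toFinite {x | P x}).toFinset.toList, by simp⟩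

theorem apply_mem_range_of_fix {D D' : Type*} {j : D' → D} {σ : Perm D}
    (h : ∀ x ∉ Set.range j, σ x = x) (d : D') : σ (j d) ∈ Set.range j := by
  by_contra hd
  exact hd ⟨d, (σ.injective (h _ hd)).symm⟩

end Hypermap

namespace Multigraph

variable {V E : Type}

/-- The orientation of the edges in an embedding can be prescribed. -/
theorem IsPlanar.exists_rot [Finite E] {g : Multigraph V E} (hg : g.IsPlanar) (s : E × Bool → V)
    (hs : ∀ e, g.ends e = s(s (e, false), s (e, true))) :
    ∃ rot : Perm (E × Bool), (∀ d d', rot.SameCycle d d' ↔ s d = s d') ∧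
      defect rot (flip E) = 0 := by
  obtain ⟨ε, hε⟩ := hg
  rw [Embedding.isSpherical_iff] at hε
  have : ∀ e, ∃ b : Bool, ∀ x, ε.src (e, xor b x) = s (e, x) := by
    intro e
    have := hs e
    rw [ε.ends_eq, Sym2.eq_iff] at this
    rcases this with ⟨h1, h2⟩ | ⟨h1, h2⟩
    · exact ⟨false, by rintro (_ | _) <;> simpa⟩
    · exact ⟨true, by rintro (_ | _) <;> simpa⟩
  choose b hb using this
  let θ : Perm (E × Bool) := Function.Involutive.toPerm (fun d => (d.1, xor (b d.1) d.2))
    fun d => by simp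
  have hθ : ∀ d, ε.src (θ d) = s d := fun d => hb d.1 d.2
  refine ⟨θ⁻¹ * ε.rot * θ, fun d d' => ?_, ?_⟩
  · rw [sameCycle_of_injective (σ := ε.rot) θ.injective (fun d => by simp),
      ε.sameCycle_rot_iff, hθ, hθ]
  · rw [← hε]
    refine defect_congr θ (fun d => by simp) fun d => ?_
    obtain ⟨e, x⟩ := d
    change (e, xor (b e) !x) = (e, !xor (b e) x)
    simp

end Multigraph

section Cap

variable {V E : Type} {n : ℕ}

/-- The initial vertices of the darts of the capped graph. -/
def capSrc (s : E × Bool → V) (v : Fin n → V) :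
    ((E ⊕ (Fin n ⊕ Fin n)) ⊕ Fin n) × Bool → (V ⊕ Fin n) ⊕ Unit
  | (.inl (.inl e), b) => .inl (.inl (s (e, b)))
  | (.inl (.inr (.inl i)), false) => .inl (.inl (v i))
  | (.inl (.inr (.inl i)), true) => .inl (.inr i)
  | (.inl (.inr (.inr i)), false) => .inl (.inr i)
  | (.inl (.inr (.inr i)), true) => .inl (.inr (finRotate n i))
  | (.inr i, false) => .inl (.inr i)
  | (.inr _, true) => .inr ()

variable [Finite E] {s : E × Bool → V} {v : Fin n → V}
  {rot : Perm (((E ⊕ (Fin n ⊕ Fin n)) ⊕ Fin n) × Bool)}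

/-- In the capped graph, the rotation at the hub is that of the enveloping cycle or its inverse. -/
theorem capRot_hub (hr : ∀ d d', rot.SameCycle d d' ↔ capSrc s v d = capSrc s v d')
    (h : defect rot (Multigraph.flip _) = 0) :
    (∀ i, rot (.inr i, true) = (.inr (finRotate n i), true)) ∨
      ∀ i, rot (.inr i, true) = (.inr ((finRotate n).symm i), true) := by
  rcases Nat.eq_zero_or_pos n with rfl | hn
  · exact Or.inl fun i => i.elim0
  classical
  obtain ⟨c, hc⟩ : ∃ c, c = finRotate n := ⟨_, rfl⟩
  rw [← hc]
  -- The backward dart at the rim vertex `i` belongs to the rim edge that ends there, namely the one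
  -- with index `c.symm i`.
  let j : Fin 4 × Fin n → ((E ⊕ (Fin n ⊕ Fin n)) ⊕ Fin n) × Bool := fun p => match p with
    | (0, i) => (.inl (.inr (.inr i)), false)
    | (1, i) => (.inl (.inr (.inr (c.symm i))), true)
    | (2, i) => (.inr i, false)
    | (3, i) => (.inr i, true)
  have hj : Function.Injective j := by
    rintro ⟨a, i⟩ ⟨b, i'⟩ h
    clear hr
    fin_cases a <;> fin_cases b <;> simp [j] at h ⊢ <;> exact h
  -- Genus zero survives when all darts outside the wheel are erased, so only the wheel itself has
  -- to be considered.
  obtain ⟨L, hL⟩ := exists_list_mem_iff fun x => x ∉ Set.range j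
  have hjL : ∀ p, j p ∉ L := fun p hp => (hL _).1 hp ⟨p, rfl⟩
  have h0 := defect_eraseList h L L
  have hfix : ∀ τ : Perm (((E ⊕ (Fin n ⊕ Fin n)) ⊕ Fin n) × Bool), ∀ x ∉ Set.range j,
    eraseList τ L x = x := fun τ x hx => eraseList_of_mem ((hL x).2 hx)
  obtain ⟨σ, hσ⟩ := exists_perm_of_injective hj (apply_mem_range_of_fix (hfix rot))
  obtain ⟨α, hα⟩ := exists_perm_of_injective hj
    (apply_mem_range_of_fix (hfix (Multigraph.flip _)))
  rw [defect_of_injective hj hσ hα (hfix _) (hfix _)] at h0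
  have hα' : ∀ p q, Multigraph.flip _ (j p) = j q → α p = q := fun p q hpq => by
    apply hj
    rw [hα, eraseList_of_notMem (hjL p) (hpq ▸ hjL q), hpq]
  have key := wheel_rot hn (c := c) (σ := σ) (α := α) (hc ▸ sameCycle_finRotate)
    (fun i => hα' _ _ (by simp [j, Multigraph.flip_apply]))
    (fun i => hα' _ _ (by simp [j, Multigraph.flip_apply]))
    (fun i => hα' _ _ (by simp [j, Multigraph.flip_apply]))
    (fun i => hα' _ _ (by simp [j, Multigraph.flip_apply])) (fun a b => by
      rw [sameCycle_of_injective hj hσ, sameCycle_eraseList, hr]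
      have : capSrc s v (j a) = capSrc s v (j b) ↔ wheelVertex a = wheelVertex b := by
        obtain ⟨a, i⟩ := a
        obtain ⟨b, i'⟩ := b
        fin_cases a <;> fin_cases b <;> simp [j, capSrc, wheelVertex, ← hc]
      rw [this]
      exact ⟨fun h => h.elim (fun h => by rw [hj h]) fun h => h.2.2,
        fun h => Or.inr ⟨hjL a, hjL b, h⟩⟩) h0
  have hhub : ∀ i, ∃ i', rot (.inr i, true) = (.inr i', true) := by
    intro i
    have h1 := (hr _ _).1 (sameCycle_apply rot (.inr i, true))
    rcases hd : rot (.inr i, true) with ⟨(e | i' | i') | i', _ | _⟩ <;> rw [hd] at h1 <;>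
      simp [capSrc] at h1
    exact ⟨i', rfl⟩
  have hrot : ∀ i i', σ (3, i) = (3, i') → rot (.inr i, true) = (.inr i', true) := by
    intro i i' hi
    have h1 := hσ (3, i)
    obtain ⟨i'', hi''⟩ := hhub i
    rw [eraseList_of_notMem (hjL (3, i)) (by
      change rot (.inr i, true) ∉ L; rw [hi'']; exact hjL (3, i'')), hi] at h1
    exact h1.symm
  exact key.imp (fun h i => hrot _ _ (h i)) fun h i => hrot _ _ (h i)

/-- Without the rim edges, each rim vertex just connects a label edge to a spoke. When the remaining
wheel darts are erased from the rotation and from the faces, a face leads from label `i` through the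
hub to the next label, so the cycle at the hub turns into the boundary cycle. -/
theorem isPlane_of_capRot {g : Multigraph V E} (hs : ∀ e, g.ends e = s(s (e, false), s (e, true)))
    (hr : ∀ d d', rot.SameCycle d d' ↔ capSrc s v d = capSrc s v d')
    (h : defect rot (Multigraph.flip _) = 0)
    (hub : ∀ i, rot (.inr i, true) = (.inr (finRotate n i), true)) :
    g.IsPlane (List.ofFn v) := by
  classical
  set c := finRotate n with hc
  let t : Fin n → ((E ⊕ (Fin n ⊕ Fin n)) ⊕ Fin n) × Bool := fun i => (.inl (.inr (.inl i)), false)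
  have ht : Function.Injective t := fun i i' h => by simpa [t] using h
  let dart : E × Bool → ((E ⊕ (Fin n ⊕ Fin n)) ⊕ Fin n) × Bool := fun p => (.inl (.inl p.1), p.2)
  obtain ⟨L, hL⟩ := exists_list_mem_iff fun x : ((E ⊕ (Fin n ⊕ Fin n)) ⊕ Fin n) × Bool => ∃ i b, x = (.inl (.inr (.inr i)), b)
  obtain ⟨J, hJ⟩ := exists_list_mem_iff fun x : ((E ⊕ (Fin n ⊕ Fin n)) ⊕ Fin n) × Bool => x ∉ Set.range dart ∧ x ∉ Set.range t
  have hdJ : ∀ p, dart p ∉ J := fun p hp => ((hJ _).1 hp).1 ⟨p, rfl⟩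
  have htJ : ∀ i, t i ∉ J := fun i hi => ((hJ _).1 hi).2 ⟨i, rfl⟩
  have hJsrc : ∀ x, x ∉ J ↔ ∃ a, capSrc s v x = .inl (.inl a) := by
    intro x
    rw [hJ, not_and_or, not_not, not_not]
    constructor
    · rintro (⟨p, rfl⟩ | ⟨i, rfl⟩)
      exacts [⟨_, rfl⟩, ⟨_, rfl⟩]
    · rintro ⟨a, ha⟩
      obtain ⟨(e | i | i) | i, _ | _⟩ := x <;> simp [capSrc] at ha
      exacts [Or.inl ⟨(e, _), rfl⟩, Or.inl ⟨(e, _), rfl⟩, Or.inr ⟨i, rfl⟩]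
  have hLJ : ∀ x, x ∈ L → x ∈ J := by
    intro x hx
    obtain ⟨i, b, rfl⟩ := (hL x).1 hx
    rw [hJ]
    constructor
    · rintro ⟨p, hp⟩; simp [dart] at hp
    · rintro ⟨p, hp⟩; simp [t] at hp
  set σ := eraseList rot L with hσ
  set α := eraseList (Multigraph.flip (((E ⊕ (Fin n ⊕ Fin n)) ⊕ Fin n))) L with hα
  have hsc : ∀ x y, σ.SameCycle x y ↔ x = y ∨ (x ∉ L ∧ y ∉ L ∧ capSrc s v x = capSrc s v y) :=
    fun x y => by rw [hσ, sameCycle_eraseList, hr]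
  have h0 : defect σ α = 0 := defect_eraseList h L L
  have hαL : ∀ e b, (∀ i, e ≠ .inl (.inr (.inr i))) → α (e, b) = (e, !b) := by
    intro e b he
    rw [hα, eraseList_of_notMem, Multigraph.flip_apply]
    · rw [hL]; rintro ⟨i, b, h⟩; exact he i (congrArg Prod.fst h)
    · rw [Multigraph.flip_apply, hL]; rintro ⟨i, b, h⟩; exact he i (congrArg Prod.fst h)
  have hsrc : ∀ x, x ∉ L → capSrc s v (σ x) = capSrc s v x := by
    intro x hx
    rcases (hsc _ _).1 (sameCycle_apply σ x) with h | h
    · rw [← h]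
    · exact h.2.2.symm
  have hσL : ∀ x, x ∉ L → σ x ∉ L := by
    intro x hx
    rcases (hsc _ _).1 (sameCycle_apply σ x) with h | h
    · rwa [← h]
    · exact h.2.1
  -- Only two darts are left at a vertex of the rim, and they are exchanged; `b` selects the one
  -- being mapped.
  have hpair : ∀ i b, σ ((if b then .inl (.inr (.inl i)) else .inr i), b) =
      ((if b then .inr i else .inl (.inr (.inl i))), !b) := by
    intro i b
    have hx : ((if b then .inl (.inr (.inl i)) else .inr i), b) ∉ L := by
      rw [hL]; cases b <;> simp
    have hy : ((if b then .inr i else .inl (.inr (.inl i))), !b) ∉ L := by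
      rw [hL]; cases b <;> simp
    have h1 := hsrc _ hx
    have h2 := hσL _ hx
    have h3 : σ.SameCycle ((if b then .inl (.inr (.inl i)) else .inr i), b)
      ((if b then .inr i else .inl (.inr (.inl i))), !b) :=
      (hsc _ _).2 (Or.inr ⟨hx, hy, by cases b <;> rfl⟩)
    by_cases hfix : σ ((if b then .inl (.inr (.inl i)) else .inr i), b) =
        ((if b then .inl (.inr (.inl i)) else .inr i), b)
    · rw [hfix]
      exact h3.eq_of_left hfix
    rcases hd : σ ((if b then .inl (.inr (.inl i)) else .inr i), b) with
      ⟨(e | i' | i') | i', _ | _⟩ <;> rw [hd] at h1 h2 hfix <;> cases b <;>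
      simp [capSrc, hL] at h1 h2 hfix ⊢ <;> tauto
  have hφ1 : ∀ i, (σ * α) (t i) = (.inr i, false) := fun i => by
    rw [Perm.mul_apply, hαL _ _ (by simp)]
    exact hpair i true
  have hφ2 : ∀ i, (σ * α) (.inr i, false) = (.inr (c i), true) := fun i => by
    rw [Perm.mul_apply, hαL _ _ (by simp), Bool.not_false, hσ, eraseList_of_notMem, hub] <;>
      simp [hL, hub]
  have hφ3 : ∀ i, (σ * α) (.inr i, true) = (.inl (.inr (.inl i)), true) := fun i => by
    rw [Perm.mul_apply, hαL _ _ (by simp)]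
    exact hpair i false
  have hφ4 : ∀ i, (σ * α) (.inl (.inr (.inl i)), true) = σ (t i) := fun i => by
    rw [Perm.mul_apply, hαL _ _ (by simp)]
    rfl
  have hσJ : ∀ x, x ∉ J → σ x ∉ J := by
    intro x hx
    rw [hJsrc] at hx ⊢
    rwa [hsrc x fun h => (hJsrc x).2 hx (hLJ x h)]
  let ρ := eraseList σ J
  -- The points are erased from the faces, so the new hyperedges have to be recovered from vertices
  -- and faces.
  let o := ρ⁻¹ * eraseList (σ * α) J
  have ho : defect ρ o = 0 := defect_eraseList_face h0 J J
  have hρ : ∀ x, x ∉ J → ρ x = σ x := fun x hx => eraseList_of_notMem hx (hσJ x hx)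
  have hod : ∀ e b, o (dart (e, b)) = dart (e, !b) := by
    intro e b
    have h1 : (σ * α) (dart (e, b)) = σ (dart (e, !b)) := by
      rw [Perm.mul_apply, hαL _ _ (by simp)]
    rw [Perm.mul_apply, Perm.inv_eq_iff_eq, hρ _ (hdJ _), eraseList_of_notMem (hdJ _), h1]
    rw [h1]
    exact hσJ _ (hdJ _)
  have hot : ∀ i, o (t i) = t (c i) := by
    intro i
    rw [Perm.mul_apply, Perm.inv_eq_iff_eq, hρ _ (htJ _)]
    refine eraseList_eq_of_skip (.skip (hφ1 i) ?_ (.skip (hφ2 i) ?_ (.skip (hφ3 _) ?_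
      (.step (hφ4 _) (hσJ _ (htJ _)))))) (htJ i) <;> simp [hJ, dart, t]
  have hoJ : ∀ x, x ∈ J → o x = x := by
    intro x hx
    rw [Perm.mul_apply, Perm.inv_eq_iff_eq, eraseList_of_mem hx]
    exact (eraseList_of_mem hx).symm
  have hW : ∀ x, x ∈ List.ofFn t ↔ x ∈ Set.range t := fun x => by simp [List.mem_ofFn]
  let vert : ((E ⊕ (Fin n ⊕ Fin n)) ⊕ Fin n) × Bool → V := fun x => match x with
    | (.inl (.inl e), b) => s (e, b)
    | (.inl (.inr (.inl i)), _) => v i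
    | (.inl (.inr (.inr i)), _) => v i
    | (.inr i, _) => v i
  have hvert : ∀ x, x ∉ J → capSrc s v x = .inl (.inl (vert x)) := by
    intro x hx
    rw [hJ, not_and_or, not_not, not_not] at hx
    rcases hx with ⟨p, rfl⟩ | ⟨i, rfl⟩ <;> rfl
  have hused : ∀ x, x ∈ Set.range dart ∨ x ∈ List.ofFn t → x ∉ J := by
    rintro x (⟨p, rfl⟩ | h)
    · exact hdJ p
    · obtain ⟨i, rfl⟩ := (hW x).1 h
      exact htJ i
  refine ⟨{
    D := ((E ⊕ (Fin n ⊕ Fin n)) ⊕ Fin n) × Bool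
    dart := dart
    dart_inj := fun p q h => by
      simp only [dart, Prod.mk.injEq, Sum.inl.injEq] at h
      exact Prod.ext h.1 h.2
    W := List.ofFn t
    nodup := List.nodup_ofFn.2 ht
    dart_notMem := fun p hp => by
      obtain ⟨i, hi⟩ := (hW _).1 hp
      simp [dart, t] at hi
    vert := vert
    ends_eq := hs
    word := by rw [List.map_ofFn]; rfl
    rot := ρ
    opp := o
    rot_fix := fun x h1 h2 => eraseList_of_mem ((hJ x).2 ⟨h1, by rwa [← hW]⟩)
    sameCycle := fun x y hx hy => ?_
    opp_dart := hod
    opp_of_notMem := fun x hx => ?_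
    planar := ho }⟩
  · have hx := hused x hx
    have hy := hused y hy
    rw [sameCycle_eraseList, hsc, hvert x hx, hvert y hy, Sum.inl.injEq, Sum.inl.injEq]
    constructor
    · rintro (rfl | ⟨-, -, rfl | h⟩)
      exacts [rfl, rfl, h.2.2]
    · exact fun h => Or.inr ⟨hx, hy, Or.inr ⟨fun k => hx (hLJ _ k), fun k => hy (hLJ _ k), h⟩⟩
  · by_cases hx' : x ∈ Set.range t
    · obtain ⟨i, rfl⟩ := hx'
      rw [hot]
      have := formPerm_getElem_finRotate (List.nodup_ofFn.2 ht) (List.length_ofFn (f := t)) i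
      simpa only [List.getElem_ofFn] using this.symm
    · rw [hoJ x ((hJ x).2 ⟨hx, hx'⟩), List.formPerm_apply_of_notMem]
      rwa [hW]

end Cap

namespace BilabelledGraph

variable {k l : ℕ} (K : BilabelledGraph k l)

theorem isPlane_of_isPlanar (h : K.IsPlanar) : K.graph.IsPlane (List.ofFn K.boundary) := by
  have := K.finiteE
  let s : K.E × Bool → K.V := fun p =>
    if p.2 then (Quot.out (K.graph.ends p.1)).2 else (Quot.out (K.graph.ends p.1)).1
  have hs : ∀ e, K.graph.ends e = s(s (e, false), s (e, true)) := fun e =>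
    (Quot.out_eq (K.graph.ends e)).symm
  obtain ⟨rot, hr, hd⟩ := Multigraph.IsPlanar.exists_rot h (capSrc s K.boundary) (by
    rintro ((e | i | i) | i)
    · simp [capped, enveloped, hs e, capSrc]
    · simp [capped, enveloped, capSrc]
    · simp [capped, enveloped, capSrc]
    · simp [capped, capSrc])
  rcases capRot_hub hr hd with hub | hub
  · exact isPlane_of_capRot hs hr hd hub
  -- If the hub turns backwards, take the mirror image; `flip` is its own inverse.
  · refine isPlane_of_capRot (rot := rot⁻¹) hs (fun d d' => by rw [Perm.sameCycle_inv, hr]) ?_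
      fun i => ?_
    · rw [← defect_inv, inv_inv]
      rw [← hd]
      rfl
    · rw [Perm.inv_eq_iff_eq, hub, Equiv.symm_apply_apply]

theorem isPlanar_iff : K.IsPlanar ↔ K.graph.IsPlane (List.ofFn K.boundary) :=
  ⟨K.isPlane_of_isPlanar, K.isPlanar_of_isPlane⟩

end BilabelledGraph

/-! ### Successive identification of pairs -/

namespace Hypermap

variable {α : Type*}

/-- Merge the classes of all pairs in a list. -/
def mergeList (l : List (α × α)) : Setoid α := l.foldr (fun p r => merge r p.1 p.2) ⊥

/-- A composition or contraction identifies all pairs at once, whereas drawings are glued one pair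
at a time; this translates between the two. The order within a pair is immaterial. -/
theorem eqvGen_eq_mergeList {R : α → α → Prop} (l : List (α × α))
    (h : ∀ a b, R a b → (a, b) ∈ l ∨ (b, a) ∈ l) (h' : ∀ p ∈ l, R p.1 p.2 ∨ R p.2 p.1) :
    Relation.EqvGen.setoid R = mergeList l := by
  apply le_antisymm
  · intro a b hab
    induction hab with
    | refl a => exact Setoid.refl' _ a
    | symm a b _ ih => exact Setoid.symm' _ ih
    | trans a b c _ _ ih ih' => exact Setoid.trans' _ ih ih'
    | rel a b hab =>
      have key : ∀ a b : α, (a, b) ∈ l → mergeList l a b := by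
        clear h h' hab
        intro a b hl
        induction l with
        | nil => cases hl
        | cons p l ih =>
          rcases List.mem_cons.1 hl with rfl | hl
          · exact merge_rel _ _ _
          · exact le_merge _ _ _ (ih hl)
      exact (h a b hab).elim (key a b) fun k => Setoid.symm' _ (key b a k)
  · clear h
    induction l with
    | nil => exact bot_le
    | cons p l ih =>
      refine merge_le (ih fun q hq => h' q (List.mem_cons_of_mem _ hq)) ?_
      rcases h' p List.mem_cons_self with h | h
      · exact .rel _ _ h
      · exact .symm _ _ (.rel _ _ h)

/-- Permits a gluing to be carried out in a quotient by the identifications made before. -/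
theorem merge_quotient {r : Setoid α} {x y a b : α} :
    merge ⊥ (Quotient.mk r x) (Quotient.mk r y) (Quotient.mk r a) (Quotient.mk r b) ↔
      merge r x y a b := by
  change (Quotient.mk r a = Quotient.mk r b ∨ (Quotient.mk r a = Quotient.mk r x ∧
    Quotient.mk r y = Quotient.mk r b) ∨ (Quotient.mk r a = Quotient.mk r y ∧
    Quotient.mk r x = Quotient.mk r b)) ↔ _
  rw [Quotient.eq, Quotient.eq, Quotient.eq, Quotient.eq, Quotient.eq]
  rfl

end Hypermap

/-! ### Tame graphs: plane, even, and properly two-coloured -/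

namespace Multigraph

variable {V E V' E' V'' : Type} {g : Multigraph V E} {g' : Multigraph V' E'} {w : List V}
  {c c' : List Bool}

theorem map_map (g : Multigraph V E) (f : V → V') (f' : V' → V'') :
    (g.map f).map f' = g.map (f' ∘ f) := by
  unfold map
  simp only [Sym2.map_map]

/-- A plane graph with coloured labels: it is properly two-coloured, the labels have the prescribed
colours, and all degrees are even, the labels at a vertex being counted. -/
structure IsTame (g : Multigraph V E) (w : List V) (c : List Bool) : Prop where
  plane : g.IsPlane w
  exists_src : ∃ s : E × Bool → V, (∀ e, g.ends e = s(s (e, false), s (e, true))) ∧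
    (∀ P : V → Bool, Even (Nat.card {d // P (s d)} + w.countP P)) ∧
    ∃ part : V → Bool, (∀ e, part (s (e, true)) = !part (s (e, false))) ∧ w.map part = c

theorem IsTame.rotate (h : g.IsTame w c) (n : ℕ) : g.IsTame (w.rotate n) (c.rotate n) := by
  obtain ⟨hp, s, hs, he, part, h1, h2⟩ := h
  refine ⟨hp.rotate n, s, hs, fun P => ?_, part, h1, by rw [List.map_rotate, h2]⟩
  rw [(List.rotate_perm w n).countP_eq]
  exact he P

theorem IsTame.length_eq (h : g.IsTame w c) : w.length = c.length := by
  obtain ⟨-, s, hs, he, part, h1, h2⟩ := h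
  rw [← h2, List.length_map]

theorem IsTame.append_comm {w w' : List V} (hc : c.length = w.length)
    (h : g.IsTame (w ++ w') (c ++ c')) : g.IsTame (w' ++ w) (c' ++ c) := by
  have := h.rotate w.length
  rwa [List.rotate_append_length_eq, ← hc, List.rotate_append_length_eq] at this

theorem IsTame.reverse (h : g.IsTame w c) : g.IsTame w.reverse c.reverse := by
  obtain ⟨hp, s, hs, he, part, h1, h2⟩ := h
  refine ⟨hp.reverse, s, hs, fun P => ?_, part, h1, by rw [List.map_reverse, h2]⟩
  rw [List.countP_reverse]
  exact he P

theorem IsTame.of_injective (h : g.IsTame w c) {φ : V → V'} (hφ : Function.Injective φ)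
    (ψ : E' ≃ E) (hg : ∀ e, g'.ends e = (g.ends (ψ e)).map φ) : g'.IsTame (w.map φ) c := by
  obtain ⟨hp, s, hs, he, part, h1, h2⟩ := h
  refine ⟨hp.of_injective hφ ψ hg, fun p => φ (s (ψ p.1, p.2)), fun e => by rw [hg, hs]; rfl,
    fun P => ?_, Function.extend φ part fun _ => false, fun e => ?_, ?_⟩
  · rw [List.countP_map]
    convert he (P ∘ φ) using 2
    exact Nat.card_congr ((ψ.prodCongr (Equiv.refl Bool)).subtypeEquiv fun d => Iff.rfl)
  · rw [hφ.extend_apply, hφ.extend_apply, h1]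
  · rw [List.map_map, Function.extend_comp hφ, h2]

theorem IsTame.sum [Finite E] [Finite E'] (h : g.IsTame w c) {w' : List V'}
    (h' : g'.IsTame w' c') :
    (g.sum g').IsTame (w.map Sum.inl ++ w'.map Sum.inr) (c ++ c') := by
  obtain ⟨hp, s, hs, he, part, h1, h2⟩ := h
  obtain ⟨hp', s', hs', he', part', h1', h2'⟩ := h'
  refine ⟨hp.sum hp', fun p => p.1.elim (fun e => .inl (s (e, p.2))) fun e => .inr (s' (e, p.2)),
    ?_, fun P => ?_, Sum.elim part part', ?_, ?_⟩
  · rintro (e | e)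
    · simp [Multigraph.sum, hs]
    · simp [Multigraph.sum, hs']
  · have e : {d : (E ⊕ E') × Bool // P (d.1.elim (fun e => .inl (s (e, d.2)))
        fun e => .inr (s' (e, d.2)))} ≃
        {d // P (.inl (s d))} ⊕ {d // P (.inr (s' d))} :=
      ((Equiv.sumProdDistrib E E' Bool).subtypeEquiv
        (q := fun x => P (x.elim (fun d => .inl (s d)) fun d => .inr (s' d)))
        (by rintro ⟨e | e, b⟩ <;> rfl)).trans Equiv.subtypeSum
    rw [Nat.card_congr e, Nat.card_sum, List.countP_append, List.countP_map, List.countP_map]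
    have := (he (P ∘ Sum.inl)).add (he' (P ∘ Sum.inr))
    rw [add_add_add_comm] at this
    exact this
  · rintro (e | e)
    exacts [h1 e, h1' e]
  · rw [List.map_append, List.map_map, List.map_map, ← h2, ← h2']
    rfl

/-- Identifying vertices of equal colour does not spoil the colouring, and the number of labels in a
set of vertices drops by zero or two. Parity is required for all sets `P` of vertices because this
form pulls back along `f`. -/
theorem IsTame.cap {x y : V} {a : Bool} (h : g.IsTame (x :: y :: w) (a :: a :: c)) {f : V → V'}
    (hf : ∀ a b, f a = f b ↔ merge ⊥ x y a b) : (g.map f).IsTame (w.map f) c := by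
  obtain ⟨hp, s, hs, he, part, h1, h2⟩ := h
  simp only [List.map_cons, List.cons.injEq] at h2
  have hpart : part.FactorsThrough f := by
    intro u v huv
    rw [hf] at huv
    rcases huv with h | ⟨h, h'⟩ | ⟨h, h'⟩
    · exact congrArg part h
    · rw [show u = x from h, ← show y = v from h', h2.1, h2.2.1]
    · rw [show u = y from h, ← show x = v from h', h2.1, h2.2.1]
  refine ⟨hp.cap hf, f ∘ s, fun e => by rw [map_ends, hs]; rfl, fun P => ?_,
    Function.extend f part fun _ => false, fun e => ?_, ?_⟩
  · have := he (P ∘ f)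
    have hxy : f x = f y := (hf x y).2 (merge_rel _ _ _)
    rw [List.countP_cons, List.countP_cons, Function.comp, Function.comp, hxy] at this
    rw [List.countP_map]
    simp only [Function.comp] at this ⊢
    split_ifs at this
    · rw [← add_assoc, ← add_assoc, add_assoc _ 1 1] at this
      exact (Nat.even_add.1 this).2 even_two
    · exact this
  · rw [Function.comp, Function.comp, hpart.extend_apply, hpart.extend_apply, h1]
  · rw [List.map_map, ← h2.2.2]
    exact List.map_congr_left fun v _ => hpart.extend_apply _ _

/-- Join two facing sequences of labels in the outer face. -/
theorem IsTame.cap_list {u u' v v' : List V} {a b d : List Bool} (hud : u.length = d.length)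
    (hv : v.length = b.length) (hv' : v'.length = b.length)
    (h : g.IsTame (u ++ v ++ v'.reverse ++ u') (d ++ b ++ b.reverse ++ a)) {f : V → V'}
    (hf : ∀ x y, f x = f y ↔ mergeList (v.zip v') x y) :
    (g.map f).IsTame ((u ++ u').map f) (d ++ a) := by
  induction v generalizing v' u u' a b d V' with
  | nil =>
    obtain rfl : b = [] := List.length_eq_zero_iff.1 hv.symm
    obtain rfl : v' = [] := List.length_eq_zero_iff.1 hv'
    have hf' : Function.Injective f := fun x y h => (hf x y).1 h
    simpa using h.of_injective (g' := g.map f) hf' (Equiv.refl E) fun e => rfl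
  | cons x v ih =>
    obtain _ | ⟨i, b⟩ := b
    · cases hv
    obtain _ | ⟨y, v'⟩ := v'
    · cases hv'
    -- The inner pairs are joined first. After that `x` and `y` are neighbours, and a rotation
    -- brings them to the front of the word.
    have h1 := ih (u := u ++ [x]) (u' := y :: u') (v' := v') (b := b) (d := d ++ [i])
      (a := i :: a) (f := Quotient.mk (mergeList (v.zip v'))) (by simp [hud])
      (by simpa using hv) (by simpa using hv') (by simpa using h)
      fun _ _ => Quotient.eq
    have h2 : (g.map (Quotient.mk (mergeList (v.zip v')))).IsTame
        ([⟦x⟧, ⟦y⟧] ++ u'.map (Quotient.mk _) ++ u.map (Quotient.mk _)) ([i, i] ++ a ++ d) := by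
      refine IsTame.append_comm (by simp [hud]) ?_
      simpa using h1
    have hf' : ∀ p q, mergeList (v.zip v') p q → f p = f q := fun p q hpq =>
      (hf p q).2 (le_merge _ _ _ hpq)
    have h2' : (g.map (Quotient.mk (mergeList (v.zip v')))).IsTame
        (⟦x⟧ :: ⟦y⟧ :: (u'.map (Quotient.mk _) ++ u.map (Quotient.mk _)))
        (i :: i :: (a ++ d)) := h2
    have h3 := h2'.cap (f := Quotient.lift f hf') (by
      intro p q
      induction p using Quotient.inductionOn with | _ p
      induction q using Quotient.inductionOn with | _ q
      rw [merge_quotient]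
      exact hf p q)
    rw [map_map] at h3
    have hcomp : Quotient.lift f hf' ∘ Quotient.mk _ = f := rfl
    rw [List.map_append, List.map_map, List.map_map, hcomp] at h3
    rw [List.map_append]
    refine h3.append_comm ?_
    have := h.length_eq
    simp only [List.length_append, List.length_reverse] at this
    rw [List.length_map]
    omega

/-- All labels sit at one vertex, whose rotation is chosen inverse to the boundary cycle; then all
faces are trivial. -/
theorem IsPlane.of_edgeless [IsEmpty E] (h : ∀ x ∈ w, ∀ y ∈ w, x = y) : g.IsPlane w := by
  let W := List.finRange w.length
  exact ⟨{
    D := Fin w.length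
    dart := isEmptyElim
    dart_inj := fun p => isEmptyElim p
    W := W
    nodup := List.nodup_finRange _
    dart_notMem := fun p => isEmptyElim p
    vert := fun i => w[i]
    ends_eq := fun e => isEmptyElim e
    word := by
      refine List.ext_getElem (by simp [W]) fun i h1 h2 => ?_
      simp [W]
    rot := W.formPerm⁻¹
    opp := W.formPerm
    rot_fix := fun x _ h => absurd (List.mem_finRange x) h
    sameCycle := fun x y _ _ => by
      rw [Perm.sameCycle_inv]
      exact iff_of_true (sameCycle_formPerm (List.nodup_finRange _) (List.mem_finRange x)
        (List.mem_finRange y)) (h _ (List.getElem_mem _) _ (List.getElem_mem _))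
    opp_dart := fun e => isEmptyElim e
    opp_of_notMem := fun x _ => rfl
    planar := by
      have := defect_inv_mul W.formPerm 1
      rwa [mul_one, defect_one] at this }⟩

theorem IsTame.of_edgeless [IsEmpty E] (h : ∀ x ∈ w, ∀ y ∈ w, x = y) (hw : Even w.length)
    (b : Bool) : g.IsTame w (List.replicate w.length b) := by
  refine ⟨.of_edgeless h, isEmptyElim, fun e => isEmptyElim e, fun P => ?_, fun _ => b,
    fun e => isEmptyElim e, List.map_const⟩
  rw [Nat.card_of_isEmpty, zero_add]
  rcases w with _ | ⟨x, w⟩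
  · simp
  · cases hx : P x
    · have : List.countP P (x :: w) = 0 := by
        rw [List.countP_eq_zero]
        intro y hy
        rw [h y hy x List.mem_cons_self, hx]
        simp
      rw [this]
      exact Even.zero
    · rw [List.countP_eq_length.2 fun y hy => by rw [h y hy x List.mem_cons_self, hx]]
      exact hw

/-- Each vertex has one dart and one label. The two transpositions in `opp` are multiplied one at a
time: the first connects two components, the second splits a face. -/
theorem isPlane_edge : BilabelledGraph.edge.graph.IsPlane [false, true] := by
  let rot : Perm (Bool × Bool) := (Equiv.refl Bool).prodCongr Equiv.boolNot
  have hrot : ∀ x y, rot.SameCycle x y ↔ x.1 = y.1 := fun x y => sameCycle_flip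
  let opp : Perm (Bool × Bool) := swap (false, false) (true, false) * swap (false, true) (true, true)
  have h1 : defect rot (1 * swap (false, false) (true, false)) = 0 := by
    rw [defect_mul_swap, defect_one]
    · simp
    · right
      intro h
      exact Bool.false_ne_true (conn_le (s := Setoid.comap Prod.fst ⊥) (fun d => rfl)
        (fun d => rfl) h)
  rw [one_mul] at h1
  have h2 : defect rot opp = 0 := by
    rw [defect_mul_swap, h1]
    · intro h
      have : (false, true) = (true, true) := h.eq_of_left (by decide)
      simp at this
    · left
      have e1 := sameCycle_apply (rot * swap (false, false) (true, false)) (false, true)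
      have e2 := sameCycle_apply (rot * swap (false, false) (true, false)) (false, false)
      exact e1.trans e2
  exact ⟨{
    D := Bool × Bool
    dart := fun p => (p.2, false)
    dart_inj := fun p q h => Prod.ext (Subsingleton.elim (α := Unit) _ _) (congrArg Prod.fst h)
    W := [(false, true), (true, true)]
    nodup := by decide
    dart_notMem := fun p => by simp
    vert := Prod.fst
    ends_eq := fun e => rfl
    word := rfl
    rot := rot
    opp := opp
    rot_fix := by
      rintro ⟨a, b⟩ h1 h2
      cases b
      · exact absurd ⟨((), a), rfl⟩ h1
      · cases a <;> simp at h2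
    sameCycle := fun x y _ _ => hrot x y
    opp_dart := by rintro e (_ | _) <;> rfl
    opp_of_notMem := by
      rintro ⟨a, b⟩ h
      cases b
      · exact absurd ⟨((), a), rfl⟩ h
      · cases a <;> rfl
    planar := h2 }⟩

theorem isTame_edge : BilabelledGraph.edge.graph.IsTame [false, true] [false, true] := by
  refine ⟨isPlane_edge, Prod.snd, fun e => rfl, fun (P : Bool → Bool) => ?_, id, fun e => rfl, rfl⟩
  have e : {d : Unit × Bool // P d.2} ≃ {b : Bool // P b} :=
    (Equiv.punitProd Bool).subtypeEquiv fun d => Iff.rfl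
  change Even (Nat.card {d : Unit × Bool // P d.2} + _)
  rw [Nat.card_congr e, Nat.card_eq_fintype_card]
  exact (by decide : ∀ P : Bool → Bool,
    Even (Fintype.card {b : Bool // P b} + List.countP P [false, true])) P

end Multigraph

/-! ### Tame bilabelled graphs under tensor product, composition and contraction -/

namespace BilabelledGraph

variable {k l m k' l' : ℕ}

theorem ofFn_boundary (K : BilabelledGraph k l) :
    List.ofFn K.boundary = (List.ofFn K.a).reverse ++ List.ofFn K.b := by
  rw [boundary, List.ofFn_fin_append]
  congr 1
  refine List.ext_getElem (by simp) fun i h1 h2 => ?_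
  simp only [List.getElem_ofFn, List.getElem_reverse, List.length_ofFn]
  congr 1
  ext
  simp
  omega

/-- Planar, even, and properly two-coloured with the given colours of the inputs and outputs. -/
structure IsTame (K : BilabelledGraph k l) (c d : List Bool) : Prop where
  tame : K.graph.IsTame ((List.ofFn K.a).reverse ++ List.ofFn K.b) (c.reverse ++ d)
  length_left : c.length = k
  length_right : d.length = l

variable {K : BilabelledGraph k l} {c d c' d' : List Bool}

theorem IsTame.invol (h : K.IsTame c d) : K.invol.IsTame d c := by
  refine ⟨?_, h.length_right, h.length_left⟩
  have := h.tame.reverse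
  rwa [List.reverse_append, List.reverse_append, List.reverse_reverse, List.reverse_reverse] at this

theorem IsTame.iso {H : BilabelledGraph k l} (hi : Iso K H) (h : K.IsTame c d) :
    H.IsTame c d := by
  obtain ⟨φ, ψ, hg, ha, hb⟩ := hi
  refine ⟨?_, h.length_left, h.length_right⟩
  have := h.tame.of_injective (g' := H.graph) φ.injective ψ.symm fun e => by
    rw [← hg, ψ.apply_symm_apply]
  rw [List.map_append, List.map_reverse, List.map_ofFn, List.map_ofFn] at this
  rwa [show φ ∘ K.a = H.a from funext ha, show φ ∘ K.b = H.b from funext hb] at this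

/-- Rotating the word of `H` puts the outputs of both factors side by side; a second rotation moves
the reversed inputs of `H` to the front. -/
theorem IsTame.tensor {H : BilabelledGraph k' l'} (h : K.IsTame c d) (h' : H.IsTame c' d') :
    (K.tensor H).IsTame (c ++ c') (d ++ d') := by
  have := K.finiteE
  have := H.finiteE
  refine ⟨?_, by simp [h.length_left, h'.length_left], by simp [h.length_right, h'.length_right]⟩
  have h1 := h.tame.sum (h'.tame.append_comm (by simp [h'.length_left]))
  rw [List.map_append, List.map_append, ← List.append_assoc, ← List.append_assoc] at h1
  have h2 := h1.append_comm (by simp [h.length_left, h'.length_right, h.length_right])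
  change Multigraph.IsTame (V := K.V ⊕ H.V) (E := K.E ⊕ H.E) (K.graph.sum H.graph)
    ((List.ofFn (Fin.append (Sum.inl ∘ K.a) (Sum.inr ∘ H.a))).reverse ++
      List.ofFn (Fin.append (Sum.inl ∘ K.b) (Sum.inr ∘ H.b))) _
  simp only [List.ofFn_fin_append, List.reverse_append, ← List.map_ofFn, List.append_assoc,
    List.map_reverse] at h2 ⊢
  exact h2

theorem comp_graph (H : BilabelledGraph m l) (K : BilabelledGraph k m) :
    (H.comp K).graph = (H.graph.sum K.graph).map (Quot.mk (GlueRel H K)) := by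
  simp only [comp, Multigraph.sum, Multigraph.map, Multigraph.mk.injEq]
  funext e
  rcases e with e | e <;> simp [Sym2.map_map]

/-- In the word of the disjoint union, the outputs of `K` face the reversed inputs of `H`, so they
are joined from the inside outwards. -/
theorem IsTame.comp {H : BilabelledGraph m l} {K : BilabelledGraph k m} (h : H.IsTame c d)
    (h' : K.IsTame c' c) : (H.comp K).IsTame c' d := by
  have := K.finiteE
  have := H.finiteE
  refine ⟨?_, h'.length_left, h.length_right⟩
  have h1 := (h.tame.sum h'.tame).append_comm (by
    simp [h.length_left, h.length_right])
  rw [List.map_append, List.map_append, List.map_reverse, List.map_reverse, ← List.append_assoc,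
    ← List.append_assoc] at h1
  have h2 := h1.cap_list (f := Quot.mk (GlueRel H K)) (by simp [h'.length_left])
    (by simp [h.length_left]) (by simp [h.length_left]) (by
      intro x y
      rw [← eqvGen_eq_mergeList (R := GlueRel H K), Quot.eq]
      · rfl
      · rintro _ _ ⟨i, rfl, rfl⟩
        right
        rw [List.mem_iff_getElem]
        exact ⟨i, by simp, by simp⟩
      · intro p hp
        rw [List.mem_iff_getElem] at hp
        obtain ⟨i, hi, rfl⟩ := hp
        simp only [List.length_zip, List.length_map, List.length_ofFn, min_self] at hi
        exact Or.inr ⟨⟨i, hi⟩, by simp, by simp⟩)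
  rw [comp_graph]
  rw [List.map_append, List.map_reverse, List.map_map, List.map_map, List.map_ofFn,
    List.map_ofFn] at h2
  exact h2

end BilabelledGraph

theorem List.countP_ofFn {α : Type*} {n : ℕ} (f : Fin n → α) (P : α → Bool) :
    (List.ofFn f).countP P = Nat.card {i // P (f i)} := by
  rw [Nat.card_eq_fintype_card, Fintype.card_subtype, Finset.card_def, Finset.filter_val,
    ← Multiset.countP_eq_card_filter, List.ofFn_eq_map, List.countP_map,
    show (Finset.univ : Finset (Fin n)).val = (List.finRange n : Multiset (Fin n)) from rfl,
    Multiset.coe_countP]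
  congr 1
  ext i
  simp

theorem Nat.card_subtype_eq_sum_fiber {α V : Type*} [Finite α] [Fintype V] (q : α → V)
    (P : V → Bool) :
    Nat.card {x // P (q x)} = ∑ v : {v // P v}, Nat.card {x // q x = v.1} := by
  rw [← Nat.card_sigma]
  refine Nat.card_congr ⟨fun x => ⟨⟨q x.1, x.2⟩, ⟨x.1, rfl⟩⟩,
    fun y => ⟨y.2.1, by rw [y.2.2]; exact y.1.2⟩, fun x => rfl, ?_⟩
  rintro ⟨⟨v, hv⟩, ⟨x, hx⟩⟩
  obtain rfl : q x = v := hx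
  rfl

namespace Multigraph

variable {V E V' E' : Type} [Finite E] {g : Multigraph V E} {w : List V} {c : List Bool}

/-- Inclusion and exclusion for the edges starting at `v` and those ending at `v`: the union
consists of the incident edges, the intersection of the loops. -/
theorem degree_eq {s : E × Bool → V} (hs : ∀ e, g.ends e = s(s (e, false), s (e, true))) (v : V) :
    g.degree v = Nat.card {d // s d = v} := by
  have e : {d : E × Bool // s d = v} ≃ {e // s (e, false) = v} ⊕ {e // s (e, true) = v} :=
    ((Equiv.boolProdEquivSum E).symm.trans (Equiv.prodComm _ _)).symm.subtypeEquiv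
      (q := fun x => x.elim (fun e => s (e, false) = v) fun e => s (e, true) = v)
      (by rintro ⟨e, _ | _⟩ <;> rfl) |>.trans Equiv.subtypeSum
  rw [Nat.card_congr e, Nat.card_sum]
  have h := Set.ncard_union_add_ncard_inter {e | s (e, false) = v} {e | s (e, true) = v}
  have h1 : ({e | s (e, false) = v} ∪ {e | s (e, true) = v} : Set E) = {e | v ∈ g.ends e} := by
    ext e
    simp [hs, eq_comm]
  have h2 : ({e | s (e, false) = v} ∩ {e | s (e, true) = v} : Set E) =
      {e | g.ends e = s(v, v)} := by
    ext e
    simp [hs]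
  rw [h1, h2] at h
  exact h

omit [Finite E] in
theorem exists_orientation (g : Multigraph V E) :
    ∃ s : E × Bool → V, ∀ e, g.ends e = s(s (e, false), s (e, true)) :=
  ⟨fun p => if p.2 then (Quot.out (g.ends p.1)).2 else (Quot.out (g.ends p.1)).1,
    fun e => (Quot.out_eq (g.ends e)).symm⟩

omit [Finite E] in
theorem IsTame.not (h : g.IsTame w c) : g.IsTame w (c.map Bool.not) := by
  obtain ⟨hp, s, hs, he, part, h1, h2⟩ := h
  exact ⟨hp, s, hs, he, fun v => !part v, fun e => congrArg _ (h1 e), by rw [← h2, List.map_map]; rfl⟩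

/-- Contract two edges at an unlabelled vertex of degree two. -/
theorem IsTame.contract_pair (h : g.IsTame w c) {v : V} {e f : E} (hef : e ≠ f) (hv : v ∉ w)
    (hdeg : g.degree v = 2) (he : v ∈ g.ends e) (hf : v ∈ g.ends f) {φ : V → V'}
    (hφ : ∀ a b, φ a = φ b ↔ Relation.EqvGen
      (fun x y => ∃ i ∈ ({e, f} : Set E), g.ends i = s(x, y)) a b) :
    IsTame (E := {i // i ∉ ({e, f} : Set E)}) ⟨fun i => (g.ends i.1).map φ⟩ (w.map φ) c := by
  classical
  obtain ⟨hp, s, hs, heven, part, h1, h2⟩ := h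
  obtain ⟨x, hx⟩ := Sym2.mem_iff_exists.1 he
  obtain ⟨y, hy⟩ := Sym2.mem_iff_exists.1 hf
  have hrel : Relation.EqvGen.setoid (fun x y => ∃ i ∈ ({e, f} : Set E), g.ends i = s(x, y)) =
      mergeList [(v, y), (v, x)] := by
    refine eqvGen_eq_mergeList _ ?_ ?_
    · rintro a b ⟨i, rfl | rfl, hi⟩
      · rw [hx, Sym2.eq_iff] at hi
        rcases hi with ⟨rfl, rfl⟩ | ⟨rfl, rfl⟩ <;> simp
      · rw [hy, Sym2.eq_iff] at hi
        rcases hi with ⟨rfl, rfl⟩ | ⟨rfl, rfl⟩ <;> simp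
    · intro p hp
      simp only [List.mem_cons, List.not_mem_nil, or_false] at hp
      rcases hp with rfl | rfl
      exacts [Or.inl ⟨f, by simp, hy⟩, Or.inl ⟨e, by simp, hx⟩]
  have hφ' : ∀ a b, φ a = φ b ↔ merge (merge ⊥ v x) v y a b := fun a b =>
    (hφ a b).trans (Setoid.ext_iff.1 hrel a b)
  have hvx : φ v = φ x := (hφ' _ _).2 (le_merge _ _ _ (merge_rel _ _ _))
  have hvy : φ v = φ y := (hφ' _ _).2 (merge_rel _ _ _)
  have hcol : ∀ i a b, g.ends i = s(a, b) → part b = !part a := by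
    intro i a b hi
    rw [hs, Sym2.eq_iff] at hi
    rcases hi with ⟨rfl, rfl⟩ | ⟨rfl, rfl⟩
    · exact h1 i
    · rw [h1, Bool.not_not]
  have hsd : ∀ i a, a ∈ g.ends i → ∃ b, s (i, b) = a := by
    intro i a hi
    rw [hs, Sym2.mem_iff] at hi
    rcases hi with rfl | rfl
    exacts [⟨_, rfl⟩, ⟨_, rfl⟩]
  -- Any further dart at `v` would be a third one, contrary to degree two.
  have hother : ∀ i ∉ ({e, f} : Set E), ∀ b, s (i, b) ≠ v := by
    rintro i hi b rfl
    simp only [Set.mem_insert_iff, Set.mem_singleton_iff, not_or] at hi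
    obtain ⟨be, hbe⟩ := hsd e _ he
    obtain ⟨bf, hbf⟩ := hsd f _ hf
    rw [degree_eq hs] at hdeg
    have h3 : ({(i, b), (e, be), (f, bf)} : Finset (E × Bool)).card = 3 :=
      Finset.card_eq_three.2 ⟨_, _, _, by simp [hi.1], by simp [hi.2], by simp [hef], rfl⟩
    have h4 := Set.ncard_le_ncard (s := (({(i, b), (e, be), (f, bf)} : Finset (E × Bool)) :
      Set (E × Bool))) (t := {d | s d = s (i, b)}) (by
        intro d hd
        simp only [Finset.coe_insert, Finset.coe_singleton, Set.mem_insert_iff,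
          Set.mem_singleton_iff] at hd
        rcases hd with rfl | rfl | rfl
        exacts [rfl, hbe, hbf])
    rw [Set.ncard_coe_finset, h3] at h4
    exact absurd (h4.trans_eq hdeg) (by decide)
  refine ⟨?_, fun p => φ (s (p.1.1, p.2)), fun i => by simp [hs], fun P => ?_, ?_⟩
  · have hp1 := hp.contract (E' := {i // i ≠ e}) (g' := ⟨fun i => (g.ends i.1).map
      (Quotient.mk (merge ⊥ v x))⟩) hx (f := Quotient.mk (merge ⊥ v x)) (fun a b => Quotient.eq)
      (j := Subtype.val) Subtype.val_injective (by simp) fun i => rfl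
    have hlift : ∀ a b, merge ⊥ v x a b → φ a = φ b := fun a b hab =>
      (hφ' a b).2 (le_merge _ _ _ hab)
    have hp2 := hp1.contract (E' := {i // i ∉ ({e, f} : Set E)}) (e₀ := ⟨f, hef.symm⟩)
      (g' := ⟨fun i => (g.ends i.1).map φ⟩) (x := ⟦v⟧) (y := ⟦y⟧) (by simp [hy])
      (f := Quotient.lift φ hlift) (by
        intro a b
        induction a using Quotient.inductionOn with | _ a
        induction b using Quotient.inductionOn with | _ b
        rw [merge_quotient]
        exact hφ' a b) (j := fun i => ⟨i.1, fun h => i.2 (by simp [h])⟩)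
      (fun i i' h => Subtype.ext (congrArg (fun a : {i // i ≠ e} => a.1) h)) (by
        rintro ⟨i, hi⟩
        constructor
        · rintro ⟨⟨i', hi'⟩, h⟩ h'
          simp only [Subtype.mk.injEq] at h h'
          exact hi' (by simp [h, h'])
        · intro h
          exact ⟨⟨i, by simp only [Set.mem_insert_iff, Set.mem_singleton_iff, not_or]
                        exact ⟨hi, fun h' => h (Subtype.ext h')⟩⟩, rfl⟩) fun i => by
        rw [Sym2.map_map]
        rfl
    rw [List.map_map] at hp2
    exact hp2
  · have heq := heven (P ∘ φ)
    have e1 : {d : E × Bool // P (φ (s d))} ≃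
        {d : {i // i ∈ ({e, f} : Set E)} × Bool // P (φ (s (d.1.1, d.2)))} ⊕
        {d : {i // i ∉ ({e, f} : Set E)} × Bool // P (φ (s (d.1.1, d.2)))} :=
      ((((Equiv.sumCompl (· ∈ ({e, f} : Set E))).symm.prodCongr (Equiv.refl Bool)).trans
        (Equiv.sumProdDistrib _ _ _)).symm.subtypeEquiv (p := fun x => P (x.elim
          (fun d => φ (s (d.1.1, d.2))) fun d => φ (s (d.1.1, d.2)))) (by
          rintro (⟨i, b⟩ | ⟨i, b⟩) <;> rfl)).symm.trans Equiv.subtypeSum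
    -- Both darts of a contracted edge lie at the same new vertex, so the number of darts lost in
    -- any set of vertices is even.
    have e2 : {d : {i // i ∈ ({e, f} : Set E)} × Bool // P (φ (s (d.1.1, d.2)))} ≃
        {i : {i // i ∈ ({e, f} : Set E)} // P (φ (s (i.1, false)))} × Bool := by
      have hb : ∀ (i : {i // i ∈ ({e, f} : Set E)}) b, φ (s (i.1, b)) = φ (s (i.1, false)) := by
        have : ∀ (i : {i // i ∈ ({e, f} : Set E)}), φ (s (i.1, false)) = φ (s (i.1, true)) :=
          fun i => (hφ _ _).2 (.rel _ _ ⟨i.1, i.2, hs _⟩)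
        rintro i (_ | _)
        exacts [rfl, (this i).symm]
      exact ⟨fun d => (⟨d.1.1, by rw [← hb _ d.1.2]; exact d.2⟩, d.1.2),
        fun d => ⟨(d.1.1, d.2), by rw [hb]; exact d.1.2⟩, fun d => rfl, fun d => rfl⟩
    simp only [Function.comp] at heq
    rw [Nat.card_congr e1, Nat.card_sum, Nat.card_congr e2, Nat.card_prod,
      Nat.card_eq_two_iff.2 ⟨false, true, by simp, by ext b; cases b <;> simp⟩, add_assoc,
      Nat.even_add] at heq
    rw [List.countP_map]
    exact heq.1 (even_two.mul_left _)
  -- Both neighbours have the colour opposite to that of `v`. Once `v` is recoloured, the colouring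
  -- is constant on the glued vertices; the labels keep their colours since `v` is not labelled.
  · have hpx : part x = !part v := hcol e v x hx
    have hpy : part y = !part v := hcol f v y hy
    have hne : ∀ b, part b = !part v → b ≠ v := by
      intro b h hbv
      rw [hbv] at h
      cases h' : part v <;> simp [h'] at h
    have hxv : Function.update part v (!part v) x = !part v := by
      rw [Function.update_of_ne (hne x hpx), hpx]
    have hyv : Function.update part v (!part v) y = !part v := by
      rw [Function.update_of_ne (hne y hpy), hpy]
    have hfac : (Function.update part v (!part v)).FactorsThrough φ := by
      have hle : merge (merge ⊥ v x) v y ≤ Setoid.ker (Function.update part v (!part v)) :=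
        merge_le (merge_le bot_le (by
          rw [Setoid.ker_def, hxv, Function.update_self]))
          (by rw [Setoid.ker_def, hyv, Function.update_self])
      exact fun a b hab => hle ((hφ' a b).1 hab)
    refine ⟨Function.extend φ (Function.update part v (!part v)) fun _ => false, fun i => ?_, ?_⟩
    · rw [hfac.extend_apply, hfac.extend_apply, Function.update_of_ne (hother _ i.2 _),
        Function.update_of_ne (hother _ i.2 _), h1]
    · rw [List.map_map, ← h2]
      refine List.map_congr_left fun a ha => ?_
      rw [Function.comp, hfac.extend_apply, Function.update_of_ne]
      rintro rfl
      exact hv ha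

end Multigraph

namespace BilabelledGraph

variable {k l : ℕ}

theorem extDegree_eq (K : BilabelledGraph k l) {s : K.E × Bool → K.V}
    (hs : ∀ e, K.graph.ends e = s(s (e, false), s (e, true))) (v : K.V) :
    K.extDegree v = Nat.card {x // Sum.elim s K.boundary x = v} := by
  have := K.finiteE
  let s' : (K.E ⊕ (Fin (k + l) ⊕ Fin (k + l))) × Bool → K.V ⊕ Fin (k + l) := fun p => match p with
    | (.inl e, b) => .inl (s (e, b))
    | (.inr (.inl i), false) => .inl (K.boundary i)
    | (.inr (.inl i), true) => .inr i
    | (.inr (.inr i), false) => .inr i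
    | (.inr (.inr i), true) => .inr (finRotate (k + l) i)
  rw [extDegree, Multigraph.degree_eq (s := s')]
  · refine (Nat.card_congr (Equiv.ofBijective (fun x : {x // Sum.elim s K.boundary x = v} =>
      (⟨match x.1 with
        | .inl d => (.inl d.1, d.2)
        | .inr i => (.inr (.inl i), false), ?_⟩ : {d // s' d = .inl v})) ⟨?_, ?_⟩)).symm
    · obtain ⟨d | i, h⟩ := x
      exacts [congrArg Sum.inl h, congrArg Sum.inl h]
    · rintro ⟨d | i, h⟩ ⟨d' | i', h'⟩ hh <;> simp only [Subtype.mk.injEq, Prod.mk.injEq,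
        Sum.inl.injEq, Sum.inr.injEq, reduceCtorEq, false_and] at hh ⊢
      exacts [Prod.ext hh.1 hh.2, hh.1]
    · rintro ⟨⟨e | i | i, _ | _⟩, h⟩ <;> simp only [s', Sum.inl.injEq, reduceCtorEq] at h
      exacts [⟨⟨.inl (e, false), h⟩, rfl⟩, ⟨⟨.inl (e, true), h⟩, rfl⟩, ⟨⟨.inr i, h⟩, rfl⟩]
  · rintro (e | i | i)
    · simp [enveloped, hs, s']
    · simp [enveloped, s']
    · simp [enveloped, s']

theorem card_subtype_elim (K : BilabelledGraph k l) (s : K.E × Bool → K.V) (P : K.V → Bool) :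
    Nat.card {x // P (Sum.elim s K.boundary x)} = Nat.card {d // P (s d)} +
      ((List.ofFn K.a).reverse ++ List.ofFn K.b).countP P := by
  have := K.finiteE
  rw [← ofFn_boundary, List.countP_ofFn, ← Nat.card_sum]
  exact Nat.card_congr Equiv.subtypeSum

/-- Parity at single vertices and parity for sets of vertices are equivalent: take singletons in one
direction and sum over the vertices of the set in the other. -/
theorem isTame_iff (K : BilabelledGraph k l) :
    K.IsTame (List.replicate k true) (List.replicate l true) ↔
      K.IsPlanar ∧ (∀ v : K.V, Even (K.extDegree v)) ∧ K.IsLabelBipartite := by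
  classical
  have := K.finiteE
  have := K.finiteV
  have := Fintype.ofFinite K.V
  have hlab : ∀ part : K.V → Bool, ((List.ofFn K.a).reverse ++ List.ofFn K.b).map part =
      (List.replicate k true).reverse ++ List.replicate l true ↔
      (∀ i, part (K.a i) = true) ∧ ∀ j, part (K.b j) = true := by
    intro part
    rw [List.reverse_replicate, List.replicate_append_replicate, List.eq_replicate_iff]
    simp only [List.length_map, List.length_append, List.length_reverse, List.length_ofFn,
      true_and, List.mem_map, List.mem_append, List.mem_reverse, List.mem_ofFn]
    constructor
    · exact fun h => ⟨fun i => h _ ⟨_, Or.inl ⟨i, rfl⟩, rfl⟩, fun i => h _ ⟨_, Or.inr ⟨i, rfl⟩, rfl⟩⟩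
    · rintro ⟨h1, h2⟩ _ ⟨_, ⟨i, rfl⟩ | ⟨i, rfl⟩, rfl⟩
      exacts [h1 i, h2 i]
  rw [isPlanar_iff, ofFn_boundary]
  constructor
  · rintro ⟨⟨hp, s, hs, he, part, h1, h2⟩, -, -⟩
    refine ⟨hp, fun v => ?_, {v | part v}, fun e u v huv => ?_, ((hlab part).1 h2).1,
      ((hlab part).1 h2).2⟩
    · have := he fun u => decide (u = v)
      rw [← card_subtype_elim K s fun u => decide (u = v)] at this
      rw [K.extDegree_eq hs]
      simpa using this
    · have h3 := h1 e
      rw [hs, Sym2.eq_iff] at huv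
      rcases huv with ⟨rfl, rfl⟩ | ⟨rfl, rfl⟩ <;> simp [h3]
  · rintro ⟨hp, he, part, h1, h2, h3⟩
    obtain ⟨s, hs⟩ := K.graph.exists_orientation
    refine ⟨⟨hp, s, hs, fun P => ?_, fun v => decide (v ∈ part), fun e => ?_, ?_⟩, by simp, by simp⟩
    · rw [← card_subtype_elim, Nat.card_subtype_eq_sum_fiber]
      refine Finset.even_sum _ fun v _ => ?_
      rw [← K.extDegree_eq hs]
      exact he v
    · have := h1 e _ _ (hs e)
      by_cases h : s (e, true) ∈ part <;> simp_all
    · rw [hlab]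
      simpa using ⟨h2, h3⟩

theorem IsTame.contract {K : BilabelledGraph k l} {c d : List Bool} (h : K.IsTame c d) {v : K.V}
    {e f : K.E} (hv : K.IsInner v) (hdeg : K.graph.degree v = 2) (hef : e ≠ f)
    (he : v ∈ K.graph.ends e) (hf : v ∈ K.graph.ends f) : (K.contract {e, f}).IsTame c d := by
  have := K.finiteE
  refine ⟨?_, h.length_left, h.length_right⟩
  have := h.tame.contract_pair (v := v) hef (by
    simp only [List.mem_append, List.mem_reverse, List.mem_ofFn, not_or, not_exists]
    exact hv) hdeg he hf (φ := Quot.mk _) fun a b => Quot.eq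
  rw [List.map_append, List.map_reverse, List.map_ofFn, List.map_ofFn] at this
  exact this

theorem isTame_M (h : Even (k + l)) (b : Bool) :
    (M k l).IsTame (List.replicate k b) (List.replicate l b) := by
  have : IsEmpty (M k l).E := inferInstanceAs (IsEmpty Empty)
  refine ⟨?_, by simp, by simp⟩
  have := Multigraph.IsTame.of_edgeless (g := (M k l).graph)
    (w := (List.ofFn (M k l).a).reverse ++ List.ofFn (M k l).b) (fun x _ y _ => rfl) (by simpa) b
  simpa using this

theorem isTame_edge (b : Bool) : edge.IsTame [b] [!b] := by
  refine ⟨?_, rfl, rfl⟩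
  cases b
  exacts [Multigraph.isTame_edge, Multigraph.isTame_edge.not]

/-- The middle vertex has colour `false` and the four outer ends have colour `true`. The factors
therefore have labels of colour `false`, which is why tameness is not restricted to labels of colour
`true`. -/
theorem isTame_edgeConnecter :
    edgeConnecter.IsTame (List.replicate 2 true) (List.replicate 2 true) := by
  have h1 := (isTame_edge true).tensor (isTame_edge true)
  have h2 := (isTame_edge false).tensor (isTame_edge false)
  exact (h2.comp (isTame_M (k := 2) (l := 2) (by decide) false)).comp h1

theorem isTame_null : null.IsTame [] [] := by
  have : IsEmpty null.E := inferInstanceAs (IsEmpty Empty)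
  exact ⟨.of_edgeless (by simp) (by simp) true, rfl, rfl⟩

end BilabelledGraph

/-- The bilabelled graphs that are planar, even, and bipartite with all labels in one part. -/
def tameCollection : GraphCollection :=
  {K | K.2.2.IsPlanar ∧ (∀ v : K.2.2.V, Even (K.2.2.extDegree v)) ∧ K.2.2.IsLabelBipartite}

open BilabelledGraph

theorem mem_tameCollection {k l : ℕ} {K : BilabelledGraph k l} : ⟨k, l, K⟩ ∈ tameCollection ↔
    K.IsTame (List.replicate k true) (List.replicate l true) := (isTame_iff K).symm

theorem isGraphCategory_tameCollection : IsGraphCategory tameCollection where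
  iso_mem hi h := by
    rw [mem_tameCollection] at h ⊢
    exact h.iso hi
  id_mem := mem_tameCollection.2 (isTame_M (by decide) true)
  dual_mem := mem_tameCollection.2 (isTame_M (by decide) true)
  null_mem := mem_tameCollection.2 isTame_null
  tensor_mem h h' := by
    rw [mem_tameCollection] at h h' ⊢
    rw [← List.replicate_append_replicate, ← List.replicate_append_replicate]
    exact h.tensor h'
  comp_mem h h' := by
    rw [mem_tameCollection] at h h' ⊢
    exact h.comp h'
  invol_mem h := by
    rw [mem_tameCollection] at h ⊢
    exact h.invol

theorem isTwoPathClosed_tameCollection : IsTwoPathClosed tameCollection := by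
  intro k l K v e f hv hdeg hef he hf h
  rw [mem_tameCollection] at h ⊢
  exact h.contract hv hdeg hef he hf

theorem contractionClosure_subset_tameCollection :
    contractionClosure {⟨2, 2, M 2 2⟩, ⟨2, 2, edgeConnecter⟩} ⊆ tameCollection := by
  intro K hK
  refine hK _ isGraphCategory_tameCollection isTwoPathClosed_tameCollection ?_
  rintro _ (rfl | rfl)
  · exact mem_tameCollection.2 (isTame_M (by decide) true)
  · exact mem_tameCollection.2 isTame_edgeConnecter

/-! ### Capping and bending in an arbitrary graph category -/

open Equiv Hypermap BilabelledGraph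

variable {C : GraphCollection}

theorem Sym2.map_equiv_refl {α : Type*} (z : Sym2 α) : z.map (Equiv.refl α) = z :=
  congrFun Sym2.map_id' z

namespace IsGraphCategory

variable {k l k' l' : ℕ}

theorem mem_of_equiv (hC : IsGraphCategory C) {K : BilabelledGraph k l}
    {T : BilabelledGraph k' l'} (hK : ⟨k, l, K⟩ ∈ C) (hk : k = k') (hl : l = l') (φ : K.V ≃ T.V)
    (ψ : K.E ≃ T.E) (hg : ∀ e, T.graph.ends (ψ e) = (K.graph.ends e).map φ)
    (ha : ∀ i, φ (K.a i) = T.a (Fin.cast hk i)) (hb : ∀ i, φ (K.b i) = T.b (Fin.cast hl i)) :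
    ⟨k', l', T⟩ ∈ C := by
  subst hk hl
  exact hC.iso_mem ⟨φ, ψ, hg, ha, hb⟩ hK

/-- Parallel strings. -/
def strings (l : ℕ) : BilabelledGraph l l where
  V := Fin l
  E := Empty
  finiteV := inferInstance
  finiteE := inferInstance
  graph := ⟨Empty.elim⟩
  a := id
  b := id

theorem strings_mem (hC : IsGraphCategory C) (l : ℕ) : ⟨l, l, strings l⟩ ∈ C := by
  induction l with
  | zero =>
    exact hC.mem_of_equiv hC.null_mem rfl rfl (Equiv.equivOfIsEmpty Empty (Fin 0))
      (Equiv.refl Empty) (fun e => e.elim) (fun i => i.elim0) fun i => i.elim0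
  | succ l ih =>
    have key : ∀ i, finSumFinEquiv (m := l) (n := 1)
        (Sum.map id (fun _ => 0) ((Fin.append (Sum.inl ∘ id) (Sum.inr ∘ fun _ => ()) :
          Fin (l + 1) → Fin l ⊕ Unit) i)) = i := by
      intro i
      refine Fin.addCases (fun i => ?_) (fun i => ?_) i
      · simp
      · simp [Subsingleton.elim i 0]
    exact hC.mem_of_equiv (hC.tensor_mem ih hC.id_mem) rfl rfl
      (((Equiv.refl (Fin l)).sumCongr (Equiv.ofUnique Unit (Fin 1))).trans finSumFinEquiv)
      (Equiv.equivOfIsEmpty (Empty ⊕ Empty) Empty) (fun e => by rcases e with e | e <;> cases e)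
      key key

/-- The strings, with a cap on the left. -/
def capStrings (l : ℕ) : BilabelledGraph (l + 2) l where
  V := Option (Fin l)
  E := Empty
  finiteV := inferInstance
  finiteE := inferInstance
  graph := ⟨Empty.elim⟩
  a := Fin.cons none (Fin.cons none some)
  b := some

theorem capStrings_mem (hC : IsGraphCategory C) (l : ℕ) : ⟨l + 2, l, capStrings l⟩ ∈ C := by
  refine hC.mem_of_equiv (hC.tensor_mem (hC.invol_mem hC.dual_mem) (hC.strings_mem l))
    (add_comm 2 l) (zero_add l)
    (((Equiv.sumComm Unit (Fin l)).trans (Equiv.optionEquivSumPUnit (Fin l)).symm))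
    (Equiv.equivOfIsEmpty (Empty ⊕ Empty) Empty) (fun e => by rcases e with e | e <;> cases e)
    (fun i => ?_) fun i => ?_
  · refine Fin.addCases (fun i => ?_) (fun i => ?_) i
    · have e : (capStrings l).a (Fin.cast (add_comm 2 l) (Fin.castAdd l i)) = none := by
        fin_cases i <;> rfl
      rw [e]
      exact congrArg _ (Fin.append_left _ _ i)
    · have e : Fin.cast (add_comm 2 l) (Fin.natAdd 2 i) = i.succ.succ :=
        Fin.ext (by simp)
      rw [e]
      exact congrArg _ (Fin.append_right _ _ i)
  · refine Fin.addCases (fun i => i.elim0) (fun i => ?_) i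
    have e : Fin.cast (zero_add l) (Fin.natAdd 0 i) = i := Fin.ext (by simp)
    rw [e]
    exact Eq.trans (congrArg _ (Fin.append_right (Sum.inl ∘ (M 2 0).b) (Sum.inr ∘ id) i)) rfl

/-- Composing with `capStrings` identifies the first two outputs and removes them. The result is
described by a surjection `f` with the right fibres, so that quotients need not be mentioned in
applications. -/
theorem cap_mem (hC : IsGraphCategory C) {K : BilabelledGraph k (l + 2)}
    {T : BilabelledGraph k l} (hK : ⟨k, l + 2, K⟩ ∈ C) {f : K.V → T.V}
    (hs : Function.Surjective f) (hf : ∀ x y, f x = f y ↔ merge ⊥ (K.b 0) (K.b 1) x y)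
    (ψ : K.E ≃ T.E) (hg : ∀ e, T.graph.ends (ψ e) = (K.graph.ends e).map f)
    (ha : ∀ i, f (K.a i) = T.a i) (hb : ∀ i : Fin l, f (K.b i.succ.succ) = T.b i) :
    ⟨k, l, T⟩ ∈ C := by
  let F : Option (Fin l) ⊕ K.V → T.V :=
    Sum.elim (fun o => o.elim (f (K.b 0)) T.b) f
  have h01 : f (K.b 1) = f (K.b 0) := ((hf _ _).2 (merge_rel _ _ _)).symm
  have hF : ∀ x y, GlueRel (capStrings l) K x y → F x = F y := by
    rintro _ _ ⟨i, rfl, rfl⟩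
    refine Fin.cases rfl (fun i => ?_) i
    refine Fin.cases ?_ (fun i => ?_) i
    · exact h01.symm
    · exact (hb i).symm
  have hrep : ∀ p : Quot (GlueRel (capStrings l) K), ∃ x, p = Quot.mk _ (Sum.inr x) := by
    intro p
    induction p using Quot.ind with | _ p
    rcases p with (_ | i) | x
    · exact ⟨K.b 0, Quot.sound ⟨0, rfl, rfl⟩⟩
    · exact ⟨K.b i.succ.succ, Quot.sound ⟨i.succ.succ, rfl, rfl⟩⟩
    · exact ⟨x, rfl⟩
  have hmk : (Quot.mk (GlueRel (capStrings l) K) (Sum.inr (K.b 0))) =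
      Quot.mk _ (Sum.inr (K.b 1)) :=
    (Quot.sound ⟨0, rfl, rfl⟩ : Quot.mk (GlueRel (capStrings l) K) (Sum.inl none) = _).symm.trans
      (Quot.sound ⟨1, rfl, rfl⟩)
  have hbij : Function.Bijective (Quot.lift F hF) := by
    refine ⟨fun p q hpq => ?_, fun y => ?_⟩
    · obtain ⟨x, rfl⟩ := hrep p
      obtain ⟨y, rfl⟩ := hrep q
      rcases (hf x y).1 hpq with h | ⟨h, h'⟩ | ⟨h, h'⟩
      · rw [show x = y from h]
      · rw [show x = K.b 0 from h, ← show K.b 1 = y from h', hmk]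
      · rw [show x = K.b 1 from h, ← show K.b 0 = y from h', hmk]
    · obtain ⟨x, rfl⟩ := hs y
      exact ⟨Quot.mk _ (Sum.inr x), rfl⟩
  refine hC.mem_of_equiv (hC.comp_mem (hC.capStrings_mem l) hK) rfl rfl
    (Equiv.ofBijective _ hbij) ((Equiv.emptySum Empty K.E).trans ψ) ?_ ha fun i => rfl
  rintro (e | e)
  · cases e
  · change T.graph.ends (ψ e) = ((K.graph.ends e).map _).map _
    rw [hg]
    exact Eq.symm (Sym2.map_map ..)

/-- Turn the first output into the first input. -/
theorem bend_mem (hC : IsGraphCategory C) {K : BilabelledGraph k (l + 1)}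
    (hK : ⟨k, l + 1, K⟩ ∈ C) {T : BilabelledGraph (k + 1) l} (φ : K.V ≃ T.V) (ψ : K.E ≃ T.E)
    (hg : ∀ e, T.graph.ends (ψ e) = (K.graph.ends e).map φ) (ha0 : T.a 0 = φ (K.b 0))
    (ha : ∀ i : Fin k, T.a i.succ = φ (K.a i)) (hb : ∀ i : Fin l, T.b i = φ (K.b i.succ)) :
    ⟨k + 1, l, T⟩ ∈ C := by
  have := K.finiteV
  have := K.finiteE
  -- A string is placed on the left. Capping its output with the first output of `K` leaves its
  -- input as the new first input.
  let K' : BilabelledGraph (k + 1) (l + 2) :=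
    { V := Option K.V
      E := K.E
      finiteV := inferInstance
      finiteE := inferInstance
      graph := K.graph.map some
      a := Fin.cons none (some ∘ K.a)
      b := Fin.cons none (some ∘ K.b) }
  have hK' : ⟨k + 1, l + 2, K'⟩ ∈ C := by
    refine hC.mem_of_equiv (hC.tensor_mem hC.id_mem hK) (add_comm 1 k) (add_comm 1 (l + 1))
      (((Equiv.sumComm Unit K.V).trans (Equiv.optionEquivSumPUnit K.V).symm))
      (Equiv.emptySum Empty K.E) ?_ (fun i => ?_) fun i => ?_
    · rintro (e | e)
      · cases e
      · change (K.graph.ends e).map some = ((K.graph.ends e).map _).map _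
        exact Eq.symm (Sym2.map_map ..)
    · refine Fin.addCases (fun i => ?_) (fun i => ?_) i
      · rw [Subsingleton.elim i 0]
        exact Eq.trans (congrArg _ (Fin.append_left (Sum.inl ∘ (M 1 1).a) (Sum.inr ∘ K.a) 0)) rfl
      · have e : Fin.cast (add_comm 1 k) (Fin.natAdd 1 i) = i.succ := Fin.ext (by simp)
        rw [e]
        exact congrArg _ (Fin.append_right _ _ i)
    · refine Fin.addCases (fun i => ?_) (fun i => ?_) i
      · rw [Subsingleton.elim i 0]
        exact Eq.trans (congrArg _ (Fin.append_left (Sum.inl ∘ (M 1 1).b) (Sum.inr ∘ K.b) 0)) rfl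
      · have e : Fin.cast (add_comm 1 (l + 1)) (Fin.natAdd 1 i) = i.succ :=
          Fin.ext (by simp)
        rw [e]
        exact congrArg _ (Fin.append_right _ _ i)
  refine hC.cap_mem hK' (f := fun o => o.elim (φ (K.b 0)) φ) (fun y => ⟨some (φ.symm y), by simp⟩)
    ?_ ψ (fun e => ?_) (fun i => ?_) fun i => (hb i).symm
  · rintro (_ | x) (_ | y) <;> simp [merge_apply, K', eq_comm]
  · rw [hg]
    exact Eq.symm (Sym2.map_map ..)
  · refine Fin.cases ?_ (fun i => ?_) i
    · exact ha0.symm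
    · exact (ha i).symm

/-- Turn the first input into the first output. -/
theorem unbend_mem (hC : IsGraphCategory C) {K : BilabelledGraph (k + 1) l}
    (hK : ⟨k + 1, l, K⟩ ∈ C) {T : BilabelledGraph k (l + 1)} (φ : K.V ≃ T.V) (ψ : K.E ≃ T.E)
    (hg : ∀ e, T.graph.ends (ψ e) = (K.graph.ends e).map φ) (hb0 : T.b 0 = φ (K.a 0))
    (ha : ∀ i : Fin k, T.a i = φ (K.a i.succ)) (hb : ∀ i : Fin l, T.b i.succ = φ (K.b i)) :
    ⟨k, l + 1, T⟩ ∈ C :=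
  hC.invol_mem (K := T.invol) (hC.bend_mem (hC.invol_mem hK) φ ψ hg hb0 hb ha)

end IsGraphCategory

/-! ### Graphs with outputs only, read as cyclic words -/

namespace Multigraph

variable {V E V' E' : Type} [Finite V] [Finite E] [Finite V'] [Finite E'] {g : Multigraph V E}
  {g' : Multigraph V' E'} {w : List V} {w' : List V'}

/-- A graph with a list of output vertices. -/
def toBilabelled (g : Multigraph V E) (w : List V) : BilabelledGraph 0 w.length :=
  ⟨V, E, inferInstance, inferInstance, g, Fin.elim0, w.get⟩

/-- The collection contains the graph with outputs `w`. -/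
def InCat (C : GraphCollection) (g : Multigraph V E) (w : List V) : Prop :=
  ⟨0, w.length, g.toBilabelled w⟩ ∈ C

theorem InCat.equiv (hC : IsGraphCategory C) (h : InCat C g w) (φ : V ≃ V') (ψ : E ≃ E')
    (hg : ∀ e, g'.ends (ψ e) = (g.ends e).map φ) (hw : w.map φ = w') : InCat C g' w' := by
  subst hw
  refine hC.mem_of_equiv h rfl (List.length_map _).symm φ ψ hg (fun i => i.elim0) fun i => ?_
  simp [toBilabelled]
  rfl

theorem InCat.sum (hC : IsGraphCategory C) (h : InCat C g w) (h' : InCat C g' w') :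
    InCat C (g.sum g') (w.map Sum.inl ++ w'.map Sum.inr) := by
  refine hC.mem_of_equiv (hC.tensor_mem h h') rfl (by simp) (Equiv.refl _) (Equiv.refl _)
    (fun e => (Sym2.map_equiv_refl _).symm) (fun i => i.elim0) fun i => ?_
  refine Fin.addCases (fun i => ?_) (fun i => ?_) i
  · refine (Fin.append_left _ _ i).trans ?_
    simp [toBilabelled]
  · refine (Fin.append_right _ _ i).trans ?_
    simp [toBilabelled]

theorem InCat.cap (hC : IsGraphCategory C) {x y : V} (h : InCat C g (x :: y :: w)) {f : V → V'}
    (hs : Function.Surjective f) (hf : ∀ a b, f a = f b ↔ merge ⊥ x y a b) (ψ : E ≃ E')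
    (hg : ∀ e, g'.ends (ψ e) = (g.ends e).map f) (hw : w.map f = w') : InCat C g' w' := by
  subst hw
  have h1 := hC.cap_mem (T := ⟨V', E', inferInstance, inferInstance, g', Fin.elim0, f ∘ w.get⟩)
    (K := g.toBilabelled (x :: y :: w)) h hs hf ψ hg (fun i => i.elim0) fun i => rfl
  exact hC.mem_of_equiv h1 rfl (List.length_map _).symm (Equiv.refl _) (Equiv.refl _)
    (fun e => (Sym2.map_equiv_refl _).symm) (fun i => i.elim0)
    fun i => by simp [toBilabelled]; rfl

/-- The first label is bent to the other side, where it is alone. Capping it with a string placed to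
its right brings it back behind all other labels. -/
theorem InCat.rotate_one (hC : IsGraphCategory C) {x : V} (h : InCat C g (x :: w)) :
    InCat C g (w ++ [x]) := by
  let T : BilabelledGraph 1 w.length :=
    ⟨V, E, inferInstance, inferInstance, g, fun _ => x, w.get⟩
  have h1 : ⟨1, w.length, T⟩ ∈ C := hC.bend_mem (K := g.toBilabelled (x :: w)) h (Equiv.refl _)
    (Equiv.refl _) (fun e => (Sym2.map_equiv_refl _).symm) rfl (fun i => i.elim0) fun i => rfl
  have h2 : ⟨w.length + 1, 0 + 2, T.invol.tensor (M 1 1)⟩ ∈ C :=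
    hC.tensor_mem (hC.invol_mem h1) hC.id_mem
  let f : V ⊕ Unit → V := Sum.elim id fun _ => x
  have hf : ∀ a b, f a = f b ↔ merge ⊥ (.inl x) (.inr ()) a b := by
    rintro (a | a) (b | b) <;> simp [f, merge_apply, eq_comm]
  have hA : ∀ i : Fin (w.length + 1), f (Fin.append (Sum.inl ∘ w.get) (Sum.inr ∘ fun _ => ()) i) =
      Fin.append w.get (fun _ : Fin 1 => x) i := fun i => by
    refine Fin.addCases (fun i => ?_) (fun i => ?_) i
    · rw [Fin.append_left, Fin.append_left]
      rfl
    · rw [Fin.append_right, Fin.append_right]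
      rfl
  have hB : ∀ i : Fin (w.length + 1), Fin.append w.get (fun _ : Fin 1 => x) i =
      (w ++ [x]).get (Fin.cast (by simp) i) := fun i => by
    refine Fin.addCases (fun i => ?_) (fun i => ?_) i
    · rw [Fin.append_left]
      simp
    · rw [Fin.append_right]
      simp
  have h3 := hC.cap_mem h2
    (T := ⟨V, E, inferInstance, inferInstance, g, Fin.append w.get fun _ : Fin 1 => x, Fin.elim0⟩)
    (f := f) (fun y => ⟨Sum.inl y, rfl⟩) hf (Equiv.sumEmpty E Empty) (by
      rintro (e | e)
      · exact Eq.trans (congrFun Sym2.map_id' (g.ends e)).symm (Eq.symm (Sym2.map_map ..))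
      · cases e) hA fun i => i.elim0
  exact hC.mem_of_equiv (hC.invol_mem h3) rfl (by simp) (Equiv.refl _) (Equiv.refl _)
    (fun e => (Sym2.map_equiv_refl _).symm) (fun i => i.elim0) hB

theorem InCat.rotate (hC : IsGraphCategory C) (h : InCat C g w) (n : ℕ) :
    InCat C g (w.rotate n) := by
  induction n with
  | zero => rwa [List.rotate_zero]
  | succ n ih =>
    rw [← List.rotate_rotate]
    generalize w.rotate n = u at ih
    rcases u with _ | ⟨x, u⟩
    · exact ih
    · rw [List.rotate_cons_succ, List.rotate_zero]
      exact ih.rotate_one hC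

end Multigraph

/-- The inputs are bent to outputs one at a time, always the first one and always to the first
place, which reverses their order. -/
theorem BilabelledGraph.mem_iff_inCat (hC : IsGraphCategory C) {k l : ℕ}
    (K : BilabelledGraph k l) : ⟨k, l, K⟩ ∈ C ↔
      haveI := K.finiteV
      haveI := K.finiteE
      Multigraph.InCat C K.graph ((List.ofFn K.a).reverse ++ List.ofFn K.b) := by
  induction k generalizing l with
  | zero =>
    have := K.finiteV
    have := K.finiteE
    constructor
    · intro h
      exact hC.mem_of_equiv h rfl (by simp) (Equiv.refl _) (Equiv.refl _)
        (fun e => (Sym2.map_equiv_refl _).symm) (fun i => i.elim0)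
        fun i => by simp [Multigraph.toBilabelled]; rfl
    · intro h
      exact hC.mem_of_equiv h rfl (by simp) (Equiv.refl _) (Equiv.refl _)
        (fun e => (Sym2.map_equiv_refl _).symm) (fun i => i.elim0)
        fun i => by simp [Multigraph.toBilabelled]; rfl
  | succ k ih =>
    let T : BilabelledGraph k (l + 1) := { K with
      a := fun i => K.a i.succ
      b := Fin.cons (K.a 0) K.b }
    have e : (⟨k + 1, l, K⟩ ∈ C) ↔ ⟨k, l + 1, T⟩ ∈ C :=
      ⟨fun h => hC.unbend_mem h (Equiv.refl _) (Equiv.refl _)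
        (fun e => (Sym2.map_equiv_refl _).symm) rfl (fun _ => rfl) fun _ => rfl,
      fun h => hC.bend_mem h (Equiv.refl _) (Equiv.refl _)
        (fun e => (Sym2.map_equiv_refl _).symm) rfl (fun _ => rfl) fun _ => rfl⟩
    rw [e, ih T]
    have e' : (List.ofFn T.a).reverse ++ List.ofFn T.b =
        (List.ofFn K.a).reverse ++ List.ofFn K.b := by
      rw [List.ofFn_succ (f := T.b), List.ofFn_succ (f := K.a)]
      simp [T]
    rw [e']

/-! ### Pendant edges and stars -/

variable {C : GraphCollection}

namespace Multigraph

variable {V E V' E' L L' : Type}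

/-- The graph on `V` without edges. -/
def edgeless (V : Type) : Multigraph V Empty := ⟨Empty.elim⟩

/-- Attach pendant edges with leaves in `L`. -/
def leaf (g : Multigraph V E) (t : L → V) : Multigraph (V ⊕ L) (E ⊕ L) :=
  ⟨Sum.elim (fun e => (g.ends e).map Sum.inl) fun x => s(Sum.inl (t x), Sum.inr x)⟩

/-- The star with set of leaves `L`. -/
abbrev star (L : Type) : Multigraph (Unit ⊕ L) (Empty ⊕ L) := (edgeless Unit).leaf fun _ => ()

/-- Exchange the two summands in the middle. -/
def sumExchange (V L V' L' : Type) : (V ⊕ L) ⊕ (V' ⊕ L') ≃ (V ⊕ V') ⊕ (L ⊕ L') where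
  toFun := Sum.elim (Sum.map Sum.inl Sum.inl) (Sum.map Sum.inr Sum.inr)
  invFun := Sum.elim (Sum.map Sum.inl Sum.inl) (Sum.map Sum.inr Sum.inr)
  left_inv := by rintro ((x | x) | (x | x)) <;> rfl
  right_inv := by rintro ((x | x) | (x | x)) <;> rfl

variable [Finite V] [Finite E] [Finite V'] [Finite E'] [Finite L] [Finite L']
  {g : Multigraph V E} {g' : Multigraph V' E'} {t : L → V} {t' : L' → V'}
  {w : List (V ⊕ L)} {w' : List (V' ⊕ L')}

theorem InCat.leaf_equiv (hC : IsGraphCategory C) (h : InCat C (g.leaf t) w) (φ : V ≃ V')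
    (ψ : E ≃ E') (χ : L ≃ L') (hg : ∀ e, g'.ends (ψ e) = (g.ends e).map φ)
    (ht : ∀ x, t' (χ x) = φ (t x)) (hw : w.map (Sum.map φ χ) = w') :
    InCat C (g'.leaf t') w' := by
  refine h.equiv hC (φ.sumCongr χ) (ψ.sumCongr χ) ?_ hw
  rintro (e | x)
  · simp only [leaf, Equiv.sumCongr_apply, Sum.map_inl, Sum.elim_inl, hg, Sym2.map_map]
    rfl
  · simp [leaf, ht]

theorem InCat.leaf_sum (hC : IsGraphCategory C) (h : InCat C (g.leaf t) w)
    (h' : InCat C (g'.leaf t') w') : InCat C ((g.sum g').leaf (Sum.map t t'))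
      (w.map (Sum.map Sum.inl Sum.inl) ++ w'.map (Sum.map Sum.inr Sum.inr)) := by
  refine (h.sum hC h').equiv hC (sumExchange V L V' L') (sumExchange E L E' L') ?_ ?_
  · have key : ∀ {A B D : Type} (p : A → B) (q : B → D) (z : Sym2 A),
        (z.map p).map q = z.map (q ∘ p) := fun p q z => Sym2.map_map ..
    rintro ((e | x) | (e | x))
    · exact (key ..).trans (Eq.symm ((congrArg _ (key ..)).trans (key ..)))
    · rfl
    · exact (key ..).trans (Eq.symm ((congrArg _ (key ..)).trans (key ..)))
    · rfl
  · rw [List.map_append, List.map_map, List.map_map]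
    rfl

/-- The leaves of a star are interchangeable, so the order in which they are listed does not matter.
-/
theorem InCat.star_congr (hC : IsGraphCategory C) {B : List L} {B' : List L'}
    (h : InCat C (star L) (B.map Sum.inr)) (hB : B.Nodup) (hB' : B'.Nodup) (hm : ∀ x, x ∈ B)
    (hm' : ∀ x, x ∈ B') (hl : B.length = B'.length) : InCat C (star L') (B'.map Sum.inr) := by
  classical
  let χ : L ≃ L' := (hB.getEquivOfForallMemList B hm).symm.trans
    ((finCongr hl).trans (hB'.getEquivOfForallMemList B' hm'))
  refine h.leaf_equiv hC (Equiv.refl Unit) (Equiv.refl Empty) χ (fun e => e.elim) (fun _ => rfl) ?_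
  rw [List.map_map]
  refine List.ext_getElem (by simpa using hl) fun i h1 h2 => ?_
  simp only [List.length_map] at h1 h2
  have : χ B[i] = B'[i] := by
    have : (hB.getEquivOfForallMemList B hm).symm B[i] = ⟨i, h1⟩ := by
      rw [Equiv.symm_apply_eq]
      rfl
    simp [χ, this]
  simp [this]

/-- Capping the two leaves produces an inner vertex of degree two. Contracting its edges identifies
their other ends; if these coincide already, two parallel edges disappear. -/
theorem InCat.star_append (hC : IsGraphCategory C) (hP : IsTwoPathClosed C) {V' : Type} [Finite V']
    {t : L ⊕ Bool → V} {w : List (V ⊕ L)}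
    (h : InCat C (g.leaf t) (.inr (.inr false) :: .inr (.inr true) :: w.map (Sum.map id Sum.inl)))
    {f : V → V'} (hs : Function.Surjective f)
    (hf : ∀ a b, f a = f b ↔ merge ⊥ (t (.inr false)) (t (.inr true)) a b) :
    InCat C ((g.map f).leaf fun x => f (t (.inl x))) (w.map (Sum.map f id)) := by
  let f₁ : V ⊕ (L ⊕ Bool) → (V ⊕ L) ⊕ Unit :=
    Sum.elim (fun a => .inl (.inl a)) (Sum.map Sum.inr fun _ => ())
  have h1 : InCat C ((g.leaf t).map f₁) (w.map Sum.inl) := by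
    refine h.cap hC (f := f₁) ?_ ?_ (Equiv.refl _) (fun e => rfl) ?_
    · rintro ((a | x) | u)
      exacts [⟨.inl a, rfl⟩, ⟨.inr (.inl x), rfl⟩, ⟨.inr (.inr true), rfl⟩]
    · rintro (a | x | b) (a' | x' | b') <;> simp [f₁, merge_apply]
      cases b <;> cases b' <;> simp
    · rw [List.map_map]
      refine List.map_congr_left fun x _ => ?_
      rcases x with x | x <;> rfl
  have hfe : f (t (.inr false)) = f (t (.inr true)) := (hf _ _).2 (merge_rel _ _ _)
  let G := (g.leaf t).map f₁
  have hGl : ∀ e, G.ends (.inl e) = (g.ends e).map fun a => .inl (.inl a) := fun e =>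
    Sym2.map_map ..
  have h2 := hP (((g.leaf t).map f₁).toBilabelled (w.map Sum.inl)) (.inr ()) (.inr (.inr false))
    (.inr (.inr true)) ?_ ?_ (by rintro ⟨⟩) ?_ ?_ h1
  rotate_left
  · refine ⟨fun i => i.elim0, fun i => ?_⟩
    simp [toBilabelled]
  · have e1 : Nat.card {e // .inr () ∈ G.ends e} = 2 := by
      rw [Nat.card_eq_two_iff]
      refine ⟨⟨.inr (.inr false), ?_⟩, ⟨.inr (.inr true), ?_⟩, ?_, ?_⟩
      · simp [G, leaf, f₁]
      · simp [G, leaf, f₁]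
      · exact fun h => by cases congrArg Subtype.val h
      · ext ⟨e | x | b, he⟩
        · rw [hGl, Sym2.mem_map] at he
          simp at he
        · simp [G, leaf, f₁] at he
        · cases b <;> simp
    have e2 : Nat.card {e // G.ends e = s(.inr (), .inr ())} = 0 := by
      rw [Finite.card_eq_zero_iff]
      refine ⟨?_⟩
      rintro ⟨e | x | b, he⟩
      · have : Sum.inr () ∈ G.ends (.inl e) := by rw [he]; simp
        rw [hGl, Sym2.mem_map] at this
        simp at this
      · simp [G, leaf, f₁] at he
      · simp [G, leaf, f₁] at he
    change Nat.card {e // .inr () ∈ G.ends e} + Nat.card {e // G.ends e = s(.inr (), .inr ())} = 2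
    rw [e1, e2]
  · exact Sym2.mem_mk_right (Sum.inl (Sum.inl _)) (Sum.inr ())
  · exact Sym2.mem_mk_right (Sum.inl (Sum.inl _)) (Sum.inr ())
  let F : (V ⊕ L) ⊕ Unit → V' ⊕ L :=
    Sum.elim (Sum.map f id) fun _ => .inl (f (t (.inr false)))
  let R : (V ⊕ L) ⊕ Unit → (V ⊕ L) ⊕ Unit → Prop := fun x y =>
    ∃ e ∈ ({.inr (.inr false), .inr (.inr true)} : Set (E ⊕ (L ⊕ Bool))), G.ends e = s(x, y)
  have hends : ∀ b, G.ends (.inr (.inr b)) = s(.inl (.inl (t (.inr b))), .inr ()) := fun b => rfl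
  have hF : ∀ x y, R x y → F x = F y := by
    have key : ∀ b x y, G.ends (.inr (.inr b)) = s(x, y) → F x = F y := by
      intro b x y h
      have hb : f (t (.inr b)) = f (t (.inr false)) := by cases b; exacts [rfl, hfe.symm]
      rw [hends, Sym2.eq_iff] at h
      rcases h with ⟨rfl, rfl⟩ | ⟨rfl, rfl⟩
      · exact congrArg Sum.inl hb
      · exact congrArg Sum.inl hb.symm
    rintro x y ⟨_, rfl | rfl, h⟩
    exacts [key _ _ _ h, key _ _ _ h]
  have hmk : ∀ b, Quot.mk R (.inl (.inl (t (.inr b)))) = Quot.mk R (.inr ()) := fun b =>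
    Quot.sound ⟨.inr (.inr b), by cases b <;> simp, hends b⟩
  have hrep : ∀ p : Quot R, ∃ z, p = Quot.mk R (.inl z) := by
    intro p
    induction p using Quot.ind with | _ p
    rcases p with z | u
    exacts [⟨z, rfl⟩, ⟨_, (hmk true).symm⟩]
  have hbij : Function.Bijective (Quot.lift F hF) := by
    refine ⟨fun p q hpq => ?_, ?_⟩
    · obtain ⟨z, rfl⟩ := hrep p
      obtain ⟨z', rfl⟩ := hrep q
      change Sum.map f id z = Sum.map f id z' at hpq
      rcases z with a | x <;> rcases z' with a' | x' <;> simp at hpq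
      · rcases (hf a a').1 hpq with h | ⟨h, h'⟩ | ⟨h, h'⟩
        · rw [show a = a' from h]
        · rw [show a = t (.inr false) from h, ← show t (.inr true) = a' from h', hmk, hmk]
        · rw [show a = t (.inr true) from h, ← show t (.inr false) = a' from h', hmk, hmk]
      · rw [hpq]
    · rintro (a | x)
      · obtain ⟨a, rfl⟩ := hs a
        exact ⟨Quot.mk R (.inl (.inl a)), rfl⟩
      · exact ⟨Quot.mk R (.inl (.inr x)), rfl⟩
  let ψ : {e : E ⊕ (L ⊕ Bool) // e ∉ ({.inr (.inr false), .inr (.inr true)} : Set _)} ≃ E ⊕ L :=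
    { toFun := fun e => match e with
        | ⟨.inl e, _⟩ => .inl e
        | ⟨.inr (.inl x), _⟩ => .inr x
        | ⟨.inr (.inr b), h⟩ => (h (by cases b <;> simp)).elim
      invFun := Sum.elim (fun e => ⟨.inl e, by simp⟩) fun x => ⟨.inr (.inl x), by simp⟩
      left_inv := by
        rintro ⟨e | x | b, h⟩
        exacts [rfl, rfl, (h (by cases b <;> simp)).elim]
      right_inv := by rintro (e | x) <;> rfl }
  refine hC.mem_of_equiv h2 rfl (by simp) (Equiv.ofBijective _ hbij) ψ ?_ (fun i => i.elim0)
    fun i => ?_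
  · rintro ⟨e | x | b, h⟩
    · exact (Sym2.map_map ..).trans (Eq.symm ((congrArg (Sym2.map _)
        ((congrArg (Sym2.map (Quot.mk R)) (hGl e)).trans (Sym2.map_map ..))).trans
        (Sym2.map_map ..)))
    · rfl
    · exact (h (by cases b; exacts [Or.inl rfl, Or.inr rfl])).elim
  · have e1 : ∀ h, (w.map Sum.inl).get ⟨i, h⟩ = (Sum.inl (w.get ⟨i, by simpa using i.2⟩) :
      (V ⊕ L) ⊕ Unit) := fun h => by simp
    have e2 : (w.map (Sum.map f id)).get (Fin.cast (by simp) i) =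
      Sum.map f id (w.get ⟨i, by simpa using i.2⟩) := by simp
    exact (congrArg F (e1 _)).trans e2.symm

end Multigraph

/-! ### All `M` and `X` from the two generators -/

variable {C : GraphCollection}

open Multigraph

theorem M_mem_iff (hC : IsGraphCategory C) (k l : ℕ) :
    ⟨k, l, M k l⟩ ∈ C ↔ InCat C (edgeless Unit) (List.replicate (k + l) ()) := by
  have := (M k l).mem_iff_inCat hC
  have e : (List.ofFn (M k l).a).reverse ++ List.ofFn (M k l).b = List.replicate (k + l) () :=
    List.eq_replicate_iff.2 ⟨by simp, fun _ _ => rfl⟩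
  rw [e] at this
  exact this

theorem X_mem_iff (hC : IsGraphCategory C) {k l n : ℕ} (hn : k + l = n) : ⟨k, l, X k l⟩ ∈ C ↔
    InCat C (star (Fin n)) ((List.finRange n).map Sum.inr) := by
  subst hn
  let B : List (Fin (k + l)) :=
    (List.ofFn (Fin.castAdd l)).reverse ++ List.ofFn (Fin.natAdd k)
  have hB : B.Nodup := by
    refine List.Nodup.append (List.nodup_reverse.2 (List.nodup_ofFn.2 (Fin.castAdd_injective k l)))
      (List.nodup_ofFn.2 (Fin.natAdd_injective l k)) ?_
    intro x hx hx'
    rw [List.mem_reverse, List.mem_ofFn] at hx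
    rw [List.mem_ofFn] at hx'
    obtain ⟨i, rfl⟩ := hx
    obtain ⟨j, hj⟩ := hx'
    have := congrArg Fin.val hj
    simp at this
    omega
  have hm : ∀ x, x ∈ B := by
    refine Fin.addCases (fun i => ?_) fun i => ?_ <;> simp [B, List.mem_ofFn]
  have hw : (B.map Sum.inr : List (Unit ⊕ Fin (k + l))).map (Equiv.optionEquivSumPUnit _ |>.trans
      (Equiv.sumComm _ _)).symm = (List.ofFn (X k l).a).reverse ++ List.ofFn (X k l).b := by
    simp only [B, List.map_append, List.map_reverse, List.map_ofFn]
    rfl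
  have key : ∀ u : List (Unit ⊕ Fin (k + l)), (u.map (Equiv.optionEquivSumPUnit _ |>.trans
      (Equiv.sumComm _ _)).symm).map (Equiv.optionEquivSumPUnit _ |>.trans
      (Equiv.sumComm _ _)) = u := fun u => by
    rw [List.map_map, Equiv.self_comp_symm, List.map_id]
  have h1 := (X k l).mem_iff_inCat hC
  rw [h1]
  have := (X k l).finiteV
  have := (X k l).finiteE
  constructor
  · intro h
    have h2 : InCat C (star (Fin (k + l))) (B.map Sum.inr) := by
      refine h.equiv hC (Equiv.optionEquivSumPUnit _ |>.trans (Equiv.sumComm _ _))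
        (Equiv.emptySum Empty _).symm (fun e => rfl) ?_
      refine (congrArg (List.map _) hw.symm).trans ?_
      exact key _
    exact h2.star_congr hC hB (List.nodup_finRange _) hm List.mem_finRange (by simp [B])
  · intro h
    have h2 := h.star_congr hC (List.nodup_finRange _) hB List.mem_finRange hm (by simp [B])
    exact h2.equiv hC (Equiv.optionEquivSumPUnit _ |>.trans (Equiv.sumComm _ _)).symm
      (Equiv.emptySum Empty _) (by rintro (e | e); exacts [e.elim, rfl]) hw

/-- Only the total number of labels matters. Capping one of `n + 1` labels with one of the four
labels of `M 2 2` leaves `n + 3`; the induction starts from `M 0 2` and from its capping, which has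
no labels. -/
theorem M_mem_of_M_two_two (hC : IsGraphCategory C) (h : ⟨2, 2, M 2 2⟩ ∈ C) {k l : ℕ}
    (hkl : Even (k + l)) : ⟨k, l, M k l⟩ ∈ C := by
  rw [M_mem_iff hC] at h ⊢
  have h2 := (M_mem_iff hC 0 2).1 hC.dual_mem
  have h0 : InCat C (edgeless Unit) (List.replicate 0 ()) :=
    InCat.cap (x := ()) (y := ()) (w := []) hC h2 (f := id) Function.surjective_id
      (fun a b => iff_of_true rfl (Or.inl rfl)) (Equiv.refl _) (fun e => e.elim) rfl
  have hstep : ∀ n, InCat C (edgeless Unit) (List.replicate (n + 1) ()) →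
      InCat C (edgeless Unit) (List.replicate (n + 3) ()) := by
    intro n hn
    have h1 := (hn.sum hC h).rotate hC n
    rw [List.replicate_succ', List.map_append, List.append_assoc] at h1
    have e : ∀ B : List (Unit ⊕ Unit), ((List.replicate n ()).map Sum.inl ++ B).rotate n =
        B ++ (List.replicate n ()).map Sum.inl := fun B => by
      have := List.rotate_append_length_eq ((List.replicate n ()).map Sum.inl) B
      rwa [List.length_map, List.length_replicate] at this
    rw [e] at h1
    refine InCat.cap (x := Sum.inl ()) (y := Sum.inr ()) hC h1 (f := fun _ => ())
      (fun _ => ⟨Sum.inl (), rfl⟩) ?_ (Equiv.equivOfIsEmpty _ _) (by rintro (e | e) <;> cases e) ?_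
    · rintro (a | a) (b | b) <;> simp [merge_apply]
    · refine List.eq_replicate_iff.2 ⟨?_, fun _ _ => rfl⟩
      simp
  obtain ⟨m, hm⟩ := hkl
  rw [hm]
  clear hm h
  induction m with
  | zero => exact h0
  | succ m ih =>
    obtain _ | m := m
    · exact h2
    · have := hstep (m + 1 + m) (by convert ih using 2; ring)
      convert this using 2
      ring

theorem iso_edgeConnecter : Iso edgeConnecter (X 2 2) := by
  let T := edge.tensor edge
  let G := T.comp (M 2 2)
  let f₁ : G.V → Option (Fin 4) := Quot.lift
    (Sum.elim (Sum.elim (fun b : Bool => cond b (some 2) none) fun b : Bool => cond b (some 3) none)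
      fun _ => none) (by rintro _ _ ⟨i, rfl, rfl⟩; fin_cases i <;> rfl)
  let F : edgeConnecter.V → Option (Fin 4) := Quot.lift
    (Sum.elim f₁ (Sum.elim (fun b : Bool => cond b none (some 0))
      fun b : Bool => cond b none (some 1))) (by rintro _ _ ⟨i, rfl, rfl⟩; fin_cases i <;> rfl)
  let q : G.V → edgeConnecter.V := fun x => Quot.mk _ (.inl x)
  let q' : T.V → edgeConnecter.V := fun x => Quot.mk _ (.inr x)
  let p : T.V → G.V := fun x => Quot.mk _ (.inl x)
  let c : G.V := Quot.mk _ (.inr ())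
  let Y : Option (Fin 4) → edgeConnecter.V := fun o => match o with
    | none => q c
    | some 0 => q' (.inl false)
    | some 1 => q' (.inr false)
    | some 2 => q (p (.inl true))
    | some 3 => q (p (.inr true))
  have hp : ∀ i, p (T.a i) = c := fun i => Quot.sound ⟨i, rfl, rfl⟩
  have hq : ∀ i, q' (T.b i) = q c := fun i => (Quot.sound ⟨i, rfl, rfl⟩ :
    Quot.mk (GlueRel G T) (.inl (G.a i)) = _).symm
  have hYF : ∀ x, Y (F x) = x := by
    intro x
    induction x using Quot.ind with | _ x
    rcases x with x | (b | b)
    · induction x using Quot.ind with | _ x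
      rcases x with (b | b) | u
      · cases b
        exacts [congrArg q (hp 0).symm, rfl]
      · cases b
        exacts [congrArg q (hp 1).symm, rfl]
      · rfl
    · cases b
      exacts [rfl, (hq 0).symm]
    · cases b
      exacts [rfl, (hq 1).symm]
  have hFY : ∀ o, F (Y o) = o := by
    rintro (_ | i)
    · rfl
    · fin_cases i <;> rfl
  let ψ : edgeConnecter.E ≃ Fin 4 :=
    { toFun := Sum.elim (Sum.elim (Sum.elim (fun _ => 2) fun _ => 3) Empty.elim)
        (Sum.elim (fun _ => 0) fun _ => 1)
      invFun := fun i => match i with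
        | 0 => .inr (.inl ())
        | 1 => .inr (.inr ())
        | 2 => .inl (.inl (.inl ()))
        | 3 => .inl (.inl (.inr ()))
      left_inv := by
        rintro (((_ | _) | e) | (_ | _))
        exacts [rfl, rfl, e.elim, rfl, rfl]
      right_inv := by
        intro i
        fin_cases i <;> rfl }
  refine ⟨⟨F, Y, hYF, hFY⟩, ψ, ?_, ?_, ?_⟩
  · rintro (((_ | _) | e) | (_ | _))
    exacts [rfl, rfl, e.elim, Sym2.eq_swap, Sym2.eq_swap]
  · intro i
    fin_cases i <;> rfl
  · intro i
    fin_cases i <;> rfl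

/-- Fusing a star with `n + 1` leaves and one with four leaves gives `n + 3` leaves. The star with
two leaves comes from joining two leaves of the same star with four leaves, and the star without
leaves is `M 0 0`. -/
theorem X_mem_of_edgeConnecter (hC : IsGraphCategory C) (hP : IsTwoPathClosed C)
    (hM : ⟨0, 0, M 0 0⟩ ∈ C) (h : ⟨2, 2, edgeConnecter⟩ ∈ C) {k l : ℕ} (hkl : Even (k + l)) :
    ⟨k, l, X k l⟩ ∈ C := by
  have h4 := (X_mem_iff hC rfl).1 (hC.iso_mem iso_edgeConnecter h)
  have hstar : ∀ {L : Type} [Finite L] {B : List L} {n : ℕ},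
      InCat C (star (Fin n)) ((List.finRange n).map Sum.inr) → B.Nodup → (∀ x, x ∈ B) →
      B.length = n → InCat C (star L) (B.map Sum.inr) := fun hn hB hm hl =>
    hn.star_congr hC (List.nodup_finRange _) hB List.mem_finRange hm (by simp [hl])
  have hstar' : ∀ {L : Type} [Finite L] {B : List L} {n : ℕ},
      InCat C (star L) (B.map Sum.inr) → B.Nodup → (∀ x, x ∈ B) → B.length = n →
      InCat C (star (Fin n)) ((List.finRange n).map Sum.inr) := fun hn hB hm hl =>
    hn.star_congr hC hB (List.nodup_finRange _) hm List.mem_finRange (by simp [hl])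
  have h0 : InCat C (star (Fin 0)) ((List.finRange 0).map Sum.inr) :=
    ((M_mem_iff hC 0 0).1 hM).equiv hC (Equiv.sumEmpty Unit (Fin 0)).symm
      (Equiv.equivOfIsEmpty _ _) (fun e => e.elim) rfl
  have h2 : InCat C (star (Fin 2)) ((List.finRange 2).map Sum.inr) := by
    have h1 : InCat C (star (Fin 2 ⊕ Bool))
        ([.inr false, .inr true, .inl 0, .inl 1].map Sum.inr) :=
      hstar h4 (by decide) (by rintro (x | x); exacts [by fin_cases x <;> simp, by cases x <;> simp]) rfl
    have h3 := InCat.star_append (w := [.inr 0, .inr 1]) hC hP h1 (f := id)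
      Function.surjective_id fun a b => iff_of_true rfl (Or.inl rfl)
    exact h3.equiv hC (Equiv.refl _) (Equiv.refl _)
      (by rintro (e | e); exacts [e.elim, rfl]) rfl
  have hstep : ∀ n, InCat C (star (Fin (n + 1))) ((List.finRange (n + 1)).map Sum.inr) →
      InCat C (star (Fin (n + 3))) ((List.finRange (n + 3)).map Sum.inr) := by
    intro n hn
    let B₁ : List (Option (Fin n)) := (List.finRange n).map some
    let B₂ : List (Option (Fin 3)) := (List.finRange 3).map some
    have hB₁ : B₁.Nodup := (List.nodup_finRange n).map (Option.some_injective _)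
    have h1 : InCat C (star (Option (Fin n))) ((B₁ ++ [none]).map Sum.inr) :=
      hstar hn (List.Nodup.append hB₁ (by simp) (by simp [B₁]))
        (by rintro (_ | x) <;> simp [B₁]) (by simp [B₁])
    have h1' : InCat C (star (Option (Fin 3))) ((none :: B₂).map Sum.inr) :=
      hstar h4 (by decide) (by decide) rfl
    have h3 := (h1.leaf_sum hC h1').rotate hC n
    let χ : Option (Fin n) ⊕ Option (Fin 3) ≃ (Fin n ⊕ Fin 3) ⊕ Bool :=
      { toFun := Sum.elim (fun o => o.elim (.inr false) fun x => .inl (.inl x))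
          fun o => o.elim (.inr true) fun x => .inl (.inr x)
        invFun := Sum.elim (Sum.map some some) fun b => if b then .inr none else .inl none
        left_inv := by rintro ((_ | x) | (_ | x)) <;> rfl
        right_inv := by rintro ((x | x) | (_ | _)) <;> rfl }
    let w : List ((Unit ⊕ Unit) ⊕ (Fin n ⊕ Fin 3)) :=
      ((List.finRange 3).map fun x => .inr (.inr x)) ++ (List.finRange n).map fun x => .inr (.inl x)
    have h5 : InCat C ((edgeless (Unit ⊕ Unit)).leaf
        (Sum.map (fun _ => ()) (fun _ => ()) ∘ χ.symm))
        (.inr (.inr false) :: .inr (.inr true) :: w.map (Sum.map id Sum.inl)) := by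
      refine h3.leaf_equiv hC (Equiv.refl _) (Equiv.equivOfIsEmpty _ _) χ
        (by rintro (e | e) <;> cases e) (fun x => by simp) ?_
      have e : ∀ B : List ((Unit ⊕ Unit) ⊕ (Option (Fin n) ⊕ Option (Fin 3))),
          ((B₁.map Sum.inr).map (Sum.map Sum.inl Sum.inl) ++ B).rotate n =
            B ++ (B₁.map Sum.inr).map (Sum.map Sum.inl Sum.inl) := fun B => by
        have := List.rotate_append_length_eq ((B₁.map Sum.inr).map (Sum.map Sum.inl Sum.inl)) B
        rwa [List.length_map, List.length_map, List.length_map, List.length_finRange] at this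
      rw [List.map_append, List.map_append, List.append_assoc, e]
      simp only [B₁, B₂, w, List.map_append, List.map_map]
      rfl
    have h6 := InCat.star_append hC hP h5 (f := fun _ => ()) (fun _ => ⟨.inl (), rfl⟩)
      (by rintro (a | a) (b | b) <;> simp [merge_apply, χ])
    have h7 : InCat C (star (Fin n ⊕ Fin 3)) (((List.finRange 3).map Sum.inr ++
        (List.finRange n).map Sum.inl).map Sum.inr) := by
      refine h6.equiv hC (Equiv.refl _) (Equiv.refl _)
        (by rintro (e | e); exacts [e.elim, rfl]) ?_
      simp only [w, List.map_append, List.map_map]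
      rfl
    refine hstar' h7 ?_ ?_ (by simp; omega)
    · refine List.Nodup.append ((List.nodup_finRange 3).map Sum.inr_injective)
        ((List.nodup_finRange n).map Sum.inl_injective) ?_
      simp [List.Disjoint]
    · rintro (x | x) <;> simp
  obtain ⟨m, hm⟩ := hkl
  rw [X_mem_iff hC hm]
  clear hm h
  induction m with
  | zero => exact h0
  | succ m ih =>
    obtain _ | m := m
    · exact h2
    · have := hstep (m + 1 + m) (hstar' (n := m + 1 + m + 1) ih (List.nodup_finRange _)
        List.mem_finRange (by simp; omega))
      exact hstar' this (List.nodup_finRange _) List.mem_finRange (by simp; omega)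

/-! ### Noncrossing partitions -/

namespace Hypermap

theorem apply_mem_iff {D : Type*} [Finite D] {σ : Perm D} {S : Set D} (h : ∀ x ∈ S, σ x ∈ S)
    (x : D) : σ x ∈ S ↔ x ∈ S := by
  refine ⟨fun hx => ?_, h x⟩
  obtain ⟨n, -, hn⟩ := (sameCycle_apply σ x).symm.exists_pow_eq'
  rw [← hn]
  clear hn
  induction n with
  | zero => exact hx
  | succ n ih =>
    rw [pow_succ', Perm.mul_apply]
    exact h _ ih

/-- Two complementary noncrossing partitions of a cycle: some class of the first one is an
interval, with last element `i`. -/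
theorem exists_interval {D : Type*} [Finite D] [Nonempty D] {σ c : Perm D}
    (hc : ∀ x y, c.SameCycle x y) (h : defect σ c = 0) :
    ∃ i, ∀ j, σ.SameCycle i j → j ≠ i → σ.SameCycle i (c j) := by
  classical
  have hone : ∀ r : Setoid D, (∀ x y, r x y) → Nat.card (Quotient r) = 1 := by
    intro r hr
    have : Subsingleton (Quotient r) := ⟨fun p q => by
      induction p using Quotient.inductionOn
      induction q using Quotient.inductionOn
      exact Quotient.sound (hr _ _)⟩
    have : Nonempty (Quotient r) := ‹Nonempty D›.map (Quotient.mk r)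
    exact Nat.card_unique
  have h1 : cyc c = 1 := hone _ hc
  have h2 : comps σ c = 1 := hone _ fun x y => conn_of_sameCycle_right σ (hc x y)
  -- Genus zero means that `σ` and `σ * c` have `|D| + 1` cycles in total. If no class is an
  -- interval, every cycle of `σ` contains two points moved by `σ * c`, while every nontrivial cycle
  -- of `σ * c` has at least two points. Together this allows at most `|D|` cycles.
  by_contra! hcon
  let β := σ * c
  have key : ∀ i, ∃ j, σ.SameCycle i j ∧ j ≠ i ∧ β j ≠ j := by
    intro i
    obtain ⟨j, hj, hji, hjc⟩ := hcon i
    refine ⟨j, hj, hji, fun hb => hjc (hj.trans ?_)⟩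
    have : σ (c j) = j := hb
    have h' := sameCycle_apply σ (c j)
    rw [this] at h'
    exact h'.symm
  choose u hu hui huβ using key
  let F : Quotient (Perm.SameCycle.setoid σ) × Bool → {x // β x ≠ x} :=
    fun p => cond p.2 ⟨u (u p.1.out), huβ _⟩ ⟨u p.1.out, huβ _⟩
  have hF : Function.Injective F := by
    have hq : ∀ p, Quotient.mk (Perm.SameCycle.setoid σ) (F p).1 = p.1 := by
      rintro ⟨q, b⟩
      conv_rhs => rw [← Quotient.out_eq q]
      cases b
      · exact Quotient.sound (hu _).symm
      · exact Quotient.sound ((hu _).trans (hu _)).symm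
    rintro ⟨q, b⟩ ⟨q', b'⟩ hp
    have e : q = q' := by
      have := hq (q, b)
      rw [hp, hq] at this
      exact this.symm
    subst e
    cases b <;> cases b' <;> simp [F] at hp ⊢
    · exact hui _ hp.symm
    · exact hui _ hp
  -- Two elements for each cycle of `β`: a representative and its image, or, for a fixed point, its
  -- copies in both summands.
  let G : Quotient (Perm.SameCycle.setoid β) × Bool → D ⊕ {x // β x = x} := fun p =>
    cond p.2 (if h : β p.1.out = p.1.out then .inr ⟨_, h⟩ else .inl (β p.1.out)) (.inl p.1.out)
  have hG : Function.Injective G := by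
    have hq : ∀ p, Quotient.mk (Perm.SameCycle.setoid β) ((G p).elim id Subtype.val) = p.1 := by
      rintro ⟨q, b⟩
      conv_rhs => rw [← Quotient.out_eq q]
      cases b
      · rfl
      · simp only [G, cond]
        split_ifs
        · rfl
        · exact Quotient.sound (sameCycle_apply β _).symm
    rintro ⟨q, b⟩ ⟨q', b'⟩ hp
    have e : q = q' := by
      have := hq (q, b)
      rw [hp, hq] at this
      exact this.symm
    subst e
    cases b <;> cases b' <;> simp only [G, cond, Prod.mk.injEq, true_and, reduceCtorEq] at hp ⊢
    · split_ifs at hp with h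
      exact h (Sum.inl_injective hp).symm
    · split_ifs at hp with h
      exact h (Sum.inl_injective hp)
  have e1 := Nat.card_le_card_of_injective F hF
  have e2 := Nat.card_le_card_of_injective G hG
  have e3 : Nat.card D = Nat.card {x // β x = x} + Nat.card {x // β x ≠ x} := by
    rw [← Nat.card_sum]
    exact Nat.card_congr (Equiv.sumCompl _).symm
  have e4 : Nat.card (Quotient (Perm.SameCycle.setoid σ)) = cyc σ := rfl
  have e5 : Nat.card (Quotient (Perm.SameCycle.setoid β)) = cyc (σ * c) := rfl
  have e6 : Nat.card Bool = 2 := by simp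
  rw [Nat.card_prod, e4, e6] at e1
  rw [Nat.card_prod, e5, e6, Nat.card_sum] at e2
  rw [defect, h1, h2] at h
  push_cast at h
  omega

end Hypermap

theorem List.exists_append_replicate {α : Type*} {v : α} {A : List α}
    (h : A.IsChain fun a b => a = v → b = v) :
    ∃ (l : List α) (m : ℕ), A = l ++ List.replicate m v ∧ v ∉ l := by
  induction A with
  | nil => exact ⟨[], 0, rfl, by simp⟩
  | cons a A ih =>
    obtain ⟨l, m, rfl, hl⟩ := ih h.tail
    by_cases ha : a = v
    · rcases l with _ | ⟨b, l⟩
      · exact ⟨[], m + 1, by simp [List.replicate_succ, ha], by simp⟩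
      · simp only [List.cons_append, List.isChain_cons_cons] at h
        exact absurd (List.mem_cons.2 (Or.inl (h.1 ha).symm)) hl
    · exact ⟨a :: l, m, rfl, by simp [hl, Ne.symm ha]⟩

/-! ### Edgeless drawings, and cutting an edge -/

namespace Multigraph

variable {V E V' E' : Type} {g : Multigraph V E} {w : List V} {c : List Bool}

/-- Without edges, the vertices give a noncrossing partition of the label positions, and one of its
blocks is an interval. For the empty word any vertex will do, with an empty block. -/
theorem IsPlane.exists_block [IsEmpty E] [Nonempty V] (h : g.IsPlane w) :
    ∃ (v : V) (n m : ℕ) (l : List V), w.rotate n = List.replicate m v ++ l ∧ v ∉ l := by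
  rcases eq_or_ne w [] with rfl | hw
  · exact ⟨Classical.arbitrary V, 0, 0, [], rfl, by simp⟩
  obtain ⟨Δ⟩ := h
  let _ := Δ.dec
  have := Δ.fin
  obtain ⟨n, hn⟩ : ∃ n, w.length = n := ⟨_, rfl⟩
  have hnW : Δ.W.length = n := by
    rw [← hn, ← List.length_map Δ.vert, Δ.word]
  have hpos : 0 < n := by rw [← hn]; exact List.length_pos_iff.2 hw
  have : Nonempty (Fin n) := ⟨⟨0, hpos⟩⟩
  have hd : ∀ x, x ∉ Set.range Δ.dart := fun x => by rintro ⟨p, -⟩; exact isEmptyElim p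
  let t : Fin n → Δ.D := fun i => Δ.W[(i : ℕ)]'(hnW ▸ i.2)
  have ht : Function.Injective t := fun i j hij =>
    Fin.ext ((List.Nodup.getElem_inj_iff Δ.nodup).1 hij)
  have htW : ∀ x, x ∈ Set.range t ↔ x ∈ Δ.W := by
    intro x
    constructor
    · rintro ⟨i, rfl⟩
      exact List.getElem_mem _
    · intro hx
      obtain ⟨i, hi, rfl⟩ := List.getElem_of_mem hx
      exact ⟨⟨i, hnW ▸ hi⟩, rfl⟩
  have hto : ∀ i, t (finRotate n i) = Δ.opp (t i) := fun i => by
    rw [Δ.opp_of_notMem _ (hd _)]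
    exact (formPerm_getElem_finRotate Δ.nodup hnW i).symm
  have hr : ∀ x ∉ Set.range t, Δ.rot x = x := fun x hx => by
    rw [htW] at hx
    exact Δ.rot_fix x (hd x) hx
  obtain ⟨σ, hσ⟩ := exists_perm_of_injective ht (σ := Δ.rot) fun d => by
    by_contra hd
    exact hd ⟨d, (Δ.rot.injective (hr _ hd)).symm⟩
  have hdef : defect σ (finRotate n) = 0 := by
    rw [← defect_of_injective ht hσ hto hr fun x hx => ?_, Δ.planar]
    rw [Δ.opp_of_notMem _ (hd _), List.formPerm_apply_of_notMem (by rwa [← htW])]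
  have hv : ∀ i : Fin n, Δ.vert (t i) = w[(i : ℕ)]'(hn ▸ i.2) := fun i => by
    simp [t, ← Δ.word]
  have hsc : ∀ i j, σ.SameCycle i j ↔ w[(i : ℕ)]'(hn ▸ i.2) = w[(j : ℕ)]'(hn ▸ j.2) := by
    intro i j
    rw [sameCycle_of_injective ht hσ, Δ.sameCycle _ _ (Or.inr ((htW _).1 ⟨i, rfl⟩))
      (Or.inr ((htW _).1 ⟨j, rfl⟩)), hv, hv]
  obtain ⟨i, hi⟩ := exists_interval (fun x y => sameCycle_finRotate x y) hdef
  -- Position `i` is moved to the end of the word. Every earlier occurrence of its vertex is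
  -- followed by another one, so the occurrences fill a final segment.
  have hchain : (w.rotate (i + 1)).IsChain fun a b =>
      a = w[(i : ℕ)]'(hn ▸ i.2) → b = w[(i : ℕ)]'(hn ▸ i.2) := by
    rw [List.isChain_iff_getElem]
    intro k hk hkv
    rw [List.length_rotate, hn] at hk
    rw [List.getElem_rotate] at hkv ⊢
    simp only [hn] at hkv ⊢
    let j : Fin n := ⟨(k + (i + 1)) % n, Nat.mod_lt _ hpos⟩
    have hj : ((finRotate n j : Fin n) : ℕ) = (k + 1 + (i + 1)) % n := by
      rw [val_finRotate]
      simp only [j, Nat.mod_add_mod]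
      congr 1
      ring
    have hji : j ≠ i := by
      intro hji
      have h1 : (k + (i + 1)) % n = i := congrArg Fin.val hji
      have h2 := i.2
      rcases lt_or_ge (k + (i + 1)) n with h3 | h3
      · rw [Nat.mod_eq_of_lt h3] at h1
        omega
      · rw [Nat.mod_eq_sub_mod h3, Nat.mod_eq_of_lt (by omega)] at h1
        omega
    have := (hsc _ _).1 (hi j ((hsc _ _).2 hkv.symm) hji)
    simp only [hj] at this
    exact this.symm
  obtain ⟨l, m, h1, h2⟩ := List.exists_append_replicate hchain
  refine ⟨_, i + 1 + l.length, m, l, ?_, h2⟩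
  rw [← List.rotate_rotate, h1, List.rotate_append_length_eq]

/-- Forget labels and vertices of a graph without edges. -/
theorem IsPlane.of_append [IsEmpty E] [IsEmpty E'] {f : V' → V} (hf : Function.Injective f)
    {l : List V} {w' : List V'} (h : g.IsPlane (l ++ w'.map f)) (g' : Multigraph V' E') :
    g'.IsPlane w' := by
  rcases isEmpty_or_nonempty V' with hV | hV
  · exact .of_edgeless fun x => isEmptyElim x
  obtain ⟨Δ⟩ := h
  let _ := Δ.dec
  have := Δ.fin
  have hd : ∀ x, x ∉ Set.range Δ.dart := fun x => by rintro ⟨p, -⟩; exact isEmptyElim p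
  obtain ⟨A, B, hW, hA, hB⟩ := List.map_eq_append_iff.1 Δ.word
  have hBf : ∀ x ∈ B, ∃ y, f y = Δ.vert x := by
    intro x hx
    have : Δ.vert x ∈ w'.map f :=
      (congrArg (Δ.vert x ∈ ·) hB).mp (List.mem_map_of_mem hx)
    obtain ⟨y, -, hy⟩ := List.mem_map.1 this
    exact ⟨y, hy⟩
  have hnd : (A ++ B).Nodup := hW ▸ Δ.nodup
  have hopp : Δ.opp = (A ++ B).formPerm := by
    ext x
    rw [Δ.opp_of_notMem x (hd x), hW]
  have hdisj := List.disjoint_of_nodup_append hnd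
  exact ⟨{
    D := Δ.D
    dart := isEmptyElim
    dart_inj := fun p => isEmptyElim p
    W := B
    nodup := hnd.of_append_right
    dart_notMem := fun p => isEmptyElim p
    vert := Function.invFun f ∘ Δ.vert
    ends_eq := fun e => isEmptyElim e
    word := by
      rw [← List.map_map, hB, List.map_map, Function.invFun_comp hf, List.map_id]
    rot := eraseList Δ.rot A
    opp := B.formPerm
    rot_fix := fun x _ hx => by
      by_cases hxA : x ∈ A
      · exact eraseList_of_mem hxA
      · have h1 := Δ.rot_fix x (hd x) (by rw [hW, List.mem_append]; tauto)
        rw [eraseList_of_notMem hxA (by rwa [h1]), h1]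
    sameCycle := fun x y hx hy => by
      replace hx := hx.resolve_left fun ⟨p, _⟩ => isEmptyElim p
      replace hy := hy.resolve_left fun ⟨p, _⟩ => isEmptyElim p
      rw [sameCycle_eraseList, Δ.sameCycle x y (Or.inr (by simp [hW, hx]))
        (Or.inr (by simp [hW, hy]))]
      obtain ⟨a, ha⟩ := hBf x hx
      obtain ⟨b, hb⟩ := hBf y hy
      rw [Function.comp, Function.comp, ← ha, ← hb, Function.leftInverse_invFun hf,
        Function.leftInverse_invFun hf, hf.eq_iff]
      refine ⟨?_, fun h => Or.inr ⟨fun k => hdisj k hx, fun k => hdisj k hy, h⟩⟩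
      rintro (rfl | h)
      exacts [hf (ha.trans hb.symm), h.2.2]
    opp_dart := fun e => isEmptyElim e
    opp_of_notMem := fun x _ => rfl
    planar := by
      have := defect_eraseList Δ.planar A A
      rwa [hopp, eraseList_formPerm_append hnd] at this }⟩

/-- Remove an edge. -/
def delete (g : Multigraph V E) (e₀ : E) : Multigraph V {e // e ≠ e₀} := ⟨fun e => g.ends e.1⟩

/-- The two darts of the removed edge are kept as label positions at their vertices. The rotation
does not change; only `opp` is replaced, by `τ`. -/
theorem Diagram.cut (Δ : Diagram g w) {W : List Δ.D} {e₀ : E} {b : Bool}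
    (hW : ∀ x, x ∈ W ↔ x ∈ Δ.W)
    (hn : (Δ.dart (e₀, b) :: Δ.dart (e₀, !b) :: W).Nodup) {τ : Perm Δ.D}
    (hτ : ∀ e b, e ≠ e₀ → τ (Δ.dart (e, b)) = Δ.dart (e, !b))
    (hτ' : haveI := Δ.dec; ∀ x, (∀ e b, e ≠ e₀ → x ≠ Δ.dart (e, b)) →
      τ x = (Δ.dart (e₀, b) :: Δ.dart (e₀, !b) :: W).formPerm x)
    (h : defect Δ.rot τ = 0) : (g.delete e₀).IsPlane
      (Δ.vert (Δ.dart (e₀, b)) :: Δ.vert (Δ.dart (e₀, !b)) :: W.map Δ.vert) := by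
  let _ := Δ.dec
  have := Δ.fin
  have hmem : ∀ x, (x ∈ Set.range (fun p : {e // e ≠ e₀} × Bool => Δ.dart (p.1.1, p.2)) ∨
      x ∈ Δ.dart (e₀, b) :: Δ.dart (e₀, !b) :: W) ↔ (x ∈ Set.range Δ.dart ∨ x ∈ Δ.W) := by
    intro x
    simp only [List.mem_cons, hW]
    constructor
    · rintro (⟨p, rfl⟩ | rfl | rfl | h)
      exacts [Or.inl ⟨_, rfl⟩, Or.inl ⟨_, rfl⟩, Or.inl ⟨_, rfl⟩, Or.inr h]
    · rintro (⟨⟨e, a⟩, rfl⟩ | h)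
      · by_cases he : e = e₀
        · subst he
          right
          by_cases hab : a = b
          · exact Or.inl (by rw [hab])
          · exact Or.inr (Or.inl (by rw [Bool.eq_not_of_ne hab]))
        · exact Or.inl ⟨(⟨e, he⟩, a), rfl⟩
      · exact Or.inr (Or.inr (Or.inr h))
  exact ⟨{
    D := Δ.D
    dart := fun p => Δ.dart (p.1.1, p.2)
    dart_inj := fun p q hpq => by
      have := Δ.dart_inj hpq
      simp only [Prod.mk.injEq] at this
      exact Prod.ext (Subtype.ext this.1) this.2
    W := Δ.dart (e₀, b) :: Δ.dart (e₀, !b) :: W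
    nodup := hn
    dart_notMem := fun p => by
      simp only [List.mem_cons, hW, Δ.dart_notMem, or_false, Δ.dart_inj.eq_iff, Prod.mk.injEq,
        p.1.2, false_and, not_false_eq_true]
    vert := Δ.vert
    ends_eq := fun e => Δ.ends_eq e.1
    word := rfl
    rot := Δ.rot
    opp := τ
    rot_fix := fun x hx hx' => by
      have := mt (hmem x).2 (by tauto)
      exact Δ.rot_fix x (by tauto) (by tauto)
    sameCycle := fun x y hx hy => Δ.sameCycle x y ((hmem x).1 hx) ((hmem y).1 hy)
    opp_dart := fun e b => hτ e.1 b e.2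
    opp_of_notMem := fun x hx => hτ' x fun e b he h => hx ⟨(⟨e, he⟩, b), h.symm⟩
    planar := h }⟩

theorem Diagram.opp_mem_range (Δ : Diagram g w) (x : Δ.D) :
    Δ.opp x ∈ Set.range Δ.dart ↔ x ∈ Set.range Δ.dart := by
  by_cases hx : x ∈ Set.range Δ.dart
  · obtain ⟨⟨e, b⟩, rfl⟩ := hx
    rw [Δ.opp_dart]
    exact iff_of_true ⟨_, rfl⟩ ⟨_, rfl⟩
  · rw [Δ.opp_of_notMem x hx]
    exact Δ.formPerm_mem_range x

/-- An edge next to a label, or in another component, can be cut and its ends become labels. -/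
theorem IsPlane.cut [Nonempty E] (h : g.IsPlane w) : ∃ (e₀ : E) (x y : V) (n : ℕ),
    g.ends e₀ = s(x, y) ∧ (g.delete e₀).IsPlane (x :: y :: w.rotate n) := by
  obtain ⟨Δ⟩ := h
  let _ := Δ.dec
  have := Δ.fin
  have hends : ∀ e b, g.ends e = s(Δ.vert (Δ.dart (e, b)), Δ.vert (Δ.dart (e, !b))) := by
    intro e b
    rw [Δ.ends_eq]
    cases b
    exacts [rfl, Sym2.eq_swap]
  have hne : ∀ e b, Δ.dart (e, b) ≠ Δ.dart (e, !b) := fun e b h => by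
    simpa using congrArg Prod.snd (Δ.dart_inj h)
  -- Without labels, the two-cycle formed by the darts of any edge can serve as the boundary.
  by_cases hW : Δ.W = []
  · obtain ⟨e₀⟩ := ‹Nonempty E›
    have hw : w = [] := by rw [← Δ.word, hW]; rfl
    subst hw
    refine ⟨e₀, _, _, 0, hends e₀ false, ?_⟩
    refine Δ.cut (W := []) (τ := Δ.opp) (by simp [hW]) (by simpa using hne e₀ false)
      (fun e b _ => Δ.opp_dart e b) (fun x hx => ?_) Δ.planar
    rw [List.formPerm_pair]
    by_cases hx' : x ∈ Set.range Δ.dart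
    · obtain ⟨⟨e, b⟩, rfl⟩ := hx'
      obtain rfl : e = e₀ := by
        by_contra he
        exact hx e b he rfl
      rw [Δ.opp_dart]
      cases b
      exacts [(swap_apply_left _ _).symm, (swap_apply_right _ _).symm]
    · rw [Δ.opp_of_notMem x hx', hW, List.formPerm_nil, Perm.one_apply, swap_apply_of_ne_of_ne]
      · rintro rfl
        exact hx' ⟨_, rfl⟩
      · rintro rfl
        exact hx' ⟨_, rfl⟩
  -- Either some dart directly precedes a label around a vertex, and then its partner lies on the
  -- same face as that label; or the labels are in components without darts. In both cases the join
  -- below preserves the genus.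
  have key : ∃ x₀ ∈ Δ.W, ∃ e₀ b, (Δ.rot * Δ.opp).SameCycle x₀ (Δ.dart (e₀, !b)) ∨
      ¬ conn Δ.rot Δ.opp x₀ (Δ.dart (e₀, !b)) := by
    by_cases hc : ∃ x₀ ∈ Δ.W, ∃ e₀ b, Δ.rot (Δ.dart (e₀, b)) = x₀
    · obtain ⟨x₀, hx₀, e₀, b, h⟩ := hc
      refine ⟨x₀, hx₀, e₀, b, Or.inl ?_⟩
      have := sameCycle_apply (Δ.rot * Δ.opp) (Δ.dart (e₀, !b))
      rw [Perm.mul_apply, Δ.opp_dart, Bool.not_not, h] at this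
      exact this.symm
    · push Not at hc
      obtain ⟨x₀, hx₀⟩ := List.exists_mem_of_ne_nil _ hW
      obtain ⟨e₀⟩ := ‹Nonempty E›
      refine ⟨x₀, hx₀, e₀, false, Or.inr fun h => ?_⟩
      have hr : ∀ x, Δ.rot x ∈ Set.range Δ.dart ↔ x ∈ Set.range Δ.dart := by
        refine apply_mem_iff ?_
        rintro _ ⟨⟨e, b⟩, rfl⟩
        by_contra hd
        have h1 := Δ.rot_fix _ hd fun hm => hc _ hm e b rfl
        exact hd ⟨_, (Δ.rot.injective h1).symm⟩
      have := conn_le (s := Setoid.comap (· ∈ Set.range Δ.dart) ⊥)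
        (fun x => propext (hr x).symm) (fun x => propext (Δ.opp_mem_range x).symm) h
      have h2 : x₀ ∈ Set.range Δ.dart := (iff_of_eq this).2 ⟨_, rfl⟩
      obtain ⟨p, rfl⟩ := h2
      exact Δ.dart_notMem p hx₀
  obtain ⟨x₀, hx₀, e₀, b, hb⟩ := key
  obtain ⟨A, B, hAB⟩ := List.append_of_mem hx₀
  have hnW := Δ.nodup
  rw [hAB] at hnW
  have hrot : Δ.W.rotate A.length = x₀ :: (B ++ A) := by
    rw [hAB, List.rotate_append_length_eq, List.cons_append]
  have hrot' : Δ.W.rotate (A.length + 1) = B ++ A ++ [x₀] := by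
    rw [← List.rotate_rotate, hrot, List.rotate_cons_succ, List.rotate_zero]
  have hmem : ∀ x, x ∈ B ++ A ++ [x₀] ↔ x ∈ Δ.W := fun x => by rw [← hrot', List.mem_rotate]
  have hfp : Δ.W.formPerm = (x₀ :: (B ++ A)).formPerm := by
    rw [← hrot, List.formPerm_rotate _ Δ.nodup]
  have hnd : (x₀ :: (B ++ A)).Nodup := hrot ▸ List.nodup_rotate.2 Δ.nodup
  have hdW : ∀ p, Δ.dart p ∉ x₀ :: (B ++ A) := fun p => by
    rw [← hrot, List.mem_rotate]
    exact Δ.dart_notMem p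
  have hdx : ∀ p, Δ.dart p ≠ x₀ := fun p h => hdW p (by simp [h])
  have hdW' : ∀ p, Δ.dart p ∉ B ++ A := fun p h => hdW p (List.mem_cons_of_mem _ h)
  set f := Δ.dart (e₀, b) with hf
  set d := Δ.dart (e₀, !b) with hd
  have hnd1 : (x₀ :: d :: (B ++ A)).Nodup := by
    rw [List.nodup_cons, List.mem_cons, not_or, List.nodup_cons]
    exact ⟨⟨(hdx _).symm, (List.nodup_cons.1 hnd).1⟩, hdW' _, (List.nodup_cons.1 hnd).2⟩
  have hnd2 : (x₀ :: f :: d :: (B ++ A)).Nodup := by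
    have h1 := List.nodup_cons.1 hnd1
    refine List.nodup_cons.2 ⟨?_, List.nodup_cons.2 ⟨?_, h1.2⟩⟩
    · exact fun h => (List.mem_cons.1 h).elim (hdx _).symm h1.1
    · exact fun h => (List.mem_cons.1 h).elim (hne e₀ b) (hdW' _)
  have hrot2 : (x₀ :: f :: d :: (B ++ A)).rotate 1 = f :: d :: (B ++ A ++ [x₀]) := by
    simp
  refine ⟨e₀, Δ.vert f, Δ.vert d, A.length + 1, hends e₀ b, ?_⟩
  have hw : w.rotate (A.length + 1) = (B ++ A ++ [x₀]).map Δ.vert := by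
    rw [← hrot', List.map_rotate, Δ.word]
  rw [hw]
  -- The transposition inserts the two darts of the edge into the boundary cycle immediately after
  -- `x₀`.
  refine Δ.cut (b := b) (W := B ++ A ++ [x₀]) (τ := Δ.opp * swap x₀ d) hmem ?_ ?_ ?_ ?_
  · rw [← hf, ← hd, ← hrot2]
    exact List.nodup_rotate.2 hnd2
  · intro e a he
    rw [Perm.mul_apply, swap_apply_of_ne_of_ne (hdx _), Δ.opp_dart]
    intro h
    exact he (congrArg Prod.fst (Δ.dart_inj h))
  · intro x hx
    rw [← hf, ← hd, ← hrot2, List.formPerm_rotate _ hnd2, formPerm_insert hnd2,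
      formPerm_insert hnd1, Perm.mul_apply, Perm.mul_apply, Perm.mul_apply]
    by_cases h1 : x = f
    · subst h1
      rw [swap_apply_right, swap_apply_left, List.formPerm_apply_of_notMem (hdW _),
        swap_apply_of_ne_of_ne (hdx _) (hne e₀ b), Δ.opp_dart]
    by_cases h2 : x = x₀
    · subst h2
      rw [swap_apply_left, swap_apply_left, swap_apply_of_ne_of_ne (hdx _) (hne e₀ b),
        List.formPerm_apply_of_notMem (hdW _), Δ.opp_dart, Bool.not_not]
    rw [swap_apply_of_ne_of_ne h2 h1]
    have h4 : ∀ y, y ∉ Set.range Δ.dart → Δ.opp y = (x₀ :: (B ++ A)).formPerm y := fun y hy => by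
      rw [Δ.opp_of_notMem y hy, hfp]
    by_cases h3 : x = d
    · subst h3
      rw [swap_apply_right]
      exact h4 _ fun ⟨p, hp⟩ => hdx p hp
    · rw [swap_apply_of_ne_of_ne h2 h3]
      refine h4 _ ?_
      rintro ⟨⟨e, a⟩, rfl⟩
      by_cases he : e = e₀
      · subst he
        by_cases hab : a = b
        · exact h1 (by rw [hab])
        · exact h3 (by rw [Bool.eq_not_of_ne hab])
      · exact hx e a he rfl
  · rw [defect_mul_swap (fun h => ?_) hb, Δ.planar]
    have := sameCycle_le (s := Setoid.comap (· ∈ Set.range Δ.dart) ⊥)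
      (fun x => propext (Δ.opp_mem_range x).symm) h
    obtain ⟨p, hp⟩ : x₀ ∈ Set.range Δ.dart := (iff_of_eq this).2 ⟨_, rfl⟩
    exact hdx p hp

/-- Two darts become two labels at the same vertices, so all parities persist; the new labels have
opposite colours as ends of an edge. -/
theorem IsTame.cut [Finite E] [Nonempty E] (h : g.IsTame w c) :
    ∃ (e₀ : E) (x y : V) (b : Bool) (n : ℕ), g.ends e₀ = s(x, y) ∧
      (g.delete e₀).IsTame (x :: y :: w.rotate n) (b :: (!b) :: c.rotate n) := by
  classical
  obtain ⟨hp, s, hs, he, part, h1, h2⟩ := h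
  obtain ⟨e₀, x, y, n, hxy, hp'⟩ := hp.cut
  have hxy' := hs e₀
  rw [hxy] at hxy'
  refine ⟨e₀, x, y, part x, n, hxy, hp', fun p => s (p.1.1, p.2), fun e => hs e.1, fun P => ?_,
    part, fun e => h1 e.1, ?_⟩
  · have e1 : {d : E × Bool // P (s d)} ≃ {d : {e // e ≠ e₀} × Bool // P (s (d.1.1, d.2))} ⊕
        {b : Bool // P (s (e₀, b))} :=
      { toFun := fun d => if h : d.1.1 = e₀ then .inr ⟨d.1.2, by rw [← h]; exact d.2⟩
          else .inl ⟨(⟨d.1.1, h⟩, d.1.2), d.2⟩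
        invFun := Sum.elim (fun d => ⟨(d.1.1.1, d.1.2), d.2⟩) fun b => ⟨(e₀, b.1), b.2⟩
        left_inv := by
          rintro ⟨⟨e, a⟩, h⟩
          by_cases he : e = e₀
          · subst he
            simp
          · simp [he]
        right_inv := by
          rintro (⟨⟨⟨e, he⟩, a⟩, h⟩ | ⟨a, h⟩)
          · simp [he]
          · simp }
    have e2 : Nat.card {b : Bool // P (s (e₀, b))} = [x, y].countP P := by
      have e3 : Nat.card {b : Bool // P (s (e₀, b))} =
          [s (e₀, false), s (e₀, true)].countP P := by
        rw [Nat.card_eq_fintype_card, Fintype.card_subtype]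
        simp only [Fintype.univ_bool, List.countP_cons, List.countP_nil]
        rw [Finset.filter_insert, Finset.filter_singleton]
        cases P (s (e₀, false)) <;> cases P (s (e₀, true)) <;> simp
      rw [e3]
      rcases Sym2.eq_iff.1 hxy' with ⟨rfl, rfl⟩ | ⟨rfl, rfl⟩
      · rfl
      · exact List.Perm.countP_eq _ (List.Perm.swap ..)
    have := he P
    rw [Nat.card_congr e1, Nat.card_sum, e2] at this
    have e3 : (x :: y :: w.rotate n).countP P = [x, y].countP P + w.countP P := by
      rw [← (List.rotate_perm w n).countP_eq, ← List.countP_append]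
      rfl
    rw [e3, ← add_assoc]
    exact this
  · have h3 := h1 e₀
    have hy : part y = !part x := by
      rcases Sym2.eq_iff.1 hxy' with ⟨rfl, rfl⟩ | ⟨rfl, rfl⟩
      · exact h3
      · rw [h3, Bool.not_not]
    rw [List.map_cons, List.map_cons, hy, List.map_rotate, h2]

end Multigraph

/-! ### Decomposition of tame graphs into `M` and `X` -/

variable {C : GraphCollection}

theorem List.exists_map_eq_of_forall {α β : Type*} {f : α → β} {l : List β}
    (h : ∀ x ∈ l, ∃ y, f y = x) : ∃ l' : List α, l'.map f = l := by
  have : l ∈ Set.range (List.map f) := by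
    rw [Set.range_list_map]
    exact h
  exact this

namespace Multigraph

variable {V E L V' L' : Type}

/-- The leaves in a list of vertices. -/
def leaves (w : List (V ⊕ L)) : List L := w.filterMap Sum.getRight?

theorem mem_leaves {w : List (V ⊕ L)} {x : L} : x ∈ leaves w ↔ .inr x ∈ w := by
  simp only [leaves, List.mem_filterMap, Sum.getRight?_eq_some_iff]
  exact ⟨fun ⟨a, ha, h⟩ => h ▸ ha, fun h => ⟨_, h, rfl⟩⟩

theorem leaves_map (f : V → V') (h : L → L') (w : List (V ⊕ L)) :
    leaves (w.map (Sum.map f h)) = (leaves w).map h := by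
  rw [leaves, leaves, List.filterMap_map, List.map_filterMap]
  congr 1
  ext (x | x) <;> rfl

theorem leaves_append (w w' : List (V ⊕ L)) : leaves (w ++ w') = leaves w ++ leaves w' :=
  List.filterMap_append

theorem leaves_map_inr (l : List L) : leaves (l.map (Sum.inr : L → V ⊕ L)) = l := by
  rw [leaves, List.filterMap_map]
  exact List.filterMap_some

variable [Finite V] [Finite E] [Finite L]

/-- Vertices of colour `true` are labelled directly, those of colour `false` through pendant leaves,
each leaf occurring once in the word. By induction on the number of vertices, an interval block is
split off as a tensor factor. -/
theorem InCat.leaf_of_edgeless (hC : IsGraphCategory C)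
    (hM : ∀ k l, Even (k + l) → ⟨k, l, M k l⟩ ∈ C) (hX : ∀ k l, Even (k + l) → ⟨k, l, X k l⟩ ∈ C)
    {t : L → V} {w : List (V ⊕ L)} (hw : (leaves w).Nodup) (hw' : ∀ x, x ∈ leaves w)
    (hp : (edgeless V).IsPlane (w.map (Sum.elim id t)))
    (he : ∀ P : V → Bool, Even ((w.map (Sum.elim id t)).countP P)) {part : V → Bool}
    (hc : ∀ z ∈ w, part (Sum.elim id t z) = z.isLeft) : InCat C ((edgeless V).leaf t) w := by
  classical
  induction hn : Nat.card V using Nat.strong_induction_on generalizing V L with | _ n ih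
  rcases isEmpty_or_nonempty V with hV | hV
  · have : IsEmpty L := Function.isEmpty t
    have hw0 : w = [] := List.eq_nil_iff_forall_not_mem.2 fun z => isEmptyElim z
    subst hw0
    exact hC.mem_of_equiv hC.null_mem rfl rfl (Equiv.equivOfIsEmpty Empty (V ⊕ L))
      (Equiv.equivOfIsEmpty Empty (Empty ⊕ L)) (fun e => e.elim) (fun i => i.elim0)
      fun i => i.elim0
  obtain ⟨v, k, m, l, hk, hvl⟩ := hp.exists_block
  rw [← List.map_rotate] at hk
  suffices h : InCat C ((edgeless V).leaf t) (w.rotate k) by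
    obtain ⟨k', hk'⟩ := List.IsRotated.forall w k
    have := h.rotate hC k'
    rwa [hk'] at this
  replace hp := hp.rotate k
  rw [← List.map_rotate, hk] at hp
  have hperm := List.rotate_perm w k
  replace he : ∀ P : V → Bool, Even ((List.replicate m v ++ l).countP P) := fun P => by
    rw [← hk, (hperm.map _).countP_eq]
    exact he P
  obtain ⟨B, A, hBA, hB, hA⟩ := List.map_eq_append_iff.1 hk
  replace hc : ∀ z ∈ B ++ A, part (Sum.elim id t z) = z.isLeft := fun z hz =>
    hc z (by rwa [← hBA, hperm.mem_iff] at hz)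
  replace hw : (leaves (B ++ A)).Nodup := by
    rw [← hBA]
    exact ((hperm.filterMap _).nodup_iff).2 hw
  replace hw' : ∀ x, x ∈ leaves (B ++ A) := fun x => by
    rw [← hBA]
    exact ((hperm.filterMap _).mem_iff).2 (hw' x)
  rw [hBA]
  clear hBA hperm hk
  have hBv : ∀ z ∈ B, Sum.elim id t z = v := fun z hz => by
    have : Sum.elim id t z ∈ List.replicate m v := by rw [← hB]; exact List.mem_map_of_mem hz
    exact List.eq_of_mem_replicate this
  have hAv : ∀ z ∈ A, Sum.elim id t z ≠ v := fun z hz h => by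
    have : Sum.elim id t z ∈ l := by rw [← hA]; exact List.mem_map_of_mem hz
    exact hvl (h ▸ this)
  have hBm : B.length = m := by simpa using congrArg List.length hB
  have hm : Even m := by
    have h1 : l.countP (fun x => decide (x = v)) = 0 :=
      List.countP_eq_zero.2 fun x hx h => hvl (of_decide_eq_true h ▸ hx)
    have := he fun x => decide (x = v)
    rw [List.countP_append, h1, List.countP_replicate] at this
    simpa using this
  rw [leaves_append, List.nodup_append'] at hw
  simp only [leaves_append, List.mem_append] at hw'
  obtain ⟨B', hB'⟩ := List.exists_map_eq_of_forall (l := B)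
    (f := Sum.map (fun _ : Unit => v) (Subtype.val : {x // t x = v} → L)) (by
      rintro (x | x) hx
      · exact ⟨.inl (), congrArg Sum.inl (hBv _ hx).symm⟩
      · exact ⟨.inr ⟨x, hBv _ hx⟩, rfl⟩)
  obtain ⟨A', hA'⟩ := List.exists_map_eq_of_forall (l := A)
    (f := Sum.map (Subtype.val : {x // x ≠ v} → V) (Subtype.val : {x // t x ≠ v} → L)) (by
      rintro (x | x) hx
      · exact ⟨.inl ⟨x, hAv _ hx⟩, rfl⟩
      · exact ⟨.inr ⟨x, hAv _ hx⟩, rfl⟩)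
  have hB'm : B'.length = m := by rw [← hBm, ← hB', List.length_map]
  have hfull : ∀ x, t x = v → .inr x ∈ B := fun x hx =>
    (hw' x).elim mem_leaves.1 fun h => absurd hx (hAv _ (mem_leaves.1 h))
  have hfull' : ∀ x, t x ≠ v → .inr x ∈ A := fun x hx =>
    (hw' x).elim (fun h => absurd (hBv _ (mem_leaves.1 h)) hx) mem_leaves.1
  have h1 : InCat C ((edgeless Unit).leaf fun _ : {x // t x = v} => ()) B' := by
    -- For colour `false` all labels of the block are leaves and the factor is a star; for colour
    -- `true` there are no leaves at `v` and the factor is an `M`.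
    cases hv : part v
    · have hBr : ∀ z ∈ B', ∃ x, Sum.inr x = z := by
        intro z hz
        have hz' : Sum.map (fun _ => v) Subtype.val z ∈ B := hB' ▸ List.mem_map_of_mem hz
        have h2 := hc _ (List.mem_append_left _ hz')
        rw [hBv _ hz', hv] at h2
        rcases z with z | z
        · cases h2
        · exact ⟨z, rfl⟩
      obtain ⟨Y, rfl⟩ := List.exists_map_eq_of_forall hBr
      have hY : leaves B = Y.map Subtype.val := by
        rw [← hB', leaves_map, leaves_map_inr]
      rw [List.length_map] at hB'm
      have h3 := (X_mem_iff hC (zero_add m)).1 (hX 0 m (by rwa [zero_add]))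
      refine h3.star_congr hC (List.nodup_finRange _) ?_ List.mem_finRange (fun x => ?_)
        (by simp [hB'm])
      · have := hw.1
        rw [hY] at this
        exact this.of_map _
      · have := mem_leaves.2 (hfull x.1 x.2)
        rw [hY, List.mem_map] at this
        obtain ⟨y, hy, hyx⟩ := this
        rwa [← Subtype.ext hyx]
    · have : IsEmpty {x // t x = v} := ⟨fun x => by
        have := hc _ (List.mem_append_left _ (hfull x.1 x.2))
        rw [Sum.elim_inr, x.2, hv] at this
        cases this⟩
      have h3 := (M_mem_iff hC 0 m).1 (hM 0 m (by rwa [zero_add]))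
      refine h3.equiv hC (Equiv.sumEmpty Unit _).symm (Equiv.equivOfIsEmpty _ _)
        (fun e => e.elim) ?_
      rw [List.map_replicate, zero_add, eq_comm, List.eq_replicate_iff]
      refine ⟨hB'm, ?_⟩
      rintro (z | z) -
      · rfl
      · exact isEmptyElim z
  have hcomp : (A'.map (Sum.elim id fun x : {x // t x ≠ v} => (⟨t x, x.2⟩ : {x // x ≠ v}))).map
      Subtype.val = l := by
    rw [← hA, ← hA', List.map_map, List.map_map]
    refine List.map_congr_left ?_
    rintro (x | x) - <;> rfl
  have h2 : InCat C ((edgeless {x // x ≠ v}).leaf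
      fun x : {x // t x ≠ v} => (⟨t x, x.2⟩ : {x // x ≠ v})) A' := by
    refine ih (Nat.card {x // x ≠ v}) ?_ (V := {x // x ≠ v}) (L := {x // t x ≠ v}) ?_ ?_ ?_ ?_
      (part := fun x => part x) ?_ rfl
    · rw [← hn]
      exact Finite.card_subtype_lt (x := v) (by simp)
    · have := hw.2.1
      rw [← hA', leaves_map] at this
      exact this.of_map _
    · intro x
      have := mem_leaves.2 (hfull' x.1 x.2)
      rw [← hA', leaves_map, List.mem_map] at this
      obtain ⟨y, hy, hyx⟩ := this
      rwa [← Subtype.ext hyx]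
    · rw [← hcomp] at hp
      exact hp.of_append Subtype.val_injective _
    · intro P
      have h4 := he fun x => if h : x ≠ v then P ⟨x, h⟩ else false
      rw [List.countP_append, List.countP_replicate, ← hcomp, List.countP_map] at h4
      simp only [ne_eq, not_true_eq_false, dite_false, Bool.false_eq_true, if_false,
        zero_add] at h4
      convert h4 using 2
      ext x
      simp [x.2]
    · intro z hz
      have hz' : Sum.map Subtype.val Subtype.val z ∈ A := hA' ▸ List.mem_map_of_mem hz
      have := hc _ (List.mem_append_right _ hz')
      rcases z with z | z <;> exact this
  let φ : Unit ⊕ {x // x ≠ v} ≃ V := Equiv.ofBijective (Sum.elim (fun _ => v) Subtype.val) <| by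
    constructor
    · rintro (x | x) (y | y) h
      · rfl
      · exact absurd h.symm y.2
      · exact absurd h x.2
      · exact congrArg _ (Subtype.ext h)
    · intro x
      by_cases hx : x = v
      exacts [⟨.inl (), hx.symm⟩, ⟨.inr ⟨x, hx⟩, rfl⟩]
  refine (h1.leaf_sum hC h2).leaf_equiv hC φ (Equiv.equivOfIsEmpty _ _)
    (Equiv.sumCompl fun x => t x = v) (by rintro (e | e) <;> cases e) ?_ ?_
  · rintro (x | x)
    exacts [x.2, rfl]
  · rw [List.map_append, List.map_map, List.map_map, ← hB', ← hA']
    congr 1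
    · refine List.map_congr_left ?_
      rintro (x | x) - <;> rfl
    · refine List.map_congr_left ?_
      rintro (x | x) - <;> rfl

/-- Induction on the number of edges, for all sets `L` of leaves. After a cut, the end of colour
`false` receives a new pendant edge, with leaf `none`; capping this leaf with the end of colour
`true` turns the pendant edge into the removed one. -/
theorem InCat.leaf_of_isTame (hC : IsGraphCategory C)
    (hM : ∀ k l, Even (k + l) → ⟨k, l, M k l⟩ ∈ C) (hX : ∀ k l, Even (k + l) → ⟨k, l, X k l⟩ ∈ C)
    {g : Multigraph V E} {t : L → V} {w : List (V ⊕ L)} (hw : (leaves w).Nodup)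
    (hw' : ∀ x, x ∈ leaves w) (h : g.IsTame (w.map (Sum.elim id t)) (w.map Sum.isLeft)) :
    InCat C (g.leaf t) w := by
  classical
  induction hn : Nat.card E using Nat.strong_induction_on generalizing E L with | _ n ih
  rcases isEmpty_or_nonempty E with hE | hE
  · obtain ⟨hp, s, hs, he, part, h1, h2⟩ := h
    have hp' := hp.of_injective (g' := edgeless V) Function.injective_id
      (Equiv.equivOfIsEmpty Empty E) fun e => e.elim
    rw [List.map_id] at hp'
    have h3 := InCat.leaf_of_edgeless hC hM hX hw hw' hp' (fun P => by
      have := he P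
      rwa [Nat.card_of_isEmpty, zero_add] at this) (part := part) fun z hz => by
        rw [List.map_map, List.map_inj_left] at h2
        exact h2 z hz
    exact h3.leaf_equiv hC (Equiv.refl V) (Equiv.equivOfIsEmpty Empty E) (Equiv.refl L)
      (fun e => e.elim) (fun x => rfl) ((List.map_congr_left (by rintro (x | x) - <;> rfl)).trans
      (List.map_id w))
  obtain ⟨e₀, x, y, b, k, hxy, hT⟩ := h.cut
  suffices h : InCat C (g.leaf t) (w.rotate k) by
    obtain ⟨k', hk'⟩ := List.IsRotated.forall w k
    have := h.rotate hC k'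
    rwa [hk'] at this
  have hperm := List.rotate_perm w k
  replace hw : (leaves (w.rotate k)).Nodup := ((hperm.filterMap _).nodup_iff).2 hw
  replace hw' : ∀ x, x ∈ leaves (w.rotate k) := fun x => ((hperm.filterMap _).mem_iff).2 (hw' x)
  rw [← List.map_rotate, ← List.map_rotate] at hT
  generalize w.rotate k = u at *
  clear h hperm
  -- Here `a` is the end that stays a label and `z` the end with the new leaf; the two alternatives
  -- for `p` and `q` are their possible orders on the boundary.
  have key : ∀ (a z : V) (p q : V ⊕ Option L), g.ends e₀ = s(a, z) →
      (p = .inl a ∧ q = .inr none ∨ p = .inr none ∧ q = .inl a) → (g.delete e₀).IsTame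
        ((p :: q :: u.map (Sum.map id some)).map (Sum.elim id fun o => o.elim z t))
        ((p :: q :: u.map (Sum.map id some)).map Sum.isLeft) → InCat C (g.leaf t) u := by
    intro a z p q haz hpq hT
    have hl : leaves (p :: q :: u.map (Sum.map id some)) = none :: (leaves u).map some := by
      rw [← leaves_map id some]
      rcases hpq with ⟨rfl, rfl⟩ | ⟨rfl, rfl⟩ <;> rfl
    have h1 : InCat C ((g.delete e₀).leaf fun o : Option L => o.elim z t)
        (p :: q :: u.map (Sum.map id some)) := by
      refine ih (Nat.card {e // e ≠ e₀}) ?_ ?_ ?_ hT rfl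
      · rw [← hn]
        exact Finite.card_subtype_lt (x := e₀) (by simp)
      · rw [hl, List.nodup_cons]
        exact ⟨by simp, hw.map (Option.some_injective _)⟩
      · rw [hl]
        rintro (_ | x)
        · exact List.mem_cons_self
        · exact List.mem_cons_of_mem _ (List.mem_map_of_mem (hw' x))
    let f : V ⊕ Option L → V ⊕ L := Sum.elim Sum.inl fun o => o.elim (.inl a) Sum.inr
    let ψ : {e // e ≠ e₀} ⊕ Option L ≃ E ⊕ L :=
      { toFun := Sum.elim (fun e => .inl e.1) fun o => o.elim (.inl e₀) Sum.inr
        invFun := Sum.elim (fun e => if h : e = e₀ then .inr none else .inl ⟨e, h⟩)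
          fun x => .inr (some x)
        left_inv := by
          rintro (⟨e, he⟩ | _ | x)
          · simp [he]
          · simp
          · rfl
        right_inv := by
          rintro (e | x)
          · by_cases he : e = e₀ <;> simp [he]
          · rfl }
    have hf : ∀ c d, f c = f d ↔ merge ⊥ (.inl a) (.inr none) c d := by
      rintro (c | _ | c) (d | _ | d) <;> simp [f, merge_apply, eq_comm]
    refine h1.cap hC (f := f) ?_ ?_ ψ ?_ ?_
    · rintro (x | x)
      exacts [⟨.inl x, rfl⟩, ⟨.inr (some x), rfl⟩]
    · rcases hpq with ⟨rfl, rfl⟩ | ⟨rfl, rfl⟩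
      · exact hf
      · intro c d
        rw [hf, merge_apply, merge_apply, or_comm (a := _ ∧ _)]
    · rintro (e | _ | x)
      · exact Eq.symm (Sym2.map_map ..)
      · change (g.ends e₀).map Sum.inl = s(.inl z, .inl a)
        rw [haz]
        exact Sym2.eq_swap
      · rfl
    · rw [List.map_map]
      refine (List.map_congr_left ?_).trans (List.map_id u)
      rintro (x | x) - <;> rfl
  have hu1 : (u.map (Sum.map id some)).map (Sum.elim id fun o : Option L => o.elim x t) =
      u.map (Sum.elim id t) := by
    rw [List.map_map]
    exact List.map_congr_left (by rintro (x | x) - <;> rfl)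
  have hu2 : (u.map (Sum.map id some)).map (Sum.elim id fun o : Option L => o.elim y t) =
      u.map (Sum.elim id t) := by
    rw [List.map_map]
    exact List.map_congr_left (by rintro (x | x) - <;> rfl)
  have hu3 : (u.map (Sum.map (id : V → V) (some : L → Option L))).map Sum.isLeft =
      u.map Sum.isLeft := by
    rw [List.map_map]
    exact List.map_congr_left (by rintro (x | x) - <;> rfl)
  cases b
  · refine key y x (.inr none) (.inl y) (hxy.trans Sym2.eq_swap) (Or.inr ⟨rfl, rfl⟩) ?_
    rw [List.map_cons, List.map_cons, List.map_cons, List.map_cons, hu1, hu3]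
    exact hT
  · refine key x y (.inl x) (.inr none) hxy (Or.inl ⟨rfl, rfl⟩) ?_
    rw [List.map_cons, List.map_cons, List.map_cons, List.map_cons, hu2, hu3]
    exact hT

end Multigraph

/-- All labels have colour `true`, so the induction is entered with an empty set of leaves. -/
theorem mem_of_mem_tameCollection (hC : IsGraphCategory C)
    (hM : ∀ k l, Even (k + l) → ⟨k, l, M k l⟩ ∈ C) (hX : ∀ k l, Even (k + l) → ⟨k, l, X k l⟩ ∈ C) :
    tameCollection ⊆ C := by
  rintro ⟨k, l, K⟩ hK
  have := K.finiteV
  have := K.finiteE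
  have h := (mem_tameCollection.1 hK).tame
  rw [List.reverse_replicate] at h
  rw [K.mem_iff_inCat hC]
  generalize (List.ofFn K.a).reverse ++ List.ofFn K.b = w at h
  have hl : w.length = k + l := by simpa using h.length_eq
  have h1 : InCat C (K.graph.leaf (Empty.elim : Empty → K.V)) (w.map Sum.inl) := by
    refine InCat.leaf_of_isTame hC hM hX ?_ (fun x => x.elim) ?_
    · have : leaves (w.map (Sum.inl : K.V → K.V ⊕ Empty)) = [] :=
        List.eq_nil_iff_forall_not_mem.2 fun x => x.elim
      rw [this]
      exact List.nodup_nil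
    · rw [List.map_map, List.map_map]
      have e1 : w.map (Sum.elim id Empty.elim ∘ Sum.inl) = w := List.map_id w
      have e2 : w.map (Sum.isLeft ∘ (Sum.inl : K.V → K.V ⊕ Empty)) =
          List.replicate k true ++ List.replicate l true := by
        rw [List.replicate_append_replicate, ← hl]
        exact List.map_const
      rwa [e1, e2]
  refine h1.equiv hC (Equiv.sumEmpty K.V Empty) (Equiv.sumEmpty K.E Empty) ?_ ?_
  · rintro (e | e)
    · exact (congrFun Sym2.map_id' _).symm.trans (Eq.symm (Sym2.map_map ..))
    · cases e
  · rw [List.map_map]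
    exact List.map_id w

theorem proposition3 :
    contractionClosure
        {⟨2, 2, BilabelledGraph.M 2 2⟩, ⟨2, 2, BilabelledGraph.edgeConnecter⟩} =
      generatedCategory
        {K | ∃ k l : ℕ, Even (k + l) ∧
          (K = ⟨k, l, BilabelledGraph.M k l⟩ ∨ K = ⟨k, l, BilabelledGraph.X k l⟩)} ∧
    generatedCategory
        {K | ∃ k l : ℕ, Even (k + l) ∧
          (K = ⟨k, l, BilabelledGraph.M k l⟩ ∨ K = ⟨k, l, BilabelledGraph.X k l⟩)} =
      {K : Σ k l : ℕ, BilabelledGraph k l |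
        K.2.2.IsPlanar ∧ (∀ v : K.2.2.V, Even (K.2.2.extDegree v)) ∧
          K.2.2.IsLabelBipartite} := by
  have h1 := contractionClosure_subset_tameCollection
  have h2 : tameCollection ⊆ generatedCategory {K | ∃ k l : ℕ, Even (k + l) ∧
      (K = ⟨k, l, M k l⟩ ∨ K = ⟨k, l, X k l⟩)} := by
    intro K hK C hC hS
    exact mem_of_mem_tameCollection hC (fun k l h => hS ⟨k, l, h, Or.inl rfl⟩)
      (fun k l h => hS ⟨k, l, h, Or.inr rfl⟩) hK
  have h3 : generatedCategory {K | ∃ k l : ℕ, Even (k + l) ∧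
      (K = ⟨k, l, M k l⟩ ∨ K = ⟨k, l, X k l⟩)} ⊆
      contractionClosure {⟨2, 2, M 2 2⟩, ⟨2, 2, edgeConnecter⟩} := by
    intro K hK C hC hP hS
    have hM : ∀ k l, Even (k + l) → ⟨k, l, M k l⟩ ∈ C := fun k l =>
      M_mem_of_M_two_two hC (hS (Or.inl rfl))
    refine hK C hC ?_
    rintro _ ⟨k, l, hkl, rfl | rfl⟩
    · exact hM k l hkl
    · exact X_mem_of_edgeConnecter hC hP (hM 0 0 (by decide)) (hS (Or.inr rfl)) hkl
  -- Three inclusions in a cycle make all three collections equal.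
  exact ⟨(h1.trans h2).antisymm h3, (h3.trans h1).antisymm h2⟩
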